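/- Let $k$ be a commutative ring, $\otimes=\otimes_k$. For a Hopf algebra $A$ over $k$ (product $m$, coproduct $\Delta(a)=a_1\otimes a_2$, counit $\varepsilon$) let $\mathrm{Reg}^1(A)$ be the group of convolution invertible linear maps $\mu:A\to k$ with $\mu(1)=1$, and $\mathrm{Reg}^2(A)$ the group of convolution invertible linear maps $\sigma:A\otimes A\to k$ with $\sigma(a,1)=\varepsilon(a)=\sigma(1,a)$. A left $2$-cocycle is a $\sigma\in\mathrm{Reg}^2(A)$ with $\sigma(a_1,b_1)\sigma(a_2b_2,c)=\sigma(b_1,c_1)\sigma(a,b_2c_2)$ for all $a,b,c\in A$. Call $\mu\in\mathrm{Reg}^1(A)$ lazy if $\mu(a_1)a_2=a_1\mu(a_2)$, and $\sigma\in\mathrm{Reg}^2(A)$ lazy if $\sigma(a_1,b_1)a_2b_2=\sigma(a_2,b_2)a_1b_1$. The lazy left $2$-cocycles form a group $Z^2_L(A)$ under convolution, the elements $\partial(\mu)(a,b)=\mu(a_1)\mu(b_1)\mu^{-1}(a_2b_2)$ with $\mu\in\mathrm{Reg}^1(A)$ lazy form a central subgroup $B^2_L(A)$, and $H^2_L(A)=Z^2_L(A)/B^2_L(A)$.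 For Hopf algebras $A$, $B$, an $A$-$B$-biGalois object is a non-zero algebra $Z$ with a left $A$-comodule algebra structure $z\mapsto z_{(-1)}\otimes z_{(0)}$ and a right $B$-comodule algebra structure $z\mapsto z_{(0)}\otimes z_{(1)}$ making $Z$ an $A$-$B$-bicomodule, such that ${}^{\mathrm{co}A}Z=k=Z^{\mathrm{co}B}$ and the maps $Z\otimes Z\to A\otimes Z$, $x\otimes y\mapsto x_{(-1)}\otimes x_{(0)}y$, and $Z\otimes Z\to Z\otimes B$, $x\otimes y\mapsto xy_{(0)}\otimes y_{(1)}$, are bijective. Let $A$ and $B$ be Hopf algebras over $k$ that are flat as $k$-modules. (1) If there exists an $A$-$B$-biGalois object that is faithfully flat as a $k$-module, then there is a group isomorphism $H^2_L(A)\cong H^2_L(B)$. (2) In particular, if the categories of right comodules $\mathrm{Comod}(A)$ and $\mathrm{Comod}(B)$ are equivalent as $k$-linear monoidal categories, then $H^2_L(A)\cong H^2_L(B)$ as groups. (3) In particular, if $B$ is isomorphic to a twist ${}_\omega A_{\omega^{-1}}$ of $A$ by a left $2$-cocycle $\omega$ of $A$ (the coalgebra $A$ with product $a\cdot b=\omega(a_1,b_1)\,a_2b_2\,\omega^{-1}(a_3,b_3)$),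 then $H^2_L(A)\cong H^2_L(B)$ as groups. -/

import Mathlib

open TensorProduct Coalgebra CategoryTheory

universe u v w z

noncomputable section

namespace LazyCohomology

/-! ### Convolution algebras -/

section Convolution

variable {k : Type u} [CommRing k]

/-- Precomposition with a coalgebra morphism `h : C → D`, as a morphism of convolution monoids
`Hom(D, R) → Hom(C, R)`. -/
def convPull {C : Type v} {D : Type w} [AddCommGroup C] [Module k C] [Coalgebra k C]
    [AddCommGroup D] [Module k D] [Coalgebra k D] (h : C →ₗc[k] D) :
    WithConv (D →ₗ[k] k) →* WithConv (C →ₗ[k] k) where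
  toFun f := WithConv.toConv (f.ofConv ∘ₗ h.toLinearMap)
  map_one' := by
    ext x
    simp [LinearMap.convOne_def]
  map_mul' f g := by
    apply WithConv.ext
    exact LinearMap.convMul_comp_coalgHom_distrib f g h

/-- A scalar valued linear form viewed as an `A`-valued one through the unit `k → A`, as a
morphism of convolution monoids `Hom(C, k) → Hom(C, A)`. -/
def convScalar (A : Type v) [Ring A] [Algebra k A] {C : Type w} [AddCommGroup C] [Module k C]
    [Coalgebra k C] : WithConv (C →ₗ[k] k) →* WithConv (C →ₗ[k] A) where
  toFun f := WithConv.toConv (Algebra.linearMap k A ∘ₗ f.ofConv)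
  map_one' := by
    ext x
    simp [LinearMap.convOne_def]
  map_mul' f g := by
    apply WithConv.ext
    exact LinearMap.algHom_comp_convMul_distrib (Algebra.ofId k A) f g

theorem convPull_apply {C : Type v} {D : Type w} [AddCommGroup C] [Module k C] [Coalgebra k C]
    [AddCommGroup D] [Module k D] [Coalgebra k D] (h : C →ₗc[k] D) (f : WithConv (D →ₗ[k] k))
    (x : C) : convPull h f x = f (h x) := rfl

theorem convScalar_apply (A : Type v) [Ring A] [Algebra k A] {C : Type w} [AddCommGroup C]
    [Module k C] [Coalgebra k C] (f : WithConv (C →ₗ[k] k)) (x : C) :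
    convScalar A f x = algebraMap k A (f x) := rfl

/-- The coalgebra morphism `id ⊗ ε : C ⊗ D → C`. -/
def fstHom (k : Type u) [CommRing k] (C : Type v) (D : Type w) [AddCommGroup C] [Module k C]
    [Coalgebra k C] [AddCommGroup D] [Module k D] [Coalgebra k D] : C ⊗[k] D →ₗc[k] C :=
  (Coalgebra.TensorProduct.rid k k C : C ⊗[k] k →ₗc[k] C).comp
    (Coalgebra.TensorProduct.map (CoalgHom.id k C) (counitCoalgHom k D))

/-- The coalgebra morphism `ε ⊗ id : C ⊗ D → D`. -/
def sndHom (k : Type u) [CommRing k] (C : Type v) (D : Type w) [AddCommGroup C] [Module k C]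
    [Coalgebra k C] [AddCommGroup D] [Module k D] [Coalgebra k D] : C ⊗[k] D →ₗc[k] D :=
  (Coalgebra.TensorProduct.lid k D : k ⊗[k] D →ₗc[k] D).comp
    (Coalgebra.TensorProduct.map (counitCoalgHom k C) (CoalgHom.id k D))

theorem fstHom_tmul {C : Type v} {D : Type w} [AddCommGroup C] [Module k C]
    [Coalgebra k C] [AddCommGroup D] [Module k D] [Coalgebra k D] (c : C) (d : D) :
    fstHom k C D (c ⊗ₜ d) = counit (R := k) d • c := by
  simp [fstHom]

theorem sndHom_tmul {C : Type v} {D : Type w} [AddCommGroup C] [Module k C]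
    [Coalgebra k C] [AddCommGroup D] [Module k D] [Coalgebra k D] (c : C) (d : D) :
    sndHom k C D (c ⊗ₜ d) = counit (R := k) c • d := by
  simp [sndHom]

theorem sum_smul_counit {D : Type w} [AddCommGroup D] [Module k D] [Coalgebra k D] (d : D) :
    ∑ j ∈ (ℛ k d).index, counit (R := k) ((ℛ k d).right j) • (ℛ k d).left j = d := by
  have h := congrArg (TensorProduct.rid k D) (sum_tmul_counit_eq (R := k) (ℛ k d))
  simpa only [map_sum, TensorProduct.rid_tmul, one_smul] using h

theorem convMul_tmul {C : Type v} {D : Type w} [AddCommGroup C] [Module k C]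
    [Coalgebra k C] [AddCommGroup D] [Module k D] [Coalgebra k D]
    (F G : WithConv (C ⊗[k] D →ₗ[k] k)) (c : C) (d : D) :
    (F * G) (c ⊗ₜ d) = ∑ i ∈ (ℛ k c).index, ∑ j ∈ (ℛ k d).index,
      F ((ℛ k c).left i ⊗ₜ (ℛ k d).left j) * G ((ℛ k c).right i ⊗ₜ (ℛ k d).right j) := by
  rw [LinearMap.convMul_apply, TensorProduct.comul_tmul]
  conv_lhs => rw [← (ℛ k c).eq, ← (ℛ k d).eq]
  simp [TensorProduct.sum_tmul, TensorProduct.tmul_sum]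
  try exact Finset.sum_comm

variable {A : Type v} [Ring A] [Bialgebra k A]

theorem commute_fst {C : Type w} [AddCommGroup C] [Module k C] [Coalgebra k C]
    {D : Type z} [AddCommGroup D] [Module k D] [Coalgebra k D] (g : C →ₗc[k] A)
    (ω : WithConv (C →ₗ[k] k))
    (hω : Commute (convScalar A ω) (WithConv.toConv g.toLinearMap))
    (f : WithConv (A ⊗[k] D →ₗ[k] k)) :
    Commute (convPull (fstHom k C D) ω)
      (convPull (Coalgebra.TensorProduct.map g (CoalgHom.id k D)) f) := by
  have key1 : ∀ (x : C) (d : D), (convPull (fstHom k C D) ω *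
      convPull (Coalgebra.TensorProduct.map g (CoalgHom.id k D)) f) (x ⊗ₜ d) =
      f ((convScalar A ω * WithConv.toConv g.toLinearMap) x ⊗ₜ d) := by
    intro x d
    have hd := Coalgebra.sum_counit_smul (ℛ k d)
    rw [convMul_tmul, (ℛ k x).convMul_apply, TensorProduct.sum_tmul, map_sum]
    refine Finset.sum_congr rfl fun i _ => ?_
    conv_rhs => rw [← hd]
    simp [convPull_apply, convScalar_apply, fstHom_tmul, TensorProduct.tmul_sum,
      ← Algebra.smul_def, ← TensorProduct.smul_tmul']
    refine Finset.sum_congr rfl fun j _ => ?_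
    ring
  have key2 : ∀ (x : C) (d : D), (convPull (Coalgebra.TensorProduct.map g (CoalgHom.id k D)) f *
      convPull (fstHom k C D) ω) (x ⊗ₜ d) =
      f ((WithConv.toConv g.toLinearMap * convScalar A ω) x ⊗ₜ d) := by
    intro x d
    have hd := sum_smul_counit (k := k) d
    rw [convMul_tmul, (ℛ k x).convMul_apply, TensorProduct.sum_tmul, map_sum]
    refine Finset.sum_congr rfl fun i _ => ?_
    conv_rhs => rw [← hd]
    simp [convPull_apply, convScalar_apply, fstHom_tmul, TensorProduct.tmul_sum,
      ← Algebra.commutes, ← Algebra.smul_def, ← TensorProduct.smul_tmul']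
    refine Finset.sum_congr rfl fun j _ => ?_
    ring
  apply WithConv.ext
  ext x d
  have h := (key1 x d).trans (Eq.trans (by rw [hω.eq]) (key2 x d).symm)
  exact h

theorem commute_snd {C : Type w} [AddCommGroup C] [Module k C] [Coalgebra k C]
    {D : Type z} [AddCommGroup D] [Module k D] [Coalgebra k D] (g : C →ₗc[k] A)
    (ω : WithConv (C →ₗ[k] k))
    (hω : Commute (convScalar A ω) (WithConv.toConv g.toLinearMap))
    (f : WithConv (D ⊗[k] A →ₗ[k] k)) :
    Commute (convPull (sndHom k D C) ω)
      (convPull (Coalgebra.TensorProduct.map (CoalgHom.id k D) g) f) := by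
  have key1 : ∀ (x : C) (d : D), (convPull (sndHom k D C) ω *
      convPull (Coalgebra.TensorProduct.map (CoalgHom.id k D) g) f) (d ⊗ₜ x) =
      f (d ⊗ₜ (convScalar A ω * WithConv.toConv g.toLinearMap) x) := by
    intro x d
    have hd := Coalgebra.sum_counit_smul (ℛ k d)
    rw [convMul_tmul, (ℛ k x).convMul_apply, TensorProduct.tmul_sum, map_sum, Finset.sum_comm]
    refine Finset.sum_congr rfl fun i _ => ?_
    conv_rhs => rw [← hd]
    simp [convPull_apply, convScalar_apply, sndHom_tmul, TensorProduct.sum_tmul,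
      ← Algebra.smul_def, ← TensorProduct.smul_tmul', Finset.mul_sum]
    refine Finset.sum_congr rfl fun j _ => ?_
    ring
  have key2 : ∀ (x : C) (d : D), (convPull (Coalgebra.TensorProduct.map (CoalgHom.id k D) g) f *
      convPull (sndHom k D C) ω) (d ⊗ₜ x) =
      f (d ⊗ₜ (WithConv.toConv g.toLinearMap * convScalar A ω) x) := by
    intro x d
    have hd := sum_smul_counit (k := k) d
    rw [convMul_tmul, (ℛ k x).convMul_apply, TensorProduct.tmul_sum, map_sum, Finset.sum_comm]
    refine Finset.sum_congr rfl fun i _ => ?_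
    conv_rhs => rw [← hd]
    simp [convPull_apply, convScalar_apply, sndHom_tmul, TensorProduct.sum_tmul,
      ← Algebra.commutes, ← Algebra.smul_def, ← TensorProduct.smul_tmul', Finset.mul_sum]
    refine Finset.sum_congr rfl fun j _ => ?_
    ring
  apply WithConv.ext
  ext d x
  have h := (key1 x d).trans (Eq.trans (by rw [hω.eq]) (key2 x d).symm)
  exact h

end Convolution

/-! ### Lazy cochains, lazy cocycles and the second lazy cohomology group -/

section Cohomology

variable (k : Type u) [CommRing k] (A : Type v) [Ring A] [Bialgebra k A]

/-- The group of convolution invertible linear forms on `A`. -/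
abbrev Conv1 : Type (max u v) := (WithConv (A →ₗ[k] k))ˣ

/-- The group of convolution invertible linear forms on `A ⊗ A`. -/
abbrev Conv2 : Type (max u v) := (WithConv (A ⊗[k] A →ₗ[k] k))ˣ

/-- The group of convolution invertible linear forms on `A ⊗ A ⊗ A`. -/
abbrev Conv3 : Type (max u v) := (WithConv ((A ⊗[k] A) ⊗[k] A →ₗ[k] k))ˣ

/-- `Reg¹(A)`: the convolution invertible `μ : A → k` with `μ(1) = 1`. -/
def Reg1 : Subgroup (Conv1 k A) where
  carrier := {μ | (μ : WithConv (A →ₗ[k] k)) (1 : A) = 1}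
  one_mem' := by simp
  mul_mem' {a b} ha hb := by
    simp only [Set.mem_ofPred_eq] at ha hb ⊢
    simp [Algebra.TensorProduct.one_def, ha, hb]
  inv_mem' {a} ha := by
    simp only [Set.mem_ofPred_eq] at ha ⊢
    have h : ((a * a⁻¹ : Conv1 k A) : WithConv (A →ₗ[k] k)) (1 : A) = 1 := by
      rw [mul_inv_cancel]; simp
    rw [Units.val_mul, LinearMap.convMul_apply, Bialgebra.comul_one,
      Algebra.TensorProduct.one_def] at h
    simpa only [TensorProduct.map_tmul, LinearMap.mul'_apply, ha, one_mul] using h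

/-- The coalgebra morphism `a ↦ a ⊗ 1`. -/
def inlHom : A →ₗc[k] A ⊗[k] A where
  toLinearMap := (TensorProduct.mk k A A).flip 1
  counit_comp := by ext; simp
  map_comp_comul := by
    ext a
    simp [← (ℛ k a).eq, TensorProduct.sum_tmul, Algebra.TensorProduct.one_def]

/-- The coalgebra morphism `a ↦ 1 ⊗ a`. -/
def inrHom : A →ₗc[k] A ⊗[k] A where
  toLinearMap := TensorProduct.mk k A A 1
  counit_comp := by ext; simp
  map_comp_comul := by
    ext a
    simp [← (ℛ k a).eq, TensorProduct.tmul_sum, Algebra.TensorProduct.one_def]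

theorem mem_reg2_iff (σ : Conv2 k A) :
    (σ ∈ {σ : Conv2 k A |
      ∀ a : A, (σ : WithConv (A ⊗[k] A →ₗ[k] k)) (a ⊗ₜ 1) = counit (R := k) a ∧
        (σ : WithConv (A ⊗[k] A →ₗ[k] k)) (1 ⊗ₜ a) = counit (R := k) a}) ↔
    Units.map (convPull (inlHom k A)) σ = 1 ∧ Units.map (convPull (inrHom k A)) σ = 1 := by
  constructor
  · intro h
    refine ⟨Units.ext (WithConv.ext (LinearMap.ext fun a => ?_)),
      Units.ext (WithConv.ext (LinearMap.ext fun a => ?_))⟩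
    · exact (h a).1
    · exact (h a).2
  · intro h a
    have h1 := congrArg (fun f : Conv1 k A => (f : WithConv (A →ₗ[k] k)) a) h.1
    have h2 := congrArg (fun f : Conv1 k A => (f : WithConv (A →ₗ[k] k)) a) h.2
    exact ⟨h1, h2⟩

/-- `Reg²(A)`: the convolution invertible `σ : A ⊗ A → k` with `σ(a, 1) = ε(a) = σ(1, a)`. -/
def Reg2 : Subgroup (Conv2 k A) where
  carrier := {σ | ∀ a : A, (σ : WithConv (A ⊗[k] A →ₗ[k] k)) (a ⊗ₜ 1) = counit (R := k) a ∧
    (σ : WithConv (A ⊗[k] A →ₗ[k] k)) (1 ⊗ₜ a) = counit (R := k) a}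
  one_mem' := by intro a; simp
  mul_mem' {σ τ} hσ hτ := by
    rw [mem_reg2_iff] at hσ hτ ⊢
    simp only [map_mul, hσ.1, hσ.2, hτ.1, hτ.2, mul_one, and_self]
  inv_mem' {σ} hσ := by
    rw [mem_reg2_iff] at hσ ⊢
    simp only [map_inv, hσ.1, hσ.2, inv_one, and_self]

variable {k A}

/-- The lazy elements `μ` of `Hom(A, k)`: those with `μ * id = id * μ` in `Hom(A, A)`. -/
def IsLazy1 (μ : Conv1 k A) : Prop :=
  Commute (convScalar A (μ : WithConv (A →ₗ[k] k))) (WithConv.toConv (LinearMap.id : A →ₗ[k] A))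

/-- The lazy elements `σ` of `Hom(A ⊗ A, k)`: those with `σ * m = m * σ` in `Hom(A ⊗ A, A)`,
where `m` is the product of `A`; that is `σ(a₁, b₁) a₂ b₂ = σ(a₂, b₂) a₁ b₁`. -/
def IsLazy2 (σ : Conv2 k A) : Prop :=
  Commute (convScalar A (σ : WithConv (A ⊗[k] A →ₗ[k] k))) (WithConv.toConv (LinearMap.mul' k A))

/-- The form `σ(a, b) ε(c)` on `A ⊗ A ⊗ A`. -/
def face12 : Conv2 k A →* Conv3 k A :=
  Units.map (convPull (fstHom k (A ⊗[k] A) A))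

/-- The form `σ(ab, c)` on `A ⊗ A ⊗ A`. -/
def faceMulLeft : Conv2 k A →* Conv3 k A :=
  Units.map (convPull (Coalgebra.TensorProduct.map (Bialgebra.mulCoalgHom k A) (CoalgHom.id k A)))

/-- The form `ε(a) σ(b, c)` on `A ⊗ A ⊗ A`. -/
def face23 : Conv2 k A →* Conv3 k A :=
  (Units.map (convPull (Coalgebra.TensorProduct.assoc k k A A A :
    (A ⊗[k] A) ⊗[k] A →ₗc[k] A ⊗[k] (A ⊗[k] A)))).comp
    (Units.map (convPull (sndHom k A (A ⊗[k] A))))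

/-- The form `σ(a, bc)` on `A ⊗ A ⊗ A`. -/
def faceMulRight : Conv2 k A →* Conv3 k A :=
  (Units.map (convPull (Coalgebra.TensorProduct.assoc k k A A A :
    (A ⊗[k] A) ⊗[k] A →ₗc[k] A ⊗[k] (A ⊗[k] A)))).comp
    (Units.map (convPull (Coalgebra.TensorProduct.map (CoalgHom.id k A)
      (Bialgebra.mulCoalgHom k A))))

theorem face12_apply (σ : Conv2 k A) (a b c : A) :
    (face12 σ).val ((a ⊗ₜ b) ⊗ₜ c) = counit (R := k) c * σ.val (a ⊗ₜ b) := by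
  change σ.val.ofConv (fstHom k (A ⊗[k] A) A ((a ⊗ₜ b) ⊗ₜ c)) = _
  rw [fstHom_tmul, map_smul, smul_eq_mul]

theorem faceMulLeft_apply (σ : Conv2 k A) (a b c : A) :
    (faceMulLeft σ).val ((a ⊗ₜ b) ⊗ₜ c) = σ.val ((a * b) ⊗ₜ c) := rfl

theorem face23_apply (σ : Conv2 k A) (a b c : A) :
    (face23 σ).val ((a ⊗ₜ b) ⊗ₜ c) = counit (R := k) a * σ.val (b ⊗ₜ c) := by
  change σ.val.ofConv (sndHom k A (A ⊗[k] A) (a ⊗ₜ (b ⊗ₜ c))) = _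
  rw [sndHom_tmul, map_smul, smul_eq_mul]

theorem faceMulRight_apply (σ : Conv2 k A) (a b c : A) :
    (faceMulRight σ).val ((a ⊗ₜ b) ⊗ₜ c) = σ.val (a ⊗ₜ (b * c)) := rfl

/-- The left 2-cocycle identity `σ(a₁, b₁) σ(a₂ b₂, c) = σ(b₁, c₁) σ(a, b₂ c₂)`, as an equality
of convolution products of linear forms on `A ⊗ A ⊗ A`. -/
def IsLeftCocycle (σ : Conv2 k A) : Prop :=
  face12 σ * faceMulLeft σ = face23 σ * faceMulRight σ

/-- The form `∂μ = (μ ⊗ μ) * (μ⁻¹ ∘ m)`, i.e. `∂μ(a, b) = μ(a₁) μ(b₁) μ⁻¹(a₂ b₂)`. Here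
`μ ⊗ μ` is written as the convolution product of `μ ∘ (id ⊗ ε)` and `μ ∘ (ε ⊗ id)`. -/
def coboundary (μ : Conv1 k A) : Conv2 k A :=
  Units.map (convPull (fstHom k A A)) μ * Units.map (convPull (sndHom k A A)) μ *
    Units.map (convPull (Bialgebra.mulCoalgHom k A)) μ⁻¹

variable (k A)

/-- `Reg¹_L(A)`: the lazy elements of `Reg¹(A)`. -/
def Reg1L : Subgroup (Conv1 k A) where
  carrier := {μ | μ ∈ Reg1 k A ∧ IsLazy1 μ}
  one_mem' := ⟨one_mem _, by simp [IsLazy1]⟩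
  mul_mem' {a b} ha hb := ⟨mul_mem ha.1 hb.1, by
    have := Commute.mul_left ha.2 hb.2
    simpa [IsLazy1] using this⟩
  inv_mem' {a} ha := ⟨inv_mem ha.1, by
    have h : Commute ((Units.map (convScalar A) a : (WithConv (A →ₗ[k] A))ˣ) :
      WithConv (A →ₗ[k] A)) _ := ha.2
    exact h.units_inv_left⟩

/-- `Reg²_L(A)`: the lazy elements of `Reg²(A)`. -/
def Reg2L : Subgroup (Conv2 k A) where
  carrier := {σ | σ ∈ Reg2 k A ∧ IsLazy2 σ}
  one_mem' := ⟨one_mem _, by simp [IsLazy2]⟩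
  mul_mem' {a b} ha hb := ⟨mul_mem ha.1 hb.1, by
    have := Commute.mul_left ha.2 hb.2
    simpa [IsLazy2] using this⟩
  inv_mem' {a} ha := ⟨inv_mem ha.1, by
    have h : Commute ((Units.map (convScalar A) a : (WithConv (A ⊗[k] A →ₗ[k] A))ˣ) :
      WithConv (A ⊗[k] A →ₗ[k] A)) _ := ha.2
    exact h.units_inv_left⟩

variable {k A}

theorem IsLazy2.commute_left {σ : Conv2 k A} (hσ : IsLazy2 σ) (τ : Conv2 k A) :
    Commute (face12 σ) (faceMulLeft τ) :=
  Units.ext (commute_fst (Bialgebra.mulCoalgHom k A) σ.val hσ τ.val)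

theorem IsLazy2.commute_right {σ : Conv2 k A} (hσ : IsLazy2 σ) (τ : Conv2 k A) :
    Commute (face23 σ) (faceMulRight τ) := by
  have h : Commute (Units.map (convPull (sndHom k A (A ⊗[k] A))) σ)
      (Units.map (convPull (Coalgebra.TensorProduct.map (CoalgHom.id k A)
        (Bialgebra.mulCoalgHom k A))) τ) :=
    Units.ext (commute_snd (Bialgebra.mulCoalgHom k A) σ.val hσ τ.val)
  exact h.map (Units.map (convPull (Coalgebra.TensorProduct.assoc k k A A A :
    (A ⊗[k] A) ⊗[k] A →ₗc[k] A ⊗[k] (A ⊗[k] A))))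

theorem IsLazy1.commute_fst {μ : Conv1 k A} (hμ : IsLazy1 μ) (f : Conv2 k A) :
    Commute (Units.map (convPull (fstHom k A A)) μ) f := by
  have h := LazyCohomology.commute_fst (D := A) (CoalgHom.id k A) μ.val hμ f.val
  have e : convPull (Coalgebra.TensorProduct.map (CoalgHom.id k A) (CoalgHom.id k A)) f.val
      = f.val := by
    apply WithConv.ext
    ext a b
    rfl
  rw [e] at h
  exact Units.ext h

theorem IsLazy1.commute_snd {μ : Conv1 k A} (hμ : IsLazy1 μ) (f : Conv2 k A) :
    Commute (Units.map (convPull (sndHom k A A)) μ) f := by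
  have h := LazyCohomology.commute_snd (D := A) (CoalgHom.id k A) μ.val hμ f.val
  have e : convPull (Coalgebra.TensorProduct.map (CoalgHom.id k A) (CoalgHom.id k A)) f.val
      = f.val := by
    apply WithConv.ext
    ext a b
    rfl
  rw [e] at h
  exact Units.ext h

/-- Composition with a linear form `f : A → k`, as a map `Hom(C, A) → Hom(C, k)`. -/
theorem comp_scalar_mul {C : Type w} [AddCommGroup C] [Module k C] [Coalgebra k C]
    (f : A →ₗ[k] k) (ω : WithConv (C →ₗ[k] k)) (g : C →ₗ[k] A) :
    f ∘ₗ (convScalar A ω * WithConv.toConv g).ofConv =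
      (ω * WithConv.toConv (f ∘ₗ g)).ofConv := by
  ext x
  have h1 := (ℛ k x).convMul_apply (convScalar A ω) (WithConv.toConv g)
  have h2 := (ℛ k x).convMul_apply ω (WithConv.toConv (f ∘ₗ g))
  rw [h2, LinearMap.comp_apply, h1]
  simp [convScalar_apply, ← Algebra.smul_def]

theorem comp_mul_scalar {C : Type w} [AddCommGroup C] [Module k C] [Coalgebra k C]
    (f : A →ₗ[k] k) (ω : WithConv (C →ₗ[k] k)) (g : C →ₗ[k] A) :
    f ∘ₗ (WithConv.toConv g * convScalar A ω).ofConv =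
      (WithConv.toConv (f ∘ₗ g) * ω).ofConv := by
  ext x
  have h1 := (ℛ k x).convMul_apply (WithConv.toConv g) (convScalar A ω)
  have h2 := (ℛ k x).convMul_apply (WithConv.toConv (f ∘ₗ g)) ω
  rw [h2, LinearMap.comp_apply, h1]
  simp [convScalar_apply, ← Algebra.commutes, ← Algebra.smul_def, mul_comm]

theorem IsLazy1.commute {μ : Conv1 k A} (hμ : IsLazy1 μ) (φ : Conv1 k A) : Commute μ φ := by
  refine Units.ext (WithConv.ext ?_)
  have h1 := comp_scalar_mul φ.val.ofConv μ.val LinearMap.id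
  have h2 := comp_mul_scalar φ.val.ofConv μ.val LinearMap.id
  rw [hμ.eq, h2] at h1
  exact h1.symm

theorem IsLazy2.commute_mul {σ : Conv2 k A} (hσ : IsLazy2 σ) (μ : Conv1 k A) :
    Commute σ (Units.map (convPull (Bialgebra.mulCoalgHom k A)) μ) := by
  refine Units.ext (WithConv.ext ?_)
  have h1 := comp_scalar_mul μ.val.ofConv σ.val (LinearMap.mul' k A)
  have h2 := comp_mul_scalar μ.val.ofConv σ.val (LinearMap.mul' k A)
  rw [hσ.eq, h2] at h1
  exact h1.symm

theorem coboundary_one : coboundary (1 : Conv1 k A) = 1 := by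
  simp [coboundary]

theorem coboundary_mul {μ φ : Conv1 k A} (hμ : IsLazy1 μ) (hφ : IsLazy1 φ) :
    coboundary (μ * φ) = coboundary μ * coboundary φ := by
  have e : (μ * φ)⁻¹ = μ⁻¹ * φ⁻¹ := (hμ.commute φ).mul_inv
  have c1 := hμ.commute_snd (Units.map (convPull (fstHom k A A)) φ)
  simp only [coboundary, e, map_mul]
  generalize Units.map (convPull (Bialgebra.mulCoalgHom k A)) μ⁻¹ = x
  generalize Units.map (convPull (Bialgebra.mulCoalgHom k A)) φ⁻¹ = y
  have c2 := hφ.commute_fst x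
  have c3 := hφ.commute_snd x
  rw [c1.symm.mul_mul_mul_comm]
  exact ((c2.mul_left c3).mul_mul_mul_comm _ _)

theorem coboundary_inv {μ : Conv1 k A} (hμ : IsLazy1 μ) (hμ' : IsLazy1 μ⁻¹) :
    coboundary μ⁻¹ = (coboundary μ)⁻¹ := by
  rw [eq_inv_iff_mul_eq_one, ← coboundary_mul hμ' hμ, inv_mul_cancel, coboundary_one]

theorem IsLazy2.commute_coboundary {σ : Conv2 k A} (hσ : IsLazy2 σ) {μ : Conv1 k A}
    (hμ : IsLazy1 μ) : Commute σ (coboundary μ) :=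
  ((hμ.commute_fst σ).symm.mul_right (hμ.commute_snd σ).symm).mul_right (hσ.commute_mul _)

variable (k A)

/-- `Z²_L(A)`: the group of lazy (left) 2-cocycles, `Z²(A) ∩ Reg²_L(A)`. -/
def ZL2 : Subgroup (Conv2 k A) where
  carrier := {σ | σ ∈ Reg2L k A ∧ IsLeftCocycle σ}
  one_mem' := ⟨one_mem _, by simp [IsLeftCocycle]⟩
  mul_mem' {σ τ} hσ hτ := ⟨mul_mem hσ.1 hτ.1, by
    have h1 : face12 σ * faceMulLeft σ = _ := hσ.2
    have h2 : face12 τ * faceMulLeft τ = _ := hτ.2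
    simp only [IsLeftCocycle, map_mul]
    rw [(hτ.1.2.commute_left σ).mul_mul_mul_comm, h1, h2,
      (hτ.1.2.commute_right σ).symm.mul_mul_mul_comm]⟩
  inv_mem' {σ} hσ := ⟨inv_mem hσ.1, by
    have h : face12 σ * faceMulLeft σ = _ := hσ.2
    simp only [IsLeftCocycle, map_inv]
    rw [← (hσ.1.2.commute_left σ).mul_inv, h, (hσ.1.2.commute_right σ).mul_inv]⟩

/-- `B²_L(A)`: the elements of `Z²_L(A)` of the form `∂μ` with `μ ∈ Reg¹_L(A)`. -/
def BL2 : Subgroup (ZL2 k A) where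
  carrier := {σ | ∃ μ ∈ Reg1L k A, (σ : Conv2 k A) = coboundary μ}
  one_mem' := ⟨1, one_mem _, coboundary_one.symm⟩
  mul_mem' {σ τ} := by
    rintro ⟨μ, hμ, h⟩ ⟨φ, hφ, h'⟩
    exact ⟨μ * φ, mul_mem hμ hφ, by rw [coboundary_mul hμ.2 hφ.2, ← h, ← h']; rfl⟩
  inv_mem' {σ} := by
    rintro ⟨μ, hμ, h⟩
    exact ⟨μ⁻¹, inv_mem hμ, by rw [coboundary_inv hμ.2 (inv_mem hμ).2, ← h]; rfl⟩

instance BL2_normal : (BL2 k A).Normal where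
  conj_mem := by
    rintro σ ⟨μ, hμ, h⟩ τ
    refine ⟨μ, hμ, ?_⟩
    have c := τ.2.1.2.commute_coboundary hμ.2
    simp only [Subgroup.coe_mul, Subgroup.coe_inv, h]
    rw [c.eq, mul_inv_cancel_right]

/-- The second lazy cohomology group `H²_L(A) = Z²_L(A) / B²_L(A)`. -/
abbrev HL2 : Type (max u v) := ZL2 k A ⧸ BL2 k A

end Cohomology
/-! ### biGalois objects -/

section Galois

variable {k : Type u} [CommRing k]

/-- `β : Z → A ⊗ Z` makes the algebra `Z` a left `A`-Galois object: `Z` is a non-zero left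
`A`-comodule algebra whose algebra of coinvariants is `k`, and the map
`x ⊗ y ↦ x₍₋₁₎ ⊗ x₍₀₎ y` is bijective. -/
structure IsLeftGalois {A : Type v} [Ring A] [Bialgebra k A] {Z : Type w} [Ring Z] [Algebra k Z]
    (β : Z →ₐ[k] A ⊗[k] Z) : Prop where
  coassoc : (TensorProduct.assoc k A A Z).toLinearMap ∘ₗ (comul (R := k) (A := A)).rTensor Z ∘ₗ
    β.toLinearMap = β.toLinearMap.lTensor A ∘ₗ β.toLinearMap
  counit_comp : (TensorProduct.lid k Z).toLinearMap ∘ₗ (counit (R := k) (A := A)).rTensor Z ∘ₗ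
    β.toLinearMap = LinearMap.id
  nontrivial : Nontrivial Z
  injective_algebraMap : Function.Injective (algebraMap k Z)
  coinvariants : ∀ z : Z, β z = 1 ⊗ₜ[k] z ↔ z ∈ Set.range (algebraMap k Z)
  bijective : Function.Bijective ((LinearMap.mul' k Z).lTensor A ∘ₗ
    (TensorProduct.assoc k A Z Z).toLinearMap ∘ₗ β.toLinearMap.rTensor Z :
      Z ⊗[k] Z →ₗ[k] A ⊗[k] Z)

/-- `ρ : Z → Z ⊗ B` makes the algebra `Z` a right `B`-Galois object: `Z` is a non-zero right
`B`-comodule algebra whose algebra of coinvariants is `k`, and the map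
`x ⊗ y ↦ x y₍₀₎ ⊗ y₍₁₎` is bijective. -/
structure IsRightGalois {B : Type v} [Ring B] [Bialgebra k B] {Z : Type w} [Ring Z] [Algebra k Z]
    (ρ : Z →ₐ[k] Z ⊗[k] B) : Prop where
  coassoc : (TensorProduct.assoc k Z B B).toLinearMap ∘ₗ ρ.toLinearMap.rTensor B ∘ₗ
    ρ.toLinearMap = (comul (R := k) (A := B)).lTensor Z ∘ₗ ρ.toLinearMap
  counit_comp : (TensorProduct.rid k Z).toLinearMap ∘ₗ (counit (R := k) (A := B)).lTensor Z ∘ₗ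
    ρ.toLinearMap = LinearMap.id
  nontrivial : Nontrivial Z
  injective_algebraMap : Function.Injective (algebraMap k Z)
  coinvariants : ∀ z : Z, ρ z = z ⊗ₜ[k] 1 ↔ z ∈ Set.range (algebraMap k Z)
  bijective : Function.Bijective ((LinearMap.mul' k Z).rTensor B ∘ₗ
    (TensorProduct.assoc k Z Z B).symm.toLinearMap ∘ₗ ρ.toLinearMap.lTensor Z :
      Z ⊗[k] Z →ₗ[k] Z ⊗[k] B)

/-- `Z` with the coactions `β` and `ρ` is an `A`-`B`-biGalois object: it is a left `A`-Galois
object, a right `B`-Galois object and an `A`-`B`-bicomodule. -/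
structure IsBiGalois {A : Type v} [Ring A] [Bialgebra k A] {B : Type w} [Ring B] [Bialgebra k B]
    {Z : Type z} [Ring Z] [Algebra k Z] (β : Z →ₐ[k] A ⊗[k] Z) (ρ : Z →ₐ[k] Z ⊗[k] B) : Prop where
  left : IsLeftGalois β
  right : IsRightGalois ρ
  bicomodule : (TensorProduct.assoc k A Z B).toLinearMap ∘ₗ β.toLinearMap.rTensor B ∘ₗ
    ρ.toLinearMap = ρ.toLinearMap.lTensor A ∘ₗ β.toLinearMap

end Galois

/-! ### Cocycle twists -/

/-- `B` is isomorphic to the twist of `A` by some 2-cocycle `ω`, the bialgebra with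
the same coalgebra as `A` and with product `ω(a₁, b₁) a₂ b₂ ω⁻¹(a₃, b₃)`. The product is the
convolution product `ω * m * ω⁻¹` in `Hom(A ⊗ A, A)`. -/
def IsCocycleTwist (k : Type u) [CommRing k] (A : Type v) [Ring A] [Bialgebra k A]
    (B : Type w) [Ring B] [Bialgebra k B] : Prop :=
  ∃ ω : Conv2 k A, ω ∈ Reg2 k A ∧ IsLeftCocycle ω ∧ ∃ e : A ≃ₗc[k] B, e 1 = 1 ∧ ∀ a b : A,
    e a * e b = e ((convScalar A ω.val * WithConv.toConv (LinearMap.mul' k A) *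
      convScalar A (ω⁻¹).val) (a ⊗ₜ[k] b))

/-! ### The monoidal category of comodules -/

/-- A right comodule over `A`. -/
structure Comod (k A : Type u) [CommRing k] [Ring A] [Bialgebra k A] : Type (u + 1) where
  carrier : Type u
  [addCommGroup : AddCommGroup carrier]
  [module : Module k carrier]
  coact : carrier →ₗ[k] carrier ⊗[k] A
  coassoc : (TensorProduct.assoc k carrier A A).toLinearMap ∘ₗ coact.rTensor A ∘ₗ coact =
    (comul (R := k) (A := A)).lTensor carrier ∘ₗ coact
  counit_comp : (TensorProduct.rid k carrier).toLinearMap ∘ₗ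
    (counit (R := k) (A := A)).lTensor carrier ∘ₗ coact = LinearMap.id

namespace Comod

variable {k A : Type u} [CommRing k] [Ring A] [Bialgebra k A]

instance : CoeSort (Comod k A) (Type u) := ⟨Comod.carrier⟩

instance (V : Comod k A) : AddCommGroup V := V.addCommGroup

instance (V : Comod k A) : Module k V := V.module

/-- A colinear map. -/
@[ext]
structure Hom (V W : Comod k A) : Type u where
  lin : V →ₗ[k] W
  colinear : W.coact ∘ₗ lin = lin.rTensor A ∘ₗ V.coact

instance : Category (Comod k A) where
  Hom V W := Hom V W
  id V := ⟨LinearMap.id, by simp⟩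
  comp f g := ⟨g.lin ∘ₗ f.lin, by
    rw [← LinearMap.comp_assoc, g.colinear, LinearMap.comp_assoc, f.colinear,
      LinearMap.rTensor_comp, LinearMap.comp_assoc]⟩

@[ext]
theorem hom_ext {V W : Comod k A} {f g : V ⟶ W} (h : Hom.lin f = Hom.lin g) : f = g :=
  Hom.ext h

@[simp]
theorem id_lin (V : Comod k A) : Hom.lin (𝟙 V) = LinearMap.id := rfl

@[simp]
theorem comp_lin {V W X : Comod k A} (f : V ⟶ W) (g : W ⟶ X) :
    Hom.lin (f ≫ g) = Hom.lin g ∘ₗ Hom.lin f := rfl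

/-- Colinear maps as a submodule of the linear maps. -/
def homSubmodule (V W : Comod k A) : Submodule k (V →ₗ[k] W) where
  carrier := {f | W.coact ∘ₗ f = f.rTensor A ∘ₗ V.coact}
  add_mem' {f g} hf hg := by
    simp only [Set.mem_ofPred_eq] at hf hg ⊢
    rw [LinearMap.comp_add, hf, hg, LinearMap.rTensor_add, LinearMap.add_comp]
  zero_mem' := by simp
  smul_mem' r f hf := by
    simp only [Set.mem_ofPred_eq] at hf ⊢
    rw [LinearMap.comp_smul, hf, LinearMap.rTensor_smul, LinearMap.smul_comp]

/-- Morphisms of comodules are the elements of `homSubmodule`. -/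
def homEquiv (V W : Comod k A) : (V ⟶ W) ≃ homSubmodule V W where
  toFun f := ⟨Hom.lin f, Hom.colinear f⟩
  invFun f := ⟨f.1, f.2⟩

instance (V W : Comod k A) : AddCommGroup (V ⟶ W) := (homEquiv V W).addCommGroup

instance (V W : Comod k A) : Module k (V ⟶ W) := (homEquiv V W).module k

@[simp]
theorem add_lin {V W : Comod k A} (f g : V ⟶ W) :
    Hom.lin (f + g) = Hom.lin f + Hom.lin g := rfl

@[simp]
theorem smul_lin {V W : Comod k A} (r : k) (f : V ⟶ W) :
    Hom.lin (r • f) = r • Hom.lin f := rfl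

instance : Preadditive (Comod k A) where
  add_comp _ _ _ f g h := hom_ext (LinearMap.comp_add f.lin g.lin h.lin)
  comp_add _ _ _ f g h := hom_ext (LinearMap.add_comp f.lin h.lin g.lin)

instance : Linear k (Comod k A) where
  homModule V W := (homEquiv V W).module k
  smul_comp _ _ _ r f g := hom_ext (LinearMap.comp_smul g.lin r f.lin)
  comp_smul _ _ _ f r g := hom_ext (LinearMap.smul_comp r g.lin f.lin)

/-- The forgetful functor to `k`-modules. -/
def forgetful (k A : Type u) [CommRing k] [Ring A] [Bialgebra k A] :
    Comod k A ⥤ ModuleCat.{u} k where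
  obj V := ModuleCat.of k V
  map f := ModuleCat.ofHom (Hom.lin f)

instance : (forgetful k A).Faithful where
  map_injective h := hom_ext (congrArg ModuleCat.Hom.hom h)

/-- The codiagonal coaction `v ⊗ w ↦ v₀ ⊗ w₀ ⊗ v₁ w₁` on the tensor product. -/
def tensorCoact (V W : Comod k A) : V ⊗[k] W →ₗ[k] (V ⊗[k] W) ⊗[k] A :=
  (LinearMap.mul' k A).lTensor (V ⊗[k] W) ∘ₗ
    (TensorProduct.tensorTensorTensorComm k V A W A).toLinearMap ∘ₗ
      TensorProduct.map V.coact W.coact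

theorem coassoc_apply (V : Comod k A) (v : V) :
    TensorProduct.assoc k V A A (V.coact.rTensor A (V.coact v)) =
      (comul (R := k) (A := A)).lTensor V (V.coact v) :=
  LinearMap.congr_fun V.coassoc v

theorem counit_apply (V : Comod k A) (v : V) :
    TensorProduct.rid k V ((counit (R := k) (A := A)).lTensor V (V.coact v)) = v :=
  LinearMap.congr_fun V.counit_comp v

/-- The product map `(V ⊗ R) ⊗ (W ⊗ R) → (V ⊗ W) ⊗ R` for an algebra `R`. -/
def mulRight (V W R : Type u) [AddCommGroup V] [Module k V] [AddCommGroup W] [Module k W] [Ring R]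
    [Algebra k R] : (V ⊗[k] R) ⊗[k] (W ⊗[k] R) →ₗ[k] (V ⊗[k] W) ⊗[k] R :=
  (LinearMap.mul' k R).lTensor (V ⊗[k] W) ∘ₗ
    (TensorProduct.tensorTensorTensorComm k V R W R).toLinearMap

@[simp]
theorem mulRight_tmul {V W R : Type u} [AddCommGroup V] [Module k V] [AddCommGroup W] [Module k W]
    [Ring R] [Algebra k R] (v : V) (w : W) (a b : R) :
    mulRight (k := k) V W R ((v ⊗ₜ a) ⊗ₜ (w ⊗ₜ b)) = (v ⊗ₜ w) ⊗ₜ (a * b) := rfl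

theorem tensorCoact_tmul (V W : Comod k A) (v : V) (w : W) :
    tensorCoact V W (v ⊗ₜ w) = mulRight V W A (V.coact v ⊗ₜ W.coact w) := rfl

theorem rTensor_tensorCoact (V W : Comod k A) (t : V ⊗[k] A) (s : W ⊗[k] A) :
    TensorProduct.assoc k (V ⊗[k] W) A A ((tensorCoact V W).rTensor A (mulRight V W A (t ⊗ₜ s))) =
      mulRight V W (A ⊗[k] A) (TensorProduct.assoc k V A A (V.coact.rTensor A t) ⊗ₜ
        TensorProduct.assoc k W A A (W.coact.rTensor A s)) := by
  induction t with
  | zero => simp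
  | add x y hx hy => simp only [TensorProduct.add_tmul, map_add, hx, hy]
  | tmul v a =>
    induction s with
    | zero => simp
    | add x y hx hy => simp only [TensorProduct.tmul_add, map_add, hx, hy]
    | tmul w b =>
      rw [mulRight_tmul, LinearMap.rTensor_tmul, LinearMap.rTensor_tmul, LinearMap.rTensor_tmul,
        tensorCoact_tmul]
      generalize V.coact v = t
      generalize W.coact w = s
      induction t with
      | zero => simp
      | add x y hx hy => simp only [TensorProduct.add_tmul, map_add, hx, hy]
      | tmul v a =>
        induction s with
        | zero => simp
        | add x y hx hy => simp only [TensorProduct.tmul_add, TensorProduct.add_tmul, map_add,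
            hx, hy]
        | tmul w b => simp

theorem lTensor_mulRight {V W R S : Type u} [AddCommGroup V] [Module k V] [AddCommGroup W]
    [Module k W] [Ring R] [Algebra k R] [Ring S] [Algebra k S] (f : R →ₐ[k] S)
    (t : V ⊗[k] R) (s : W ⊗[k] R) :
    f.toLinearMap.lTensor (V ⊗[k] W) (mulRight V W R (t ⊗ₜ s)) =
      mulRight V W S (f.toLinearMap.lTensor V t ⊗ₜ f.toLinearMap.lTensor W s) := by
  induction t with
  | zero => simp
  | add x y hx hy => simp only [TensorProduct.add_tmul, map_add, hx, hy]
  | tmul v a =>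
    induction s with
    | zero => simp
    | add x y hx hy => simp only [TensorProduct.tmul_add, map_add, hx, hy]
    | tmul w b => simp

theorem rid_mulRight {V W : Type u} [AddCommGroup V] [Module k V] [AddCommGroup W]
    [Module k W] (t : V ⊗[k] k) (s : W ⊗[k] k) :
    TensorProduct.rid k (V ⊗[k] W) (mulRight V W k (t ⊗ₜ s)) =
      TensorProduct.rid k V t ⊗ₜ TensorProduct.rid k W s := by
  induction t with
  | zero => simp
  | add x y hx hy => simp only [TensorProduct.add_tmul, map_add, hx, hy]
  | tmul v a =>
    induction s with
    | zero => simp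
    | add x y hx hy => simp only [TensorProduct.tmul_add, map_add, hx, hy]
    | tmul w b =>
      simp only [mulRight_tmul, TensorProduct.rid_tmul, TensorProduct.smul_tmul_smul]

theorem rTensor_mulRight {V W V' W' R : Type u} [AddCommGroup V] [Module k V] [AddCommGroup W]
    [Module k W] [AddCommGroup V'] [Module k V'] [AddCommGroup W'] [Module k W'] [Ring R]
    [Algebra k R] (f : V →ₗ[k] V') (g : W →ₗ[k] W') (t : V ⊗[k] R) (s : W ⊗[k] R) :
    (TensorProduct.map f g).rTensor R (mulRight V W R (t ⊗ₜ s)) =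
      mulRight V' W' R (f.rTensor R t ⊗ₜ g.rTensor R s) := by
  induction t with
  | zero => simp
  | add x y hx hy => simp only [TensorProduct.add_tmul, map_add, hx, hy]
  | tmul v a =>
    induction s with
    | zero => simp
    | add x y hx hy => simp only [TensorProduct.tmul_add, map_add, hx, hy]
    | tmul w b => simp

/-- The tensor product of two comodules. -/
def tensor (V W : Comod k A) : Comod k A where
  carrier := V ⊗[k] W
  coact := tensorCoact V W
  coassoc := by
    ext v w
    simp only [TensorProduct.AlgebraTensorModule.curry_apply, LinearMap.restrictScalars_self,
      TensorProduct.curry_apply, LinearMap.comp_apply, LinearEquiv.coe_coe]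
    rw [tensorCoact_tmul, rTensor_tensorCoact, coassoc_apply, coassoc_apply]
    exact (lTensor_mulRight (Bialgebra.comulAlgHom k A) _ _).symm
  counit_comp := by
    ext v w
    simp only [TensorProduct.AlgebraTensorModule.curry_apply, LinearMap.restrictScalars_self,
      TensorProduct.curry_apply, LinearMap.comp_apply, LinearEquiv.coe_coe]
    rw [tensorCoact_tmul]
    refine (congrArg (TensorProduct.rid k (V ⊗[k] W))
      (lTensor_mulRight (Bialgebra.counitAlgHom k A) (V.coact v) (W.coact w))).trans ?_
    rw [rid_mulRight]
    exact congrArg₂ (fun x y => x ⊗ₜ[k] y) (counit_apply V v) (counit_apply W w)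

theorem map_colinear {V W V' W' : Comod k A} (f : V ⟶ V') (g : W ⟶ W') :
    tensorCoact V' W' ∘ₗ TensorProduct.map (Hom.lin f) (Hom.lin g) =
      (TensorProduct.map (Hom.lin f) (Hom.lin g)).rTensor A ∘ₗ tensorCoact V W := by
  ext v w
  have hf := LinearMap.congr_fun (Hom.colinear f) v
  have hg := LinearMap.congr_fun (Hom.colinear g) w
  simp only [LinearMap.comp_apply] at hf hg
  simp only [TensorProduct.AlgebraTensorModule.curry_apply, LinearMap.restrictScalars_self,
    TensorProduct.curry_apply, LinearMap.comp_apply, TensorProduct.map_tmul]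
  rw [tensorCoact_tmul, tensorCoact_tmul, rTensor_mulRight, hf, hg]

/-- The trivial comodule `k`, with coaction `r ↦ r ⊗ 1`. -/
def trivial (k A : Type u) [CommRing k] [Ring A] [Bialgebra k A] : Comod k A where
  carrier := k
  coact := (TensorProduct.mk k k A).flip 1
  coassoc := by ext; simp [Algebra.TensorProduct.one_def]
  counit_comp := by ext; simp

/-- A colinear bijection is an isomorphism of comodules. -/
def isoOfLinearEquiv {V W : Comod k A} (e : V ≃ₗ[k] W)
    (h : W.coact ∘ₗ e.toLinearMap = e.toLinearMap.rTensor A ∘ₗ V.coact) : V ≅ W where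
  hom := ⟨e.toLinearMap, h⟩
  inv := ⟨e.symm.toLinearMap, by
    ext w
    obtain ⟨v, rfl⟩ := e.surjective w
    have hv := LinearMap.congr_fun h v
    simp only [LinearMap.comp_apply, LinearEquiv.coe_coe] at hv ⊢
    rw [hv, ← LinearMap.rTensor_comp_apply]
    simp⟩
  hom_inv_id := by
    apply hom_ext; ext; simp
  inv_hom_id := by
    apply hom_ext; ext; simp

theorem assoc_colinear (U V W : Comod k A) :
    (tensor U (tensor V W)).coact ∘ₗ (TensorProduct.assoc k U V W).toLinearMap =
      (TensorProduct.assoc k U V W).toLinearMap.rTensor A ∘ₗ (tensor (tensor U V) W).coact := by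
  apply TensorProduct.ext_threefold
  intro u v w
  change mulRight U (V ⊗[k] W) A (U.coact u ⊗ₜ mulRight V W A (V.coact v ⊗ₜ W.coact w)) =
    (TensorProduct.assoc k U V W).toLinearMap.rTensor A
      (mulRight (U ⊗[k] V) W A (mulRight U V A (U.coact u ⊗ₜ V.coact v) ⊗ₜ W.coact w))
  generalize U.coact u = r
  generalize V.coact v = s
  generalize W.coact w = t
  induction r with
  | zero => simp
  | add x y hx hy => simp only [TensorProduct.add_tmul, map_add, hx, hy]
  | tmul u a =>
    induction s with
    | zero => simp
    | add x y hx hy => simp only [TensorProduct.tmul_add, TensorProduct.add_tmul, map_add, hx, hy]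
    | tmul v b =>
      induction t with
      | zero => simp
      | add x y hx hy => simp only [TensorProduct.tmul_add, map_add, hx, hy]
      | tmul w c => simp [mul_assoc]

theorem lid_colinear (V : Comod k A) :
    V.coact ∘ₗ (TensorProduct.lid k V).toLinearMap =
      (TensorProduct.lid k V).toLinearMap.rTensor A ∘ₗ (tensor (trivial k A) V).coact := by
  apply TensorProduct.ext'
  intro r v
  change V.coact (TensorProduct.lid k V (r ⊗ₜ v)) =
    (TensorProduct.lid k V).toLinearMap.rTensor A
      (mulRight k V A ((r ⊗ₜ 1) ⊗ₜ V.coact v))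
  rw [TensorProduct.lid_tmul, map_smul]
  generalize V.coact v = t
  induction t with
  | zero => simp
  | add x y hx hy => simp only [TensorProduct.tmul_add, smul_add, map_add, hx, hy]
  | tmul v a => simp [TensorProduct.smul_tmul']

theorem rid_colinear (V : Comod k A) :
    V.coact ∘ₗ (TensorProduct.rid k V).toLinearMap =
      (TensorProduct.rid k V).toLinearMap.rTensor A ∘ₗ (tensor V (trivial k A)).coact := by
  apply TensorProduct.ext'
  intro v r
  change V.coact (TensorProduct.rid k V (v ⊗ₜ r)) =
    (TensorProduct.rid k V).toLinearMap.rTensor A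
      (mulRight V k A (V.coact v ⊗ₜ (r ⊗ₜ 1)))
  rw [TensorProduct.rid_tmul, map_smul]
  generalize V.coact v = t
  induction t with
  | zero => simp
  | add x y hx hy => simp only [TensorProduct.add_tmul, smul_add, map_add, hx, hy]
  | tmul v a => simp [TensorProduct.smul_tmul']

instance : MonoidalCategoryStruct (Comod k A) where
  tensorObj V W := tensor V W
  whiskerLeft V _ _ f := ⟨(Hom.lin f).lTensor V, map_colinear (𝟙 V) f⟩
  whiskerRight f W := ⟨(Hom.lin f).rTensor W, map_colinear f (𝟙 W)⟩
  tensorHom f g := ⟨TensorProduct.map (Hom.lin f) (Hom.lin g), map_colinear f g⟩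
  tensorUnit := trivial k A
  associator U V W := isoOfLinearEquiv (V := tensor (tensor U V) W) (W := tensor U (tensor V W))
    (TensorProduct.assoc k U V W) (assoc_colinear U V W)
  leftUnitor V := isoOfLinearEquiv (V := tensor (trivial k A) V) (TensorProduct.lid k V)
    (lid_colinear V)
  rightUnitor V := isoOfLinearEquiv (V := tensor V (trivial k A)) (TensorProduct.rid k V)
    (rid_colinear V)

instance : MonoidalCategory (Comod k A) :=
  Monoidal.induced (forgetful k A)
  { μIso _ _ := .refl _
    εIso := .refl _
    associator_eq _ _ _ := by ext1; exact TensorProduct.ext (TensorProduct.ext rfl)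
    leftUnitor_eq _ := by ext1; exact TensorProduct.ext rfl
    rightUnitor_eq _ := by ext1; exact TensorProduct.ext rfl }

end Comod

/-- `A` and `B` are monoidally co-Morita equivalent: their categories of comodules are
equivalent as `k`-linear monoidal categories. -/
def MonoidallyCoMoritaEquivalent (k A B : Type u) [CommRing k] [Ring A] [Bialgebra k A]
    [Ring B] [Bialgebra k B] : Prop :=
  ∃ F : Comod k A ≌ Comod k B, Nonempty F.functor.Monoidal ∧ F.functor.Additive ∧
    F.functor.Linear k

end LazyCohomology

end

/-!
Forms on tensor powers of `A` and of `B` act on tensor powers of a biGalois object `Z` through its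
two coactions. The Galois maps are bijective and the coinvariants trivial, so a lazy form on `A ⊗ A`
deforms the product of `Z` in the same way as exactly one lazy form on `B ⊗ B`. This correspondence
is multiplicative, and it preserves cocycles and coboundaries because both are detected on `Z`.

A monoidal equivalence can be used directly: lazy forms on `A` and on `A ⊗ A` are the natural
endomorphisms of the identity functor and of the tensor product of `Comod k A`, and the cocycle and
coboundary conditions are conditions on these. A cocycle twist gives such an equivalence, which is
the identity on the underlying modules with the cocycle as its monoidal structure.
-/

noncomputable section

namespace LazyCohomology

section Coaction

variable {k : Type*} [CommRing k] {M M' N N' C C' D D' P Q : Type*}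
  [AddCommGroup M] [Module k M] [AddCommGroup M'] [Module k M']
  [AddCommGroup N] [Module k N] [AddCommGroup N'] [Module k N']
  [AddCommGroup C] [Module k C] [AddCommGroup C'] [Module k C']
  [AddCommGroup D] [Module k D] [AddCommGroup D'] [Module k D']
  [Ring P] [Algebra k P] [Ring Q] [Algebra k Q]

/-- The endomorphism `x ↦ x₀ τ(x₁)` of `M`, where `δ x = x₀ ⊗ x₁`. -/
def act (δ : M →ₗ[k] M ⊗[k] C) (τ : WithConv (C →ₗ[k] k)) : M →ₗ[k] M :=
  (TensorProduct.rid k M).toLinearMap ∘ₗ τ.ofConv.lTensor M ∘ₗ δ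

/-- The map `x ↦ m(x₀) φ(x₁)` with values in an algebra, where `δ x = x₀ ⊗ x₁`. For `δ` a
comultiplication this is the convolution product. -/
def convCoact (δ : M →ₗ[k] M ⊗[k] C) (m : M →ₗ[k] P) (φ : C →ₗ[k] P) : M →ₗ[k] P :=
  LinearMap.mul' k P ∘ₗ TensorProduct.map m φ ∘ₗ δ

/-- `δ` is a right coaction on `M` of `C` with comultiplication `Δ` and counit `ε`. These are
explicit because a left coaction of a coalgebra is encoded as a right coaction with respect to the
opposite comultiplication. -/
structure IsCoaction (Δ : C →ₗ[k] C ⊗[k] C) (ε : C →ₗ[k] k) (δ : M →ₗ[k] M ⊗[k] C) : Prop where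
  coassoc : (TensorProduct.assoc k M C C).toLinearMap ∘ₗ δ.rTensor C ∘ₗ δ = Δ.lTensor M ∘ₗ δ
  counit_comp : (TensorProduct.rid k M).toLinearMap ∘ₗ ε.lTensor M ∘ₗ δ = LinearMap.id

/-- The outer tensor product of two coactions, or of two comultiplications. -/
def outer (δ : M →ₗ[k] M ⊗[k] C) (δ' : M' →ₗ[k] M' ⊗[k] C') :
    M ⊗[k] M' →ₗ[k] (M ⊗[k] M') ⊗[k] (C ⊗[k] C') :=
  (TensorProduct.tensorTensorTensorComm k M C M' C').toLinearMap ∘ₗ TensorProduct.map δ δ'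

/-- The opposite comultiplication `c ↦ c₂ ⊗ c₁`, where `Δ c = c₁ ⊗ c₂`. -/
def opComul (Δ : C →ₗ[k] C ⊗[k] C) : C →ₗ[k] C ⊗[k] C :=
  (TensorProduct.comm k C C).toLinearMap ∘ₗ Δ

/-- The two coactions `δ` and `lam` on `M` commute. -/
def CoactionsCommute (δ : M →ₗ[k] M ⊗[k] C) (lam : M →ₗ[k] M ⊗[k] D) : Prop :=
  lam.rTensor C ∘ₗ δ = (TensorProduct.rightComm k M C D).toLinearMap ∘ₗ δ.rTensor D ∘ₗ lam

theorem IsCoaction.coassoc_apply {Δ : C →ₗ[k] C ⊗[k] C} {ε : C →ₗ[k] k} {δ : M →ₗ[k] M ⊗[k] C}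
    (h : IsCoaction Δ ε δ) (x : M) :
    TensorProduct.assoc k M C C (δ.rTensor C (δ x)) = Δ.lTensor M (δ x) :=
  LinearMap.congr_fun h.coassoc x

theorem comp_act [Coalgebra k C] (δ : M →ₗ[k] M ⊗[k] C) (τ : WithConv (C →ₗ[k] k)) (m : M →ₗ[k] P) :
    m ∘ₗ act δ τ = convCoact δ m (convScalar P τ).ofConv := by
  have scalar_mul : m ∘ₗ (TensorProduct.rid k M).toLinearMap ∘ₗ τ.ofConv.lTensor M =
      LinearMap.mul' k P ∘ₗ TensorProduct.map m (convScalar P τ).ofConv := by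
    ext x c
    simp only [TensorProduct.AlgebraTensorModule.curry_apply, LinearMap.restrictScalars_self,
      TensorProduct.curry_apply, LinearMap.comp_apply, LinearMap.lTensor_tmul,
      LinearEquiv.coe_coe, TensorProduct.rid_tmul, map_smul, TensorProduct.map_tmul,
      LinearMap.mul'_apply]
    exact (Algebra.smul_def _ _).trans (Algebra.commutes _ _)
  exact congrArg (· ∘ₗ δ) scalar_mul

theorem algHom_comp_convCoact (b : P →ₐ[k] Q) (δ : M →ₗ[k] M ⊗[k] C) (m : M →ₗ[k] P)
    (φ : C →ₗ[k] P) :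
    b.toLinearMap ∘ₗ convCoact δ m φ =
      convCoact δ (b.toLinearMap ∘ₗ m) (b.toLinearMap ∘ₗ φ) := by
  have map_mul' : b.toLinearMap ∘ₗ LinearMap.mul' k P ∘ₗ TensorProduct.map m φ =
      LinearMap.mul' k Q ∘ₗ TensorProduct.map (b.toLinearMap ∘ₗ m) (b.toLinearMap ∘ₗ φ) := by
    ext; simp
  exact congrArg (· ∘ₗ δ) map_mul'

theorem IsCoaction.act_comp_act {Δ : C →ₗ[k] C ⊗[k] C} {ε : C →ₗ[k] k} {δ : M →ₗ[k] M ⊗[k] C}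
    (h : IsCoaction Δ ε δ) (τ φ : WithConv (C →ₗ[k] k)) :
    act δ τ ∘ₗ act δ φ = act δ (.toConv (convCoact Δ τ.ofConv φ.ofConv)) := by
  have contract : act δ τ ∘ₗ (TensorProduct.rid k M).toLinearMap ∘ₗ φ.ofConv.lTensor M =
      (TensorProduct.rid k M).toLinearMap ∘ₗ φ.ofConv.lTensor M ∘ₗ (act δ τ).rTensor C := by
    ext; simp
  have contract' : (TensorProduct.rid k M).toLinearMap ∘ₗ φ.ofConv.lTensor M ∘ₗ
      ((TensorProduct.rid k M).toLinearMap ∘ₗ τ.ofConv.lTensor M).rTensor C =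
      (TensorProduct.rid k M).toLinearMap ∘ₗ (LinearMap.mul' k k ∘ₗ
        TensorProduct.map τ.ofConv φ.ofConv).lTensor M ∘ₗ
          (TensorProduct.assoc k M C C).toLinearMap := by
    ext; simp [smul_smul, mul_comm]
  ext x
  calc act δ τ (act δ φ x)
      = TensorProduct.rid k M (φ.ofConv.lTensor M ((act δ τ).rTensor C (δ x))) :=
        LinearMap.congr_fun contract (δ x)
    _ = TensorProduct.rid k M ((LinearMap.mul' k k ∘ₗ
          TensorProduct.map τ.ofConv φ.ofConv).lTensor M (Δ.lTensor M (δ x))) := by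
        rw [← h.coassoc_apply, act, ← LinearMap.comp_assoc, LinearMap.rTensor_comp_apply]
        exact LinearMap.congr_fun contract' _
    _ = act δ (.toConv (convCoact Δ τ.ofConv φ.ofConv)) x := by
        rw [← LinearMap.lTensor_comp_apply]; rfl

theorem act_one [Coalgebra k C] {Δ : C →ₗ[k] C ⊗[k] C} {δ : M →ₗ[k] M ⊗[k] C}
    (h : IsCoaction Δ counit δ) : act δ 1 = LinearMap.id := h.counit_comp

theorem act_mul [Coalgebra k C] {δ : M →ₗ[k] M ⊗[k] C} (h : IsCoaction comul counit δ)
    (τ φ : WithConv (C →ₗ[k] k)) : act δ (τ * φ) = act δ τ ∘ₗ act δ φ :=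
  (h.act_comp_act τ φ).symm

theorem convCoact_opComul (Δ : C →ₗ[k] C ⊗[k] C) {φ ψ : C →ₗ[k] P}
    (h : ∀ x y, φ x * ψ y = ψ y * φ x) : convCoact (opComul Δ) φ ψ = convCoact Δ ψ φ := by
  have mul_comp_comm : LinearMap.mul' k P ∘ₗ TensorProduct.map φ ψ ∘ₗ
      (TensorProduct.comm k C C).toLinearMap = LinearMap.mul' k P ∘ₗ TensorProduct.map ψ φ := by
    ext; simp [h]
  exact congrArg (· ∘ₗ Δ) mul_comp_comm

theorem act_mul_op [Coalgebra k C] {δ : M →ₗ[k] M ⊗[k] C} (h : IsCoaction (opComul comul) counit δ)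
    (τ φ : WithConv (C →ₗ[k] k)) : act δ (τ * φ) = act δ φ ∘ₗ act δ τ := by
  rw [h.act_comp_act φ τ, convCoact_opComul comul fun _ _ => mul_comm _ _]
  rfl

theorem commute_convScalar_iff [Coalgebra k C] {g : C →ₗ[k] P} {τ : WithConv (C →ₗ[k] k)} :
    Commute (convScalar P τ) (.toConv g) ↔ g ∘ₗ act comul τ = g ∘ₗ act (opComul comul) τ := by
  rw [comp_act, comp_act, convCoact_opComul comul fun _ _ => (Algebra.commutes _ _).symm]
  exact ⟨fun h => congrArg WithConv.ofConv h.symm, fun h => WithConv.ext h.symm⟩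

theorem IsCoaction.comp_act {Δ : C →ₗ[k] C ⊗[k] C} {ε : C →ₗ[k] k} {δ : M →ₗ[k] M ⊗[k] C}
    (h : IsCoaction Δ ε δ) (τ : WithConv (C →ₗ[k] k)) :
    δ ∘ₗ act δ τ = (act Δ τ).lTensor M ∘ₗ δ := by
  have contract : δ ∘ₗ (TensorProduct.rid k M).toLinearMap ∘ₗ τ.ofConv.lTensor M =
      (TensorProduct.rid k (M ⊗[k] C)).toLinearMap ∘ₗ τ.ofConv.lTensor (M ⊗[k] C) ∘ₗ
        δ.rTensor C := by
    ext; simp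
  have contract_assoc : (TensorProduct.rid k (M ⊗[k] C)).toLinearMap ∘ₗ
      τ.ofConv.lTensor (M ⊗[k] C) = ((TensorProduct.rid k C).toLinearMap ∘ₗ
        τ.ofConv.lTensor C).lTensor M ∘ₗ (TensorProduct.assoc k M C C).toLinearMap := by
    ext; simp
  calc δ ∘ₗ act δ τ = _ := congrArg (· ∘ₗ δ) contract
    _ = _ := congrArg (· ∘ₗ δ.rTensor C ∘ₗ δ) contract_assoc
    _ = (act Δ τ).lTensor M ∘ₗ δ := by
      rw [LinearMap.comp_assoc, h.coassoc, ← LinearMap.comp_assoc, ← LinearMap.lTensor_comp]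
      rfl

theorem IsCoaction.rTensor_act_comp {Δ : C →ₗ[k] C ⊗[k] C} {ε : C →ₗ[k] k}
    {δ : M →ₗ[k] M ⊗[k] C} (h : IsCoaction Δ ε δ) (τ : WithConv (C →ₗ[k] k)) :
    (act δ τ).rTensor C ∘ₗ δ = (act (opComul Δ) τ).lTensor M ∘ₗ δ := by
  have contract_assoc : ((TensorProduct.rid k M).toLinearMap ∘ₗ τ.ofConv.lTensor M).rTensor C =
      ((TensorProduct.rid k C).toLinearMap ∘ₗ τ.ofConv.lTensor C ∘ₗ
        (TensorProduct.comm k C C).toLinearMap).lTensor M ∘ₗ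
          (TensorProduct.assoc k M C C).toLinearMap := by
    ext; simp [TensorProduct.smul_tmul]
  calc (act δ τ).rTensor C ∘ₗ δ = _ := by
        rw [act, ← LinearMap.comp_assoc, LinearMap.rTensor_comp, LinearMap.comp_assoc]
    _ = _ := congrArg (· ∘ₗ δ.rTensor C ∘ₗ δ) contract_assoc
    _ = (act (opComul Δ) τ).lTensor M ∘ₗ δ := by
      rw [LinearMap.comp_assoc, h.coassoc, ← LinearMap.comp_assoc, ← LinearMap.lTensor_comp]
      rfl

theorem act_comp_of_comp [Coalgebra k C] [Coalgebra k C'] {δ : M →ₗ[k] M ⊗[k] C}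
    {δ' : M' →ₗ[k] M' ⊗[k] C'} (f : M →ₗ[k] M') (g : C →ₗc[k] C')
    (h : δ' ∘ₗ f = TensorProduct.map f g.toLinearMap ∘ₗ δ) (τ : WithConv (C' →ₗ[k] k)) :
    act δ' τ ∘ₗ f = f ∘ₗ act δ (convPull g τ) := by
  have contract_map : (TensorProduct.rid k M').toLinearMap ∘ₗ τ.ofConv.lTensor M' ∘ₗ
      TensorProduct.map f g.toLinearMap =
        f ∘ₗ (TensorProduct.rid k M).toLinearMap ∘ₗ (convPull g τ).ofConv.lTensor M := by
    ext
    simp only [TensorProduct.AlgebraTensorModule.curry_apply, LinearMap.restrictScalars_self,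
      TensorProduct.curry_apply, LinearMap.comp_apply, TensorProduct.map_tmul,
      LinearMap.lTensor_tmul, LinearEquiv.coe_coe, TensorProduct.rid_tmul, map_smul]
    rfl
  rw [act, LinearMap.comp_assoc, LinearMap.comp_assoc, h]
  exact congrArg (· ∘ₗ δ) contract_map

theorem outer_comp_map {δ : M →ₗ[k] M ⊗[k] C} {δ' : M' →ₗ[k] M' ⊗[k] C'}
    {d : N →ₗ[k] N ⊗[k] D} {d' : N' →ₗ[k] N' ⊗[k] D'}
    {m : M →ₗ[k] N} {m' : M' →ₗ[k] N'} {g : C →ₗ[k] D} {g' : C' →ₗ[k] D'}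
    (h : d ∘ₗ m = TensorProduct.map m g ∘ₗ δ) (h' : d' ∘ₗ m' = TensorProduct.map m' g' ∘ₗ δ') :
    outer d d' ∘ₗ TensorProduct.map m m' =
      TensorProduct.map (TensorProduct.map m m') (TensorProduct.map g g') ∘ₗ outer δ δ' := by
  rw [outer, LinearMap.comp_assoc, ← TensorProduct.map_comp, h, h', TensorProduct.map_comp,
    ← LinearMap.comp_assoc, TensorProduct.tensorTensorTensorComm_comp_map, LinearMap.comp_assoc,
    outer]

theorem outer_opComul (Δ : C →ₗ[k] C ⊗[k] C) (Δ' : C' →ₗ[k] C' ⊗[k] C') :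
    outer (opComul Δ) (opComul Δ') = opComul (outer Δ Δ') := by
  have comm_shuffle : (TensorProduct.tensorTensorTensorComm k C C C' C').toLinearMap ∘ₗ
      TensorProduct.map (TensorProduct.comm k C C).toLinearMap
        (TensorProduct.comm k C' C').toLinearMap =
      (TensorProduct.comm k _ _).toLinearMap ∘ₗ
        (TensorProduct.tensorTensorTensorComm k C C C' C').toLinearMap := by
    ext; simp
  rw [outer, opComul, opComul, TensorProduct.map_comp, ← LinearMap.comp_assoc, comm_shuffle]
  rfl

theorem outer_comul [Coalgebra k C] [Coalgebra k C'] :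
    outer (comul (R := k) (A := C)) (comul (R := k) (A := C')) =
      comul (R := k) (A := C ⊗[k] C') := rfl

theorem outer_counit [Coalgebra k C] [Coalgebra k C'] :
    LinearMap.mul' k k ∘ₗ TensorProduct.map (counit (R := k) (A := C))
      (counit (R := k) (A := C')) = counit (R := k) (A := C ⊗[k] C') := by
  ext; simp [mul_comm]

theorem IsCoaction.coassoc_outer {Δ : C →ₗ[k] C ⊗[k] C} {ε : C →ₗ[k] k}
    {δ : M →ₗ[k] M ⊗[k] C} (h : IsCoaction Δ ε δ) {Δ' : C' →ₗ[k] C' ⊗[k] C'}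
    {ε' : C' →ₗ[k] k} {δ' : M' →ₗ[k] M' ⊗[k] C'} (h' : IsCoaction Δ' ε' δ') :
    (TensorProduct.assoc k (M ⊗[k] M') _ _).toLinearMap ∘ₗ
      (outer δ δ').rTensor (C ⊗[k] C') ∘ₗ outer δ δ' =
        (outer Δ Δ').lTensor (M ⊗[k] M') ∘ₗ outer δ δ' := by
  have shuffle_coact : (outer δ δ').rTensor (C ⊗[k] C') ∘ₗ
      (TensorProduct.tensorTensorTensorComm k M C M' C').toLinearMap =
      (TensorProduct.tensorTensorTensorComm k M C M' C').toLinearMap.rTensor _ ∘ₗ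
      (TensorProduct.tensorTensorTensorComm k (M ⊗[k] C) C (M' ⊗[k] C') C').toLinearMap ∘ₗ
        TensorProduct.map (δ.rTensor C) (δ'.rTensor C') := by
    ext; simp [outer]
  have shuffle_comul : (outer Δ Δ').lTensor (M ⊗[k] M') ∘ₗ
      (TensorProduct.tensorTensorTensorComm k M C M' C').toLinearMap =
      (TensorProduct.tensorTensorTensorComm k C C C' C').toLinearMap.lTensor _ ∘ₗ
      (TensorProduct.tensorTensorTensorComm k M (C ⊗[k] C) M' (C' ⊗[k] C')).toLinearMap ∘ₗ
        TensorProduct.map (Δ.lTensor M) (Δ'.lTensor M') := by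
    ext; simp [outer]
  have shuffle_assoc : (TensorProduct.assoc k (M ⊗[k] M') _ _).toLinearMap ∘ₗ
      (TensorProduct.tensorTensorTensorComm k M C M' C').toLinearMap.rTensor _ ∘ₗ
      (TensorProduct.tensorTensorTensorComm k (M ⊗[k] C) C (M' ⊗[k] C') C').toLinearMap =
      (TensorProduct.tensorTensorTensorComm k C C C' C').toLinearMap.lTensor _ ∘ₗ
      (TensorProduct.tensorTensorTensorComm k M (C ⊗[k] C) M' (C' ⊗[k] C')).toLinearMap ∘ₗ
        TensorProduct.map (TensorProduct.assoc k M C C).toLinearMap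
          (TensorProduct.assoc k M' C' C').toLinearMap := by
    ext; simp
  have coassoc_map : TensorProduct.map (TensorProduct.assoc k M C C).toLinearMap
      (TensorProduct.assoc k M' C' C').toLinearMap ∘ₗ
        TensorProduct.map (δ.rTensor C) (δ'.rTensor C') ∘ₗ TensorProduct.map δ δ' =
      TensorProduct.map (Δ.lTensor M) (Δ'.lTensor M') ∘ₗ TensorProduct.map δ δ' := by
    simp only [← TensorProduct.map_comp, h.coassoc, h'.coassoc]
  calc _ = _ := congrArg (_ ∘ₗ · ∘ₗ TensorProduct.map δ δ') shuffle_coact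
    _ = _ := congrArg (· ∘ₗ TensorProduct.map (δ.rTensor C) (δ'.rTensor C') ∘ₗ
      TensorProduct.map δ δ') shuffle_assoc
    _ = _ := congrArg ((TensorProduct.tensorTensorTensorComm k C C C' C').toLinearMap.lTensor
      (M ⊗[k] M') ∘ₗ (TensorProduct.tensorTensorTensorComm k M (C ⊗[k] C) M'
        (C' ⊗[k] C')).toLinearMap ∘ₗ ·) coassoc_map
    _ = _ := congrArg (· ∘ₗ TensorProduct.map δ δ') shuffle_comul.symm

theorem IsCoaction.outer {Δ : C →ₗ[k] C ⊗[k] C} {ε : C →ₗ[k] k} {δ : M →ₗ[k] M ⊗[k] C}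
    (h : IsCoaction Δ ε δ) {Δ' : C' →ₗ[k] C' ⊗[k] C'} {ε' : C' →ₗ[k] k}
    {δ' : M' →ₗ[k] M' ⊗[k] C'} (h' : IsCoaction Δ' ε' δ') :
    IsCoaction (outer Δ Δ') (LinearMap.mul' k k ∘ₗ TensorProduct.map ε ε') (outer δ δ') where
  coassoc := h.coassoc_outer h'
  counit_comp := by
    have shuffle : (TensorProduct.rid k (M ⊗[k] M')).toLinearMap ∘ₗ (LinearMap.mul' k k ∘ₗ
        TensorProduct.map ε ε').lTensor _ ∘ₗ
          (TensorProduct.tensorTensorTensorComm k M C M' C').toLinearMap =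
        TensorProduct.map ((TensorProduct.rid k M).toLinearMap ∘ₗ ε.lTensor M)
          ((TensorProduct.rid k M').toLinearMap ∘ₗ ε'.lTensor M') := by
      ext; simp [TensorProduct.smul_tmul', smul_smul, mul_comm]
    calc _ = _ := congrArg (· ∘ₗ TensorProduct.map δ δ') shuffle
      _ = _ := by
        rw [← TensorProduct.map_comp, LinearMap.comp_assoc, LinearMap.comp_assoc, h.counit_comp,
          h'.counit_comp, TensorProduct.map_id]

theorem outer_comp_assoc (δ : M →ₗ[k] M ⊗[k] C) (δ' : M' →ₗ[k] M' ⊗[k] C')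
    (δ'' : N →ₗ[k] N ⊗[k] D) :
    outer δ (outer δ' δ'') ∘ₗ (TensorProduct.assoc k M M' N).toLinearMap =
      TensorProduct.map (TensorProduct.assoc k M M' N).toLinearMap
        (TensorProduct.assoc k C C' D).toLinearMap ∘ₗ outer (outer δ δ') δ'' := by
  have shuffle_assoc : (TensorProduct.tensorTensorTensorComm k M C (M' ⊗[k] N) _).toLinearMap ∘ₗ
      (TensorProduct.tensorTensorTensorComm k M' C' N D).toLinearMap.lTensor (M ⊗[k] C) ∘ₗ
        (TensorProduct.assoc k (M ⊗[k] C) (M' ⊗[k] C') (N ⊗[k] D)).toLinearMap =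
      TensorProduct.map (TensorProduct.assoc k M M' N).toLinearMap
        (TensorProduct.assoc k C C' D).toLinearMap ∘ₗ
        (TensorProduct.tensorTensorTensorComm k (M ⊗[k] M') _ N D).toLinearMap ∘ₗ
          (TensorProduct.tensorTensorTensorComm k M C M' C').toLinearMap.rTensor (N ⊗[k] D) := by
    ext; simp
  ext x y z
  exact LinearMap.congr_fun shuffle_assoc ((δ x ⊗ₜ δ' y) ⊗ₜ δ'' z)

theorem outer_comp_comm (δ : M →ₗ[k] M ⊗[k] C) (δ' : M' →ₗ[k] M' ⊗[k] C') :
    outer δ' δ ∘ₗ (TensorProduct.comm k M M').toLinearMap =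
      TensorProduct.map (TensorProduct.comm k M M').toLinearMap
        (TensorProduct.comm k C C').toLinearMap ∘ₗ outer δ δ' := by
  have shuffle_comm : (TensorProduct.tensorTensorTensorComm k M' C' M C).toLinearMap ∘ₗ
      (TensorProduct.comm k (M ⊗[k] C) (M' ⊗[k] C')).toLinearMap =
      TensorProduct.map (TensorProduct.comm k M M').toLinearMap
        (TensorProduct.comm k C C').toLinearMap ∘ₗ
          (TensorProduct.tensorTensorTensorComm k M C M' C').toLinearMap := by
    ext; simp
  ext x y
  exact LinearMap.congr_fun shuffle_comm (δ x ⊗ₜ δ' y)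

theorem act_outer_fst [Coalgebra k C] [Coalgebra k C'] {δ : M →ₗ[k] M ⊗[k] C}
    {Δ' : C' →ₗ[k] C' ⊗[k] C'} {δ' : M' →ₗ[k] M' ⊗[k] C'} (h' : IsCoaction Δ' counit δ')
    (τ : WithConv (C →ₗ[k] k)) :
    act (outer δ δ') (convPull (fstHom k C C') τ) = (act δ τ).rTensor M' := by
  have contract : (TensorProduct.rid k _).toLinearMap ∘ₗ
      (convPull (fstHom k C C') τ).ofConv.lTensor _ ∘ₗ
        (TensorProduct.tensorTensorTensorComm k M C M' C').toLinearMap =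
      TensorProduct.map ((TensorProduct.rid k M).toLinearMap ∘ₗ τ.ofConv.lTensor M)
        ((TensorProduct.rid k M').toLinearMap ∘ₗ counit.lTensor M') := by
    ext
    simp [convPull, fstHom_tmul, TensorProduct.smul_tmul, smul_smul]
  calc _ = _ := congrArg (· ∘ₗ TensorProduct.map δ δ') contract
    _ = _ := by
      rw [← TensorProduct.map_comp, LinearMap.comp_assoc, LinearMap.comp_assoc, h'.counit_comp]
      rfl

theorem act_outer_snd [Coalgebra k C] [Coalgebra k C'] {Δ : C →ₗ[k] C ⊗[k] C}
    {δ : M →ₗ[k] M ⊗[k] C} {δ' : M' →ₗ[k] M' ⊗[k] C'} (h : IsCoaction Δ counit δ)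
    (τ : WithConv (C' →ₗ[k] k)) :
    act (outer δ δ') (convPull (sndHom k C C') τ) = (act δ' τ).lTensor M := by
  have contract : (TensorProduct.rid k _).toLinearMap ∘ₗ
      (convPull (sndHom k C C') τ).ofConv.lTensor _ ∘ₗ
        (TensorProduct.tensorTensorTensorComm k M C M' C').toLinearMap =
      TensorProduct.map ((TensorProduct.rid k M).toLinearMap ∘ₗ counit.lTensor M)
        ((TensorProduct.rid k M').toLinearMap ∘ₗ τ.ofConv.lTensor M') := by
    ext
    simp [convPull, sndHom_tmul, TensorProduct.smul_tmul, smul_smul, mul_comm]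
  calc _ = _ := congrArg (· ∘ₗ TensorProduct.map δ δ') contract
    _ = _ := by
      rw [← TensorProduct.map_comp, LinearMap.comp_assoc, LinearMap.comp_assoc, h.counit_comp]
      rfl

theorem CoactionsCommute.symm {δ : M →ₗ[k] M ⊗[k] C} {lam : M →ₗ[k] M ⊗[k] D}
    (h : CoactionsCommute δ lam) : CoactionsCommute lam δ := by
  ext x
  exact ((TensorProduct.rightComm k M C D).symm_apply_eq.2 (LinearMap.congr_fun h x)).symm

theorem CoactionsCommute.comp_act {δ : M →ₗ[k] M ⊗[k] C} {lam : M →ₗ[k] M ⊗[k] D}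
    (h : CoactionsCommute δ lam) (σ : WithConv (D →ₗ[k] k)) :
    δ ∘ₗ act lam σ = (act lam σ).rTensor C ∘ₗ δ := by
  have contract : δ ∘ₗ (TensorProduct.rid k M).toLinearMap ∘ₗ σ.ofConv.lTensor M =
      ((TensorProduct.rid k M).toLinearMap ∘ₗ σ.ofConv.lTensor M).rTensor C ∘ₗ
        (TensorProduct.rightComm k M C D).toLinearMap ∘ₗ δ.rTensor D := by
    have contract_right : (TensorProduct.rid k (M ⊗[k] C)).toLinearMap ∘ₗ
        σ.ofConv.lTensor (M ⊗[k] C) =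
        ((TensorProduct.rid k M).toLinearMap ∘ₗ σ.ofConv.lTensor M).rTensor C ∘ₗ
          (TensorProduct.rightComm k M C D).toLinearMap := by
      ext; simp [TensorProduct.smul_tmul']
    rw [← LinearMap.comp_assoc (δ.rTensor D), ← contract_right]
    ext; simp
  calc _ = _ := congrArg (· ∘ₗ lam) contract
    _ = _ := congrArg (((TensorProduct.rid k M).toLinearMap ∘ₗ σ.ofConv.lTensor M).rTensor C ∘ₗ ·)
      (Eq.symm h)
    _ = _ := by rw [← LinearMap.comp_assoc, ← LinearMap.rTensor_comp]; rfl

theorem CoactionsCommute.act_comp_act {δ : M →ₗ[k] M ⊗[k] C} {lam : M →ₗ[k] M ⊗[k] D}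
    (h : CoactionsCommute δ lam) (τ : WithConv (C →ₗ[k] k)) (σ : WithConv (D →ₗ[k] k)) :
    act δ τ ∘ₗ act lam σ = act lam σ ∘ₗ act δ τ := by
  have contract : (TensorProduct.rid k M).toLinearMap ∘ₗ τ.ofConv.lTensor M ∘ₗ
      (act lam σ).rTensor C =
        act lam σ ∘ₗ (TensorProduct.rid k M).toLinearMap ∘ₗ τ.ofConv.lTensor M := by
    ext; simp
  calc act δ τ ∘ₗ act lam σ = _ :=
        congrArg ((TensorProduct.rid k M).toLinearMap ∘ₗ τ.ofConv.lTensor M ∘ₗ ·) (h.comp_act σ)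
    _ = _ := congrArg (· ∘ₗ δ) contract

theorem CoactionsCommute.outer {δ : M →ₗ[k] M ⊗[k] C} {lam : M →ₗ[k] M ⊗[k] D}
    (h : CoactionsCommute δ lam) {δ' : M' →ₗ[k] M' ⊗[k] C'} {lam' : M' →ₗ[k] M' ⊗[k] D'}
    (h' : CoactionsCommute δ' lam') : CoactionsCommute (outer δ δ') (outer lam lam') := by
  have shuffle_fst : (LazyCohomology.outer lam lam').rTensor (C ⊗[k] C') ∘ₗ
      (TensorProduct.tensorTensorTensorComm k M C M' C').toLinearMap =
      (TensorProduct.tensorTensorTensorComm k M D M' D').toLinearMap.rTensor _ ∘ₗ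
        (TensorProduct.tensorTensorTensorComm k (M ⊗[k] D) C (M' ⊗[k] D') C').toLinearMap ∘ₗ
          TensorProduct.map (lam.rTensor C) (lam'.rTensor C') := by
    ext; simp [LazyCohomology.outer]
  have shuffle_snd : (LazyCohomology.outer δ δ').rTensor (D ⊗[k] D') ∘ₗ
      (TensorProduct.tensorTensorTensorComm k M D M' D').toLinearMap =
      (TensorProduct.tensorTensorTensorComm k M C M' C').toLinearMap.rTensor _ ∘ₗ
        (TensorProduct.tensorTensorTensorComm k (M ⊗[k] C) D (M' ⊗[k] C') D').toLinearMap ∘ₗ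
          TensorProduct.map (δ.rTensor D) (δ'.rTensor D') := by
    ext; simp [LazyCohomology.outer]
  have shuffle_rightComm : (TensorProduct.tensorTensorTensorComm k M D M' D').toLinearMap.rTensor
      _ ∘ₗ (TensorProduct.tensorTensorTensorComm k (M ⊗[k] D) C (M' ⊗[k] D') C').toLinearMap ∘ₗ
        TensorProduct.map (TensorProduct.rightComm k M C D).toLinearMap
          (TensorProduct.rightComm k M' C' D').toLinearMap =
      (TensorProduct.rightComm k _ _ _).toLinearMap ∘ₗ
        (TensorProduct.tensorTensorTensorComm k M C M' C').toLinearMap.rTensor _ ∘ₗ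
          (TensorProduct.tensorTensorTensorComm k (M ⊗[k] C) D (M' ⊗[k] C') D').toLinearMap := by
    ext; simp
  have commute_map : TensorProduct.map (lam.rTensor C) (lam'.rTensor C') ∘ₗ
      TensorProduct.map δ δ' = TensorProduct.map (TensorProduct.rightComm k M C D).toLinearMap
        (TensorProduct.rightComm k M' C' D').toLinearMap ∘ₗ
          TensorProduct.map (δ.rTensor D) (δ'.rTensor D') ∘ₗ TensorProduct.map lam lam' := by
    simp only [← TensorProduct.map_comp]
    exact congrArg₂ TensorProduct.map h h'
  calc (LazyCohomology.outer lam lam').rTensor (C ⊗[k] C') ∘ₗ LazyCohomology.outer δ δ' = _ :=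
        congrArg (· ∘ₗ TensorProduct.map δ δ') shuffle_fst
    _ = _ := congrArg ((TensorProduct.tensorTensorTensorComm k M D M' D').toLinearMap.rTensor
      (C ⊗[k] C') ∘ₗ (TensorProduct.tensorTensorTensorComm k (M ⊗[k] D) C (M' ⊗[k] D')
        C').toLinearMap ∘ₗ ·) commute_map
    _ = _ := congrArg (· ∘ₗ TensorProduct.map (δ.rTensor D) (δ'.rTensor D') ∘ₗ
      TensorProduct.map lam lam') shuffle_rightComm
    _ = _ := congrArg ((TensorProduct.rightComm k (M ⊗[k] M') (C ⊗[k] C')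
      (D ⊗[k] D')).toLinearMap ∘ₗ · ∘ₗ TensorProduct.map lam lam') shuffle_snd.symm

end Coaction

section GaloisMap

variable {k : Type*} [CommRing k] {M C D N P Q R : Type*}
  [AddCommGroup M] [Module k M] [AddCommGroup C] [Module k C] [AddCommGroup D] [Module k D]
  [AddCommGroup N] [Module k N]
  [Ring P] [Algebra k P] [Ring Q] [Algebra k Q] [Ring R] [Algebra k R]

/-- The extension `p ⊗ x ↦ p • f x` of `f` to a `P`-linear map; Mathlib's
`LinearMap.liftBaseChange` requires `P` to be commutative. -/
def extendScalars {X : Type*} [AddCommGroup X] [Module k X] [Module P X] [IsScalarTower k P X]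
    (f : M →ₗ[k] X) : P ⊗[k] M →ₗ[P] X :=
  TensorProduct.AlgebraTensorModule.lift (LinearMap.toSpanSingleton P (M →ₗ[k] X) f)

@[simp]
theorem extendScalars_tmul {X : Type*} [AddCommGroup X] [Module k X] [Module P X]
    [IsScalarTower k P X] (f : M →ₗ[k] X) (p : P) (x : M) :
    extendScalars f (p ⊗ₜ[k] x) = p • f x := rfl

/-- The Galois map `p ⊗ x ↦ p m(x₀) ⊗ x₁` of a map `m` to an algebra, where `δ x = x₀ ⊗ x₁`. -/
def galoisMap (m : M →ₗ[k] P) (δ : M →ₗ[k] M ⊗[k] C) : P ⊗[k] M →ₗ[P] P ⊗[k] C :=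
  extendScalars (m.rTensor C ∘ₗ δ)

theorem mul'_map_galoisMap (b : P →ₐ[k] Q) (m : M →ₗ[k] P) (δ : M →ₗ[k] M ⊗[k] C)
    (φ : C →ₗ[k] Q) (p : P) (x : M) :
    LinearMap.mul' k Q (TensorProduct.map b.toLinearMap φ (galoisMap m δ (p ⊗ₜ x))) =
      b p * convCoact δ (b.toLinearMap ∘ₗ m) φ x := by
  have mul_mul : LinearMap.mul' k Q ∘ₗ TensorProduct.map b.toLinearMap φ ∘ₗ
      (LinearMap.mulLeft k p).rTensor C ∘ₗ m.rTensor C =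
      LinearMap.mulLeft k (b p) ∘ₗ LinearMap.mul' k Q ∘ₗ
        TensorProduct.map (b.toLinearMap ∘ₗ m) φ := by
    ext; simp [mul_assoc]
  exact LinearMap.congr_fun mul_mul (δ x)

theorem exists_convCoact_eq {m : M →ₗ[k] P} {δ : M →ₗ[k] M ⊗[k] C}
    (h : Function.Bijective (galoisMap m δ)) (f : M →ₗ[k] P) :
    ∃ φ : C →ₗ[k] P, f = convCoact δ m φ := by
  let E : P ⊗[k] C →ₗ[P] P :=
    extendScalars f ∘ₗ (LinearEquiv.ofBijective (galoisMap m δ) h).symm.toLinearMap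
  let φ : C →ₗ[k] P := E.restrictScalars k ∘ₗ TensorProduct.mk k P C 1
  have E_eq : E.restrictScalars k = LinearMap.mul' k P ∘ₗ φ.lTensor P := by
    ext p c
    simpa [φ, TensorProduct.smul_tmul', -map_smul] using E.map_smul p (1 ⊗ₜ c)
  refine ⟨φ, LinearMap.ext fun x => ?_⟩
  calc f x = E (galoisMap m δ (1 ⊗ₜ x)) := by
        simp [E, LinearEquiv.ofBijective_symm_apply_apply]
    _ = LinearMap.mul' k P (φ.lTensor P (galoisMap m δ (1 ⊗ₜ x))) :=
        LinearMap.congr_fun E_eq _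
    _ = convCoact δ m φ x := (mul'_map_galoisMap (AlgHom.id k P) m δ φ 1 x).trans
        (one_mul _)

theorem convCoact_injective {m : M →ₗ[k] P} {δ : M →ₗ[k] M ⊗[k] C}
    (h : Function.Surjective (galoisMap m δ)) (b : P →ₐ[k] Q) :
    Function.Injective fun φ : C →ₗ[k] Q => convCoact δ (b.toLinearMap ∘ₗ m) φ := by
  intro φ φ' eq
  have mul_map_eq : LinearMap.mul' k Q ∘ₗ TensorProduct.map b.toLinearMap φ ∘ₗ
      (galoisMap m δ).restrictScalars k = LinearMap.mul' k Q ∘ₗ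
        TensorProduct.map b.toLinearMap φ' ∘ₗ (galoisMap m δ).restrictScalars k := by
    ext p x
    simpa using (mul'_map_galoisMap b m δ φ p x).trans
      ((congrArg (b p * · x) eq).trans (mul'_map_galoisMap b m δ φ' p x).symm)
  ext c
  obtain ⟨t, ht⟩ := h (1 ⊗ₜ c)
  simpa [ht] using LinearMap.congr_fun mul_map_eq t

theorem act_injective [Coalgebra k C] {m : M →ₗ[k] P} {δ : M →ₗ[k] M ⊗[k] C}
    (h : Function.Surjective (galoisMap m δ)) (hP : Function.Injective (algebraMap k P)) :
    Function.Injective fun τ : WithConv (C →ₗ[k] k) => m ∘ₗ act δ τ := by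
  intro τ τ' eq
  have scalar_eq : convScalar P τ = convScalar P τ' := by
    refine WithConv.ext (convCoact_injective h (AlgHom.id k P) ?_)
    simpa only [AlgHom.toLinearMap_id, LinearMap.id_comp, comp_act] using eq
  exact WithConv.ext (LinearMap.ext fun c => hP (LinearMap.congr_fun
    (congrArg WithConv.ofConv scalar_eq) c))

theorem map_comp_injective {m : M →ₗ[k] P} {δ : M →ₗ[k] M ⊗[k] C}
    (h : Function.Surjective (galoisMap m δ))
    (hR : Function.Injective (TensorProduct.mk k P R 1)) :
    Function.Injective fun φ : C →ₗ[k] R => TensorProduct.map m φ ∘ₗ δ := by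
  intro φ φ' eq
  have map_eq : ∀ ψ : C →ₗ[k] R, TensorProduct.map m ψ ∘ₗ δ =
      convCoact δ (Algebra.TensorProduct.includeLeft.toLinearMap ∘ₗ m)
        (Algebra.TensorProduct.includeRight.toLinearMap ∘ₗ ψ : C →ₗ[k] P ⊗[k] R) := by
    have map_eq_mul : ∀ ψ : C →ₗ[k] R, TensorProduct.map m ψ = LinearMap.mul' k (P ⊗[k] R) ∘ₗ
        TensorProduct.map (Algebra.TensorProduct.includeLeft.toLinearMap ∘ₗ m)
          (Algebra.TensorProduct.includeRight.toLinearMap ∘ₗ ψ) := by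
      intro ψ; ext; simp
    exact fun ψ => congrArg (· ∘ₗ δ) (map_eq_mul ψ)
  have include_eq := convCoact_injective h Algebra.TensorProduct.includeLeft
    ((map_eq φ).symm.trans (eq.trans (map_eq φ')))
  exact LinearMap.ext fun c => hR (LinearMap.congr_fun include_eq c)

/-- The coinvariants of `b` are the scalars, and the scalars embed in `P`. -/
structure HasTrivialCoinvariants (b : P →ₐ[k] P ⊗[k] R) : Prop where
  mem_range : ∀ p, b p = p ⊗ₜ 1 → p ∈ Set.range (algebraMap k P)
  injective : Function.Injective (algebraMap k P)

theorem HasTrivialCoinvariants.exists_convScalar_eq [Coalgebra k C] {b : P →ₐ[k] P ⊗[k] R}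
    (hb : HasTrivialCoinvariants b) {φ : C →ₗ[k] P}
    (hφ : b.toLinearMap ∘ₗ φ = Algebra.TensorProduct.includeLeft.toLinearMap ∘ₗ φ) :
    ∃ τ : WithConv (C →ₗ[k] k), φ = (convScalar P τ).ofConv := by
  have mem_range : ∀ c, φ c ∈ LinearMap.range (Algebra.linearMap k P) :=
    fun c => hb.mem_range _ (LinearMap.congr_fun hφ c)
  refine ⟨.toConv ((LinearEquiv.ofInjective (Algebra.linearMap k P) hb.injective).symm.toLinearMap
    ∘ₗ φ.codRestrict _ mem_range), LinearMap.ext fun c => ?_⟩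
  exact (congrArg Subtype.val ((LinearEquiv.ofInjective (Algebra.linearMap k P)
    hb.injective).apply_symm_apply ⟨φ c, mem_range c⟩)).symm

theorem CoactionsCommute.convCoact_map {δ : M →ₗ[k] M ⊗[k] C} {lam : M →ₗ[k] M ⊗[k] D}
    (h : CoactionsCommute δ lam) (m : M →ₗ[k] P) (g : D →ₗ[k] R) (φ : C →ₗ[k] P) :
    convCoact δ (TensorProduct.map m g ∘ₗ lam)
        (Algebra.TensorProduct.includeLeft.toLinearMap ∘ₗ φ) =
      TensorProduct.map (convCoact δ m φ) g ∘ₗ lam := by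
  have mul_map_rightComm : LinearMap.mul' k (P ⊗[k] R) ∘ₗ
      TensorProduct.map (TensorProduct.map m g)
        (Algebra.TensorProduct.includeLeft.toLinearMap ∘ₗ φ) ∘ₗ
          (TensorProduct.rightComm k M C D).toLinearMap =
      TensorProduct.map (LinearMap.mul' k P ∘ₗ TensorProduct.map m φ) g := by
    ext; simp
  calc _ = (LinearMap.mul' k (P ⊗[k] R) ∘ₗ TensorProduct.map (TensorProduct.map m g)
        (Algebra.TensorProduct.includeLeft.toLinearMap ∘ₗ φ)) ∘ₗ lam.rTensor C ∘ₗ δ := by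
        rw [convCoact, ← LinearMap.map_comp_rTensor]; rfl
    _ = TensorProduct.map (LinearMap.mul' k P ∘ₗ TensorProduct.map m φ) g ∘ₗ
        δ.rTensor D ∘ₗ lam := by
        rw [h]
        exact congrArg (· ∘ₗ δ.rTensor D ∘ₗ lam) mul_map_rightComm
    _ = TensorProduct.map (convCoact δ m φ) g ∘ₗ lam := by
        rw [← LinearMap.comp_assoc, LinearMap.map_comp_rTensor]; rfl

theorem HasTrivialCoinvariants.exists_eq_comp_act [Coalgebra k C] {b : P →ₐ[k] P ⊗[k] R}
    (hb : HasTrivialCoinvariants b) {m f : M →ₗ[k] P} {δ : M →ₗ[k] M ⊗[k] C}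
    {lam : M →ₗ[k] M ⊗[k] D} {g : D →ₗ[k] R}
    (hm : b.toLinearMap ∘ₗ m = TensorProduct.map m g ∘ₗ lam)
    (hf : b.toLinearMap ∘ₗ f = TensorProduct.map f g ∘ₗ lam) (hcomm : CoactionsCommute δ lam)
    (h : Function.Bijective (galoisMap m δ)) :
    ∃ τ : WithConv (C →ₗ[k] k), f = m ∘ₗ act δ τ := by
  obtain ⟨φ, rfl⟩ := exists_convCoact_eq h f
  have coinvariant :
      b.toLinearMap ∘ₗ φ = Algebra.TensorProduct.includeLeft.toLinearMap ∘ₗ φ := by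
    refine convCoact_injective h.2 b ?_
    change convCoact δ (b.toLinearMap ∘ₗ m) _ = convCoact δ (b.toLinearMap ∘ₗ m) _
    rw [← algHom_comp_convCoact, hf, hm, hcomm.convCoact_map]
  obtain ⟨τ, rfl⟩ := hb.exists_convScalar_eq coinvariant
  exact ⟨τ, (comp_act δ τ m).symm⟩

theorem HasTrivialCoinvariants.exists_central {S : Type*} [Ring S] [Algebra k S] [Coalgebra k C]
    [Coalgebra k D] {b : P →ₐ[k] P ⊗[k] R} (hb : HasTrivialCoinvariants b) {b' : P →ₗ[k] P ⊗[k] S}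
    (hS : Function.Injective (TensorProduct.mk k P S 1)) {m : M →ₗ[k] P}
    {ΔC : C →ₗ[k] C ⊗[k] C} {δ : M →ₗ[k] M ⊗[k] C} (hδ : IsCoaction ΔC counit δ)
    {ΔD : D →ₗ[k] D ⊗[k] D} {lam : M →ₗ[k] M ⊗[k] D} (hlam : IsCoaction ΔD counit lam)
    (hcomm : CoactionsCommute δ lam) {g : D →ₗ[k] R} {g' : C →ₗ[k] S}
    (hg : b.toLinearMap ∘ₗ m = TensorProduct.map m g ∘ₗ lam)
    (hg' : b' ∘ₗ m = TensorProduct.map m g' ∘ₗ δ) (h : Function.Bijective (galoisMap m δ))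
    {σ : WithConv (D →ₗ[k] k)} (hσ : g ∘ₗ act ΔD σ = g ∘ₗ act (opComul ΔD) σ) :
    ∃ τ : WithConv (C →ₗ[k] k), m ∘ₗ act lam σ = m ∘ₗ act δ τ ∧
      g' ∘ₗ act ΔC τ = g' ∘ₗ act (opComul ΔC) τ := by
  have colinear : b.toLinearMap ∘ₗ m ∘ₗ act lam σ =
      TensorProduct.map (m ∘ₗ act lam σ) g ∘ₗ lam := by
    rw [← LinearMap.comp_assoc, hg, LinearMap.comp_assoc, hlam.comp_act, ← LinearMap.comp_assoc,
      LinearMap.map_comp_lTensor, hσ, ← LinearMap.map_comp_lTensor, LinearMap.comp_assoc,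
      ← hlam.rTensor_act_comp, ← LinearMap.comp_assoc, LinearMap.map_comp_rTensor]
  obtain ⟨τ, hτ⟩ := hb.exists_eq_comp_act hg colinear hcomm h
  refine ⟨τ, hτ, map_comp_injective h.2 hS ?_⟩
  calc TensorProduct.map m (g' ∘ₗ act ΔC τ) ∘ₗ δ = b' ∘ₗ m ∘ₗ act δ τ := by
        rw [← LinearMap.map_comp_lTensor, LinearMap.comp_assoc, ← hδ.comp_act,
          ← LinearMap.comp_assoc, ← hg', LinearMap.comp_assoc]
    _ = TensorProduct.map (m ∘ₗ act lam σ) g' ∘ₗ δ := by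
        rw [← hτ, ← LinearMap.comp_assoc, hg', LinearMap.comp_assoc, hcomm.comp_act,
          ← LinearMap.comp_assoc, LinearMap.map_comp_rTensor]
    _ = TensorProduct.map m (g' ∘ₗ act (opComul ΔC) τ) ∘ₗ δ := by
        rw [hτ, ← LinearMap.map_comp_rTensor, LinearMap.comp_assoc, hδ.rTensor_act_comp,
          ← LinearMap.comp_assoc, LinearMap.map_comp_lTensor]

end GaloisMap

section GaloisMapProduct

variable {k : Type*} [CommRing k] {M M' N C C' D P Q R : Type*}
  [AddCommGroup M] [Module k M] [AddCommGroup M'] [Module k M'] [AddCommGroup N] [Module k N]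
  [AddCommGroup C] [Module k C] [AddCommGroup C'] [Module k C'] [AddCommGroup D] [Module k D]
  [Ring P] [Algebra k P] [Ring R] [Algebra k R]

/-- The product `x ⊗ y ↦ m(x) m'(y)` of two maps to an algebra. -/
def mulMap (m : M →ₗ[k] P) (m' : M' →ₗ[k] P) : M ⊗[k] M' →ₗ[k] P :=
  LinearMap.mul' k P ∘ₗ TensorProduct.map m m'

@[simp]
theorem mulMap_tmul (m : M →ₗ[k] P) (m' : M' →ₗ[k] P) (x : M) (y : M') :
    mulMap m m' (x ⊗ₜ y) = m x * m' y := rfl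

theorem algHom_comp_mulMap (b : P →ₐ[k] P ⊗[k] R) {m : M →ₗ[k] P} {m' : M' →ₗ[k] P}
    {δ : M →ₗ[k] M ⊗[k] C} {δ' : M' →ₗ[k] M' ⊗[k] C'} {g : C →ₗ[k] R} {g' : C' →ₗ[k] R}
    (h : b.toLinearMap ∘ₗ m = TensorProduct.map m g ∘ₗ δ)
    (h' : b.toLinearMap ∘ₗ m' = TensorProduct.map m' g' ∘ₗ δ') :
    b.toLinearMap ∘ₗ mulMap m m' =
      TensorProduct.map (mulMap m m') (mulMap g g') ∘ₗ outer δ δ' := by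
  have mul_shuffle : mulMap (TensorProduct.map m g) (TensorProduct.map m' g') =
      TensorProduct.map (mulMap m m') (mulMap g g') ∘ₗ
        (TensorProduct.tensorTensorTensorComm k M C M' C').toLinearMap := by
    ext; simp
  ext x y
  calc b (m x * m' y) = b (m x) * b (m' y) := map_mul b _ _
    _ = TensorProduct.map m g (δ x) * TensorProduct.map m' g' (δ' y) :=
      congrArg₂ (· * ·) (LinearMap.congr_fun h x) (LinearMap.congr_fun h' y)
    _ = _ := LinearMap.congr_fun mul_shuffle (δ x ⊗ₜ δ' y)

theorem galoisMap_bijective_of_equiv {m : N →ₗ[k] P} {δ : M →ₗ[k] M ⊗[k] C}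
    {d : N →ₗ[k] N ⊗[k] D} (e : M ≃ₗ[k] N) (f : C ≃ₗ[k] D)
    (h : d ∘ₗ e.toLinearMap = TensorProduct.map e.toLinearMap f.toLinearMap ∘ₗ δ)
    (hm : Function.Bijective (galoisMap m d)) :
    Function.Bijective (galoisMap (m ∘ₗ e.toLinearMap) δ) := by
  have conj : f.lTensor P ∘ galoisMap (m ∘ₗ e.toLinearMap) δ = galoisMap m d ∘ e.lTensor P := by
    have lTensor_map : ∀ p : P, f.toLinearMap.lTensor P ∘ₗ (LinearMap.mulLeft k p).rTensor C ∘ₗ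
        (m ∘ₗ e.toLinearMap).rTensor C = (LinearMap.mulLeft k p).rTensor D ∘ₗ m.rTensor D ∘ₗ
          TensorProduct.map e.toLinearMap f.toLinearMap := by
      intro p; ext; simp
    have on_tmul : ∀ p x, f.lTensor P (galoisMap (m ∘ₗ e.toLinearMap) δ (p ⊗ₜ x)) =
        galoisMap m d (p ⊗ₜ e x) := fun p x =>
      (LinearMap.congr_fun (lTensor_map p) (δ x)).trans
        (congrArg (fun t => p • m.rTensor D t) (LinearMap.congr_fun h x).symm)
    have conj_linear : (f.lTensor P).toLinearMap ∘ₗ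
        (galoisMap (m ∘ₗ e.toLinearMap) δ).restrictScalars k =
          (galoisMap m d).restrictScalars k ∘ₗ (e.lTensor P).toLinearMap :=
      TensorProduct.ext' on_tmul
    exact congrArg DFunLike.coe conj_linear
  refine (Function.Bijective.of_comp_iff' (f.lTensor P).bijective _).1 ?_
  rw [conj]
  exact hm.comp (e.lTensor P).bijective

theorem galoisMap_mulMap_bijective {m : M →ₗ[k] P} {m' : M' →ₗ[k] P} {δ : M →ₗ[k] M ⊗[k] C}
    {δ' : M' →ₗ[k] M' ⊗[k] C'} (h : Function.Bijective (galoisMap m δ))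
    (h' : Function.Bijective (galoisMap m' δ')) :
    Function.Bijective (galoisMap (mulMap m m') (outer δ δ')) := by
  let G := (LinearEquiv.ofBijective (galoisMap m δ) h).restrictScalars k
  let G' := (LinearEquiv.ofBijective (galoisMap m' δ') h').restrictScalars k
  let E : P ⊗[k] (M ⊗[k] M') ≃ₗ[k] P ⊗[k] (C ⊗[k] C') :=
    (TensorProduct.assoc k P M M').symm ≪≫ₗ G.rTensor M' ≪≫ₗ TensorProduct.rightComm k P C M' ≪≫ₗ
      G'.rTensor C ≪≫ₗ TensorProduct.rightComm k P C' C ≪≫ₗ TensorProduct.assoc k P C C'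
  let T : (P ⊗[k] C) ⊗[k] (M' ⊗[k] C') →ₗ[k] P ⊗[k] (C ⊗[k] C') :=
    (mulMap LinearMap.id m').rTensor (C ⊗[k] C') ∘ₗ
      (TensorProduct.tensorTensorTensorComm k P C M' C').toLinearMap
  have mul_snd : ∀ (t : P ⊗[k] C) (y : M'), TensorProduct.assoc k P C C'
      (TensorProduct.rightComm k P C' C (G'.rTensor C (TensorProduct.rightComm k P C M'
        (t ⊗ₜ y)))) = T (t ⊗ₜ δ' y) := by
    have shuffle : ∀ (q : P) (c : C), (TensorProduct.assoc k P C C').toLinearMap ∘ₗ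
        (TensorProduct.rightComm k P C' C).toLinearMap ∘ₗ
          (TensorProduct.mk k (P ⊗[k] C') C).flip c ∘ₗ
            (LinearMap.mulLeft k q).rTensor C' ∘ₗ m'.rTensor C' =
        T ∘ₗ TensorProduct.mk k (P ⊗[k] C) (M' ⊗[k] C') (q ⊗ₜ c) := by
      intro q c; ext; simp [T]
    intro t y
    induction t with
    | zero => simp
    | add s t hs ht => simp only [TensorProduct.add_tmul, map_add, hs, ht]
    | tmul q c => exact LinearMap.congr_fun (shuffle q c) (δ' y)
  have mul_fst : ∀ p : P, T ∘ₗ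
      ((LinearMap.mulLeft k p).rTensor C ∘ₗ m.rTensor C).rTensor (M' ⊗[k] C') =
        (LinearMap.mulLeft k p).rTensor (C ⊗[k] C') ∘ₗ (mulMap m m').rTensor (C ⊗[k] C') ∘ₗ
          (TensorProduct.tensorTensorTensorComm k M C M' C').toLinearMap := by
    intro p; ext; simp [T, mul_assoc]
  have galoisMap_eq : (galoisMap (mulMap m m') (outer δ δ')).restrictScalars k =
      E.toLinearMap := by
    ext p x y
    exact (LinearMap.congr_fun (mul_fst p) (δ x ⊗ₜ δ' y)).symm.trans
      (mul_snd (G (p ⊗ₜ x)) y).symm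
  exact (congrArg (fun f : _ →ₗ[k] _ => Function.Bijective f) galoisMap_eq).mpr E.bijective

end GaloisMapProduct

section BiGalois

variable {k : Type*} [CommRing k] {Z : Type*} [Ring Z] [Algebra k Z]

/-- The left comodule algebra structure `β` over `A`, written as a right coaction. -/
def opCoaction {A : Type*} [Ring A] [Algebra k A] (β : Z →ₐ[k] A ⊗[k] Z) : Z →ₐ[k] Z ⊗[k] A :=
  (Algebra.TensorProduct.comm k A Z).toAlgHom.comp β

/-- The coaction `ρ` on the opposite algebra. A left Galois object becomes a right one for the
opposite product, which is how the two sides of a biGalois object are treated alike. -/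
def opAlgHom {B : Type*} [Ring B] [Algebra k B] (ρ : Z →ₐ[k] Z ⊗[k] B) :
    Zᵐᵒᵖ →ₐ[k] Zᵐᵒᵖ ⊗[k] Bᵐᵒᵖ :=
  (Algebra.TensorProduct.opAlgEquiv k k Z B).symm.toAlgHom.comp (AlgHom.op ρ)

/-- The map `m` with values in the opposite algebra. -/
def opComp {M : Type*} [AddCommGroup M] [Module k M] (m : M →ₗ[k] Z) : M →ₗ[k] Zᵐᵒᵖ :=
  (MulOpposite.opLinearEquiv k).toLinearMap ∘ₗ m

section

variable {M M' C C' B : Type*} [AddCommGroup M] [Module k M] [AddCommGroup M'] [Module k M']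
  [AddCommGroup C] [Module k C] [AddCommGroup C'] [Module k C'] [Ring B] [Algebra k B]

theorem opComul_opComul (Δ : C →ₗ[k] C ⊗[k] C) : opComul (opComul Δ) = Δ :=
  LinearMap.ext fun x => (TensorProduct.comm k C C).symm_apply_apply (Δ x)

theorem opComp_mulMap (m : M →ₗ[k] Z) (m' : M' →ₗ[k] Z) :
    opComp (mulMap m m') =
      mulMap (opComp m') (opComp m) ∘ₗ (TensorProduct.comm k M M').toLinearMap :=
  TensorProduct.ext' fun _ _ => rfl

theorem opAlgHom_comp_opComp (ρ : Z →ₐ[k] Z ⊗[k] B) {m : M →ₗ[k] Z} {δ : M →ₗ[k] M ⊗[k] C}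
    {g : C →ₗ[k] B} (h : ρ.toLinearMap ∘ₗ m = TensorProduct.map m g ∘ₗ δ) :
    (opAlgHom ρ).toLinearMap ∘ₗ opComp m = TensorProduct.map (opComp m) (opComp g) ∘ₗ δ := by
  have op_map : (Algebra.TensorProduct.opAlgEquiv k k Z B).symm.toLinearMap ∘ₗ
      (MulOpposite.opLinearEquiv k).toLinearMap ∘ₗ TensorProduct.map m g =
        TensorProduct.map (opComp m) (opComp g) := by
    ext; simp [opComp]
  ext x
  exact (congrArg _ (LinearMap.congr_fun h x)).trans (LinearMap.congr_fun op_map (δ x))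

theorem galoisMap_opComp_mulMap_bijective {m : M →ₗ[k] Z} {m' : M' →ₗ[k] Z}
    {δ : M →ₗ[k] M ⊗[k] C} {δ' : M' →ₗ[k] M' ⊗[k] C'}
    (h : Function.Bijective (galoisMap (opComp m) δ))
    (h' : Function.Bijective (galoisMap (opComp m') δ')) :
    Function.Bijective (galoisMap (opComp (mulMap m m')) (outer δ δ')) := by
  rw [opComp_mulMap]
  exact galoisMap_bijective_of_equiv _ (TensorProduct.comm k C C') (outer_comp_comm δ δ')
    (galoisMap_mulMap_bijective h' h)

end

variable {A B : Type*} [Ring A] [Bialgebra k A] [Ring B] [Bialgebra k B]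
  {β : Z →ₐ[k] A ⊗[k] Z} {ρ : Z →ₐ[k] Z ⊗[k] B}

theorem IsLeftGalois.isCoaction (h : IsLeftGalois β) :
    IsCoaction (opComul comul) counit (opCoaction β).toLinearMap where
  coassoc := by
    let T : A ⊗[k] (A ⊗[k] Z) →ₗ[k] Z ⊗[k] (A ⊗[k] A) :=
      (TensorProduct.assoc k Z A A).toLinearMap ∘ₗ
        (TensorProduct.comm k A Z).toLinearMap.rTensor A ∘ₗ
          (TensorProduct.comm k A (A ⊗[k] Z)).toLinearMap
    have coact_comm : (TensorProduct.assoc k Z A A).toLinearMap ∘ₗ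
        (opCoaction β).toLinearMap.rTensor A ∘ₗ (TensorProduct.comm k A Z).toLinearMap =
          T ∘ₗ β.toLinearMap.lTensor A := by
      ext; simp [T, opCoaction]
    have comul_comm : (opComul (comul (R := k))).lTensor Z ∘ₗ
        (TensorProduct.comm k A Z).toLinearMap =
          (TensorProduct.comm k A A).toLinearMap.lTensor Z ∘ₗ
            (TensorProduct.comm k (A ⊗[k] A) Z).toLinearMap ∘ₗ comul.rTensor Z := by
      ext; simp [opComul]
    have reverse : T ∘ₗ (TensorProduct.assoc k A A Z).toLinearMap =
        (TensorProduct.comm k A A).toLinearMap.lTensor Z ∘ₗ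
          (TensorProduct.comm k (A ⊗[k] A) Z).toLinearMap := by
      ext; simp [T]
    calc _ = T ∘ₗ β.toLinearMap.lTensor A ∘ₗ β.toLinearMap :=
          congrArg (· ∘ₗ β.toLinearMap) coact_comm
      _ = _ := congrArg (T ∘ₗ ·) h.coassoc.symm
      _ = _ := congrArg (· ∘ₗ comul.rTensor Z ∘ₗ β.toLinearMap) reverse
      _ = _ := congrArg (· ∘ₗ β.toLinearMap) comul_comm.symm
  counit_comp := by
    have counit_comm : (TensorProduct.rid k Z).toLinearMap ∘ₗ counit.lTensor Z ∘ₗ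
        (TensorProduct.comm k A Z).toLinearMap =
          (TensorProduct.lid k Z).toLinearMap ∘ₗ counit.rTensor Z := by
      ext; simp
    exact (congrArg (· ∘ₗ β.toLinearMap) counit_comm).trans h.counit_comp

theorem IsRightGalois.isCoaction (h : IsRightGalois ρ) :
    IsCoaction comul counit ρ.toLinearMap := ⟨h.coassoc, h.counit_comp⟩

theorem IsLeftGalois.galoisMap_bijective (h : IsLeftGalois β) :
    Function.Bijective
      (galoisMap (opComp (LinearMap.id : Z →ₗ[k] Z)) (opCoaction β).toLinearMap) := by
  let op : Z ≃ₗ[k] Zᵐᵒᵖ := MulOpposite.opLinearEquiv k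
  let E := op.symm.rTensor Z ≪≫ₗ TensorProduct.comm k Z Z ≪≫ₗ
    LinearEquiv.ofBijective _ h.bijective ≪≫ₗ TensorProduct.comm k A Z ≪≫ₗ op.rTensor A
  have reverse_mul : ∀ t : Z, (LinearMap.mulLeft k (op t)).rTensor A ∘ₗ
      (opComp (LinearMap.id : Z →ₗ[k] Z)).rTensor A ∘ₗ (TensorProduct.comm k A Z).toLinearMap =
        (op.rTensor A).toLinearMap ∘ₗ (TensorProduct.comm k A Z).toLinearMap ∘ₗ
          (LinearMap.mul' k Z).lTensor A ∘ₗ (TensorProduct.assoc k A Z Z).toLinearMap ∘ₗ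
            (TensorProduct.mk k (A ⊗[k] Z) Z).flip t := by
    intro t; ext; simp [opComp, op]
  have galoisMap_eq : (galoisMap (opComp (LinearMap.id : Z →ₗ[k] Z))
      (opCoaction β).toLinearMap).restrictScalars k = E.toLinearMap :=
    TensorProduct.ext' fun t x => LinearMap.congr_fun (reverse_mul t.unop) (β x)
  exact (congrArg (fun f : _ →ₗ[k] _ => Function.Bijective f) galoisMap_eq).mpr E.bijective

theorem IsRightGalois.galoisMap_bijective (h : IsRightGalois ρ) :
    Function.Bijective (galoisMap LinearMap.id ρ.toLinearMap) := by
  have assoc_mul : ∀ t : Z, (LinearMap.mulLeft k t).rTensor B ∘ₗ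
      (LinearMap.id : Z →ₗ[k] Z).rTensor B =
        (LinearMap.mul' k Z).rTensor B ∘ₗ (TensorProduct.assoc k Z Z B).symm.toLinearMap ∘ₗ
          TensorProduct.mk k Z (Z ⊗[k] B) t := by
    intro t; ext; simp
  have galoisMap_eq : (galoisMap LinearMap.id ρ.toLinearMap).restrictScalars k =
      (LinearMap.mul' k Z).rTensor B ∘ₗ (TensorProduct.assoc k Z Z B).symm.toLinearMap ∘ₗ
        ρ.toLinearMap.lTensor Z :=
    TensorProduct.ext' fun t x => LinearMap.congr_fun (assoc_mul t) (ρ x)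
  exact (congrArg (fun f : _ →ₗ[k] _ => Function.Bijective f) galoisMap_eq).mpr h.bijective

theorem IsLeftGalois.hasTrivialCoinvariants (h : IsLeftGalois β) :
    HasTrivialCoinvariants (opCoaction β) where
  mem_range z hz := (h.coinvariants z).1 ((TensorProduct.comm k A Z).injective hz)
  injective := h.injective_algebraMap

theorem IsRightGalois.hasTrivialCoinvariants_op (h : IsRightGalois ρ) :
    HasTrivialCoinvariants (opAlgHom ρ) where
  mem_range z hz := by
    have op_eq := congrArg (Algebra.TensorProduct.opAlgEquiv k k Z B) hz
    obtain ⟨r, hr⟩ := (h.coinvariants z.unop).1 (MulOpposite.op_injective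
      (((Algebra.TensorProduct.opAlgEquiv k k Z B).apply_symm_apply _).symm.trans op_eq))
    exact ⟨r, MulOpposite.unop_injective hr⟩
  injective := MulOpposite.op_injective.comp h.injective_algebraMap

theorem IsBiGalois.coactionsCommute (h : IsBiGalois β ρ) :
    CoactionsCommute ρ.toLinearMap (opCoaction β).toLinearMap := by
  let T : A ⊗[k] (Z ⊗[k] B) →ₗ[k] (Z ⊗[k] A) ⊗[k] B :=
    (TensorProduct.comm k A Z).toLinearMap.rTensor B ∘ₗ
      (TensorProduct.assoc k A Z B).symm.toLinearMap
  have left_coact : (opCoaction β).toLinearMap.rTensor B =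
      T ∘ₗ (TensorProduct.assoc k A Z B).toLinearMap ∘ₗ β.toLinearMap.rTensor B := by
    ext; simp [T, opCoaction]
  have right_coact : (TensorProduct.rightComm k Z B A).toLinearMap ∘ₗ
      ρ.toLinearMap.rTensor A ∘ₗ (TensorProduct.comm k A Z).toLinearMap =
        T ∘ₗ ρ.toLinearMap.lTensor A := by
    have rightComm_comm : (TensorProduct.rightComm k Z B A).toLinearMap ∘ₗ
        (TensorProduct.comm k A (Z ⊗[k] B)).toLinearMap = T := by
      ext; simp [T]
    rw [← rightComm_comm]
    ext; simp
  calc _ = _ := congrArg (· ∘ₗ ρ.toLinearMap) left_coact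
    _ = _ := congrArg (T ∘ₗ ·) h.bicomodule
    _ = _ := congrArg (· ∘ₗ β.toLinearMap) right_coact.symm

variable {M M' C C' D D' : Type*} [AddCommGroup M] [Module k M] [AddCommGroup M'] [Module k M']
  [AddCommGroup C] [Module k C] [AddCommGroup C'] [Module k C']
  [AddCommGroup D] [Module k D] [AddCommGroup D'] [Module k D']
  [Coalgebra k C] [Coalgebra k C'] [Coalgebra k D] [Coalgebra k D']

/-- `m : M → Z` is a map of bicomodules along `g : D → A` and `g' : C → B`, with bijective Galois
maps on both sides. The case `M = Z ⊗ Z` of the product of `Z` lets forms on `A ⊗ A` be compared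
with forms on `B ⊗ B`. -/
structure IsBiGaloisMap (β : Z →ₐ[k] A ⊗[k] Z) (ρ : Z →ₐ[k] Z ⊗[k] B) (m : M →ₗ[k] Z)
    (lam : M →ₗ[k] M ⊗[k] D) (δ : M →ₗ[k] M ⊗[k] C) (g : D →ₗ[k] A) (g' : C →ₗ[k] B) : Prop where
  left : IsCoaction (opComul comul) counit lam
  right : IsCoaction comul counit δ
  commute : CoactionsCommute δ lam
  map_left : (opCoaction β).toLinearMap ∘ₗ m = TensorProduct.map m g ∘ₗ lam
  map_right : ρ.toLinearMap ∘ₗ m = TensorProduct.map m g' ∘ₗ δ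
  bijective_left : Function.Bijective (galoisMap (opComp m) lam)
  bijective_right : Function.Bijective (galoisMap m δ)

theorem IsBiGalois.isBiGaloisMap (h : IsBiGalois β ρ) :
    IsBiGaloisMap β ρ LinearMap.id (opCoaction β).toLinearMap ρ.toLinearMap
      LinearMap.id LinearMap.id where
  left := h.left.isCoaction
  right := h.right.isCoaction
  commute := h.coactionsCommute
  map_left := by rw [TensorProduct.map_id, LinearMap.comp_id, LinearMap.id_comp]
  map_right := by rw [TensorProduct.map_id, LinearMap.comp_id, LinearMap.id_comp]
  bijective_left := h.left.galoisMap_bijective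
  bijective_right := h.right.galoisMap_bijective

variable {m : M →ₗ[k] Z} {lam : M →ₗ[k] M ⊗[k] D} {δ : M →ₗ[k] M ⊗[k] C}
  {g : D →ₗ[k] A} {g' : C →ₗ[k] B}

theorem IsBiGaloisMap.mul (h : IsBiGaloisMap β ρ m lam δ g g') {m' : M' →ₗ[k] Z}
    {lam' : M' →ₗ[k] M' ⊗[k] D'} {δ' : M' →ₗ[k] M' ⊗[k] C'} {f : D' →ₗ[k] A} {f' : C' →ₗ[k] B}
    (h' : IsBiGaloisMap β ρ m' lam' δ' f f') :
    IsBiGaloisMap β ρ (mulMap m m') (outer lam lam') (outer δ δ') (mulMap g f)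
      (mulMap g' f') where
  left := by simpa only [outer_opComul, outer_comul, outer_counit] using h.left.outer h'.left
  right := by simpa only [outer_comul, outer_counit] using h.right.outer h'.right
  commute := h.commute.outer h'.commute
  map_left := algHom_comp_mulMap (opCoaction β) h.map_left h'.map_left
  map_right := algHom_comp_mulMap ρ h.map_right h'.map_right
  bijective_left := galoisMap_opComp_mulMap_bijective h.bijective_left h'.bijective_left
  bijective_right := galoisMap_mulMap_bijective h.bijective_right h'.bijective_right

/-- The forms `σ` and `τ` define the same deformation of `m`. -/
def IsIntertwined (m : M →ₗ[k] Z) (lam : M →ₗ[k] M ⊗[k] D) (δ : M →ₗ[k] M ⊗[k] C)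
    (σ : WithConv (D →ₗ[k] k)) (τ : WithConv (C →ₗ[k] k)) : Prop :=
  m ∘ₗ act lam σ = m ∘ₗ act δ τ

theorem IsBiGaloisMap.intertwined_one (h : IsBiGaloisMap β ρ m lam δ g g') :
    IsIntertwined m lam δ 1 1 := by
  rw [IsIntertwined, act_one h.left, act_one h.right]

theorem IsBiGaloisMap.intertwined_mul (h : IsBiGaloisMap β ρ m lam δ g g')
    {σ σ' : WithConv (D →ₗ[k] k)} {τ τ' : WithConv (C →ₗ[k] k)} (hτ : IsIntertwined m lam δ σ τ)
    (hτ' : IsIntertwined m lam δ σ' τ') : IsIntertwined m lam δ (σ * σ') (τ * τ') := by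
  calc m ∘ₗ act lam (σ * σ') = (m ∘ₗ act lam σ') ∘ₗ act lam σ := by
        rw [act_mul_op h.left, LinearMap.comp_assoc]
    _ = (m ∘ₗ act lam σ) ∘ₗ act δ τ' := by
        rw [hτ', LinearMap.comp_assoc, h.commute.act_comp_act, LinearMap.comp_assoc]
    _ = m ∘ₗ act δ (τ * τ') := by rw [hτ, act_mul h.right, LinearMap.comp_assoc]

theorem IsBiGaloisMap.unique_right (h : IsBiGaloisMap β ρ m lam δ g g')
    (hZ : Function.Injective (algebraMap k Z)) {σ : WithConv (D →ₗ[k] k)}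
    {τ τ' : WithConv (C →ₗ[k] k)} (hτ : IsIntertwined m lam δ σ τ)
    (hτ' : IsIntertwined m lam δ σ τ') : τ = τ' :=
  act_injective h.bijective_right.2 hZ (hτ.symm.trans hτ')

theorem IsBiGaloisMap.unique_left (h : IsBiGaloisMap β ρ m lam δ g g')
    (hZ : Function.Injective (algebraMap k Z)) {σ σ' : WithConv (D →ₗ[k] k)}
    {τ : WithConv (C →ₗ[k] k)} (hσ : IsIntertwined m lam δ σ τ)
    (hσ' : IsIntertwined m lam δ σ' τ) : σ = σ' :=
  act_injective h.bijective_left.2 (MulOpposite.op_injective.comp hZ)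
    (congrArg opComp (hσ.trans hσ'.symm))

theorem IsBiGaloisMap.exists_right (h : IsBiGaloisMap β ρ m lam δ g g') (hβ : IsLeftGalois β)
    (hB : Function.Injective (TensorProduct.mk k Z B 1)) {σ : WithConv (D →ₗ[k] k)}
    (hσ : Commute (convScalar A σ) (.toConv g)) :
    ∃ τ, IsIntertwined m lam δ σ τ ∧ Commute (convScalar B τ) (.toConv g') := by
  have hσ_op : g ∘ₗ act (opComul comul) σ = g ∘ₗ act (opComul (opComul comul)) σ := by
    rw [opComul_opComul]
    exact (commute_convScalar_iff.1 hσ).symm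
  obtain ⟨τ, hτ, central⟩ := hβ.hasTrivialCoinvariants.exists_central hB h.right h.left h.commute
    h.map_left h.map_right h.bijective_right hσ_op
  exact ⟨τ, hτ, commute_convScalar_iff.2 central⟩

theorem IsBiGaloisMap.exists_left (h : IsBiGaloisMap β ρ m lam δ g g') (hρ : IsRightGalois ρ)
    (hA : Function.Injective (TensorProduct.mk k Z A 1)) {τ : WithConv (C →ₗ[k] k)}
    (hτ : Commute (convScalar B τ) (.toConv g')) :
    ∃ σ, IsIntertwined m lam δ σ τ ∧ Commute (convScalar A σ) (.toConv g) := by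
  let op : Z ≃ₗ[k] Zᵐᵒᵖ := MulOpposite.opLinearEquiv k
  have hA_op : Function.Injective (TensorProduct.mk k Zᵐᵒᵖ A 1) :=
    (op.rTensor A).injective.comp hA
  have map_left : ((op.rTensor A).toLinearMap ∘ₗ (opCoaction β).toLinearMap ∘ₗ
      op.symm.toLinearMap) ∘ₗ opComp m = TensorProduct.map (opComp m) g ∘ₗ lam := by
    calc _ = op.toLinearMap.rTensor A ∘ₗ (opCoaction β).toLinearMap ∘ₗ m := rfl
      _ = _ := by rw [h.map_left, ← LinearMap.comp_assoc, LinearMap.rTensor_comp_map]; rfl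
  obtain ⟨σ, hσ, central⟩ := hρ.hasTrivialCoinvariants_op.exists_central hA_op h.left h.right
    h.commute.symm (opAlgHom_comp_opComp ρ h.map_right) map_left h.bijective_left
    (congrArg opComp (commute_convScalar_iff.1 hτ))
  refine ⟨σ, LinearMap.ext fun x => MulOpposite.op_injective (LinearMap.congr_fun hσ.symm x),
    commute_convScalar_iff.2 ?_⟩
  rw [central, opComul_opComul]

end BiGalois

section Transport

theorem exists_unit_of_rel {P Q : Type*} [Monoid P] [Monoid Q] {R : P → Q → Prop}
    (one : R 1 1) (mul : ∀ {σ σ' τ τ'}, R σ τ → R σ' τ' → R (σ * σ') (τ * τ'))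
    (unique : ∀ {σ τ τ'}, R σ τ → R σ τ' → τ = τ') {σ : Pˣ} {τ τ' : Q} (h : R σ.val τ)
    (h' : R σ⁻¹.val τ') : ∃ φ : Qˣ, φ.val = τ ∧ φ⁻¹.val = τ' :=
  ⟨⟨τ, τ', unique (by simpa using mul h h') one, unique (by simpa using mul h' h) one⟩, rfl, rfl⟩

theorem exists_units_map_eq {P Q : Type*} [Monoid P] [Monoid Q] {f : P →* Q}
    (hf : Function.Injective f) {q : Qˣ} {p p' : P} (hp : f p = q.val) (hp' : f p' = q⁻¹.val) :
    ∃ u : Pˣ, Units.map f u = q := by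
  obtain ⟨u, rfl, -⟩ := exists_unit_of_rel (R := fun q p => f p = q) (map_one f)
    (fun h h' => (map_mul f _ _).trans (congrArg₂ _ h h'))
    (fun h h' => hf (h.trans h'.symm)) hp hp'
  exact ⟨u, Units.ext hp⟩

theorem nonempty_HL2_mulEquiv_of_rel {k : Type*} [CommRing k] {A : Type*} [Ring A] [Bialgebra k A]
    {B : Type*} [Ring B] [Bialgebra k B] (R : Conv2 k A → Conv2 k B → Prop)
    (mul : ∀ {σ σ' τ τ'}, R σ τ → R σ' τ' → R (σ * σ') (τ * τ'))
    (unique_right : ∀ {σ τ τ'}, R σ τ → R σ τ' → τ = τ')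
    (unique_left : ∀ {σ σ' τ}, R σ τ → R σ' τ → σ = σ')
    (exists_right : ∀ σ ∈ ZL2 k A, ∃ τ ∈ ZL2 k B, R σ τ)
    (exists_left : ∀ τ ∈ ZL2 k B, ∃ σ ∈ ZL2 k A, R σ τ)
    (coboundary_right : ∀ μ ∈ Reg1L k A, ∃ ν ∈ Reg1L k B, R (coboundary μ) (coboundary ν))
    (coboundary_left : ∀ ν ∈ Reg1L k B, ∃ μ ∈ Reg1L k A, R (coboundary μ) (coboundary ν)) :
    Nonempty (HL2 k A ≃* HL2 k B) := by
  choose f hf rel_f using exists_right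
  let F : ZL2 k A →* ZL2 k B := MonoidHom.mk' (fun σ => ⟨f σ.1 σ.2, hf σ.1 σ.2⟩) fun σ σ' =>
    Subtype.ext (unique_right (rel_f _ _) (mul (rel_f σ.1 σ.2) (rel_f σ'.1 σ'.2)))
  have rel_F : ∀ σ, R σ.1 (F σ).1 := fun σ => rel_f σ.1 σ.2
  have bijective_F : Function.Bijective F := by
    refine ⟨fun σ σ' h => Subtype.ext (unique_left (rel_F σ) (h ▸ rel_F σ')), fun τ => ?_⟩
    obtain ⟨σ, hσ, h⟩ := exists_left τ.1 τ.2
    exact ⟨⟨σ, hσ⟩, Subtype.ext (unique_right (rel_F _) h)⟩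
  refine ⟨QuotientGroup.congr (BL2 k A) (BL2 k B) (MulEquiv.ofBijective F bijective_F) ?_⟩
  ext τ
  rw [Subgroup.mem_map]
  constructor
  · rintro ⟨σ, ⟨μ, hμ, h⟩, rfl⟩
    obtain ⟨ν, hν, h'⟩ := coboundary_right μ hμ
    exact ⟨ν, hν, unique_right (rel_F σ) (h ▸ h')⟩
  · rintro ⟨ν, hν, h⟩
    obtain ⟨μ, hμ, h'⟩ := coboundary_left ν hν
    obtain ⟨σ, rfl⟩ := bijective_F.2 τ
    exact ⟨σ, ⟨μ, hμ, unique_left (rel_F σ) (h ▸ h')⟩, rfl⟩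

end Transport

section ComoduleAlgebra

variable {k : Type*} [CommRing k] {Z : Type*} [Ring Z] [Algebra k Z]
  {R : Type*} [Ring R] [Bialgebra k R] {Δ : R →ₗ[k] R ⊗[k] R} {b : Z →ₐ[k] Z ⊗[k] R}

theorem mulMap_id : mulMap (LinearMap.id : Z →ₗ[k] Z) LinearMap.id = LinearMap.mul' k Z := by
  ext; simp

theorem algHom_comp_mul' (b : Z →ₐ[k] Z ⊗[k] R) : b.toLinearMap ∘ₗ LinearMap.mul' k Z =
    TensorProduct.map (LinearMap.mul' k Z) (LinearMap.mul' k R) ∘ₗ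
      outer b.toLinearMap b.toLinearMap := by
  have colinear_id : b.toLinearMap ∘ₗ LinearMap.id =
      TensorProduct.map LinearMap.id LinearMap.id ∘ₗ b.toLinearMap := by
    rw [TensorProduct.map_id, LinearMap.comp_id, LinearMap.id_comp]
  simpa only [mulMap_id] using algHom_comp_mulMap b colinear_id colinear_id

theorem act_comp_mul' (b : Z →ₐ[k] Z ⊗[k] R) (μ : WithConv (R →ₗ[k] k)) :
    act b.toLinearMap μ ∘ₗ LinearMap.mul' k Z = LinearMap.mul' k Z ∘ₗ
      act (outer b.toLinearMap b.toLinearMap) (convPull (Bialgebra.mulCoalgHom k R) μ) :=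
  act_comp_of_comp (LinearMap.mul' k Z) (Bialgebra.mulCoalgHom k R) (algHom_comp_mul' b) μ

theorem act_apply_one (b : Z →ₐ[k] Z ⊗[k] R) (μ : WithConv (R →ₗ[k] k)) :
    act b.toLinearMap μ 1 = algebraMap k Z (μ (1 : R)) := by
  simp only [act, LinearMap.comp_apply, AlgHom.toLinearMap_apply, map_one,
    Algebra.TensorProduct.one_def, LinearMap.lTensor_tmul, LinearEquiv.coe_coe,
    TensorProduct.rid_tmul, Algebra.algebraMap_eq_smul_one]

theorem act_convPull_inlHom (b : Z →ₐ[k] Z ⊗[k] R) (τ : WithConv (R ⊗[k] R →ₗ[k] k)) :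
    act b.toLinearMap (convPull (inlHom k R) τ) = (LinearMap.mul' k Z ∘ₗ
      act (outer b.toLinearMap b.toLinearMap) τ) ∘ₗ (TensorProduct.mk k Z Z).flip 1 := by
  have shuffle_one : (TensorProduct.tensorTensorTensorComm k Z R Z R).toLinearMap ∘ₗ
      (TensorProduct.mk k (Z ⊗[k] R) (Z ⊗[k] R)).flip (1 ⊗ₜ 1) =
      TensorProduct.map ((TensorProduct.mk k Z Z).flip 1) ((TensorProduct.mk k R R).flip 1) := by
    ext; simp
  have colinear_inl : outer b.toLinearMap b.toLinearMap ∘ₗ (TensorProduct.mk k Z Z).flip 1 =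
      TensorProduct.map ((TensorProduct.mk k Z Z).flip 1) (inlHom k R).toLinearMap ∘ₗ
        b.toLinearMap := by
    ext x
    simp only [LinearMap.comp_apply, outer, LinearMap.flip_apply, TensorProduct.mk_apply,
      TensorProduct.map_tmul, AlgHom.toLinearMap_apply, map_one, Algebra.TensorProduct.one_def]
    exact LinearMap.congr_fun shuffle_one (b x)
  rw [LinearMap.comp_assoc, act_comp_of_comp _ (inlHom k R) colinear_inl]
  ext x; simp

theorem act_convPull_inrHom (b : Z →ₐ[k] Z ⊗[k] R) (τ : WithConv (R ⊗[k] R →ₗ[k] k)) :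
    act b.toLinearMap (convPull (inrHom k R) τ) = (LinearMap.mul' k Z ∘ₗ
      act (outer b.toLinearMap b.toLinearMap) τ) ∘ₗ TensorProduct.mk k Z Z 1 := by
  have shuffle_one : (TensorProduct.tensorTensorTensorComm k Z R Z R).toLinearMap ∘ₗ
      TensorProduct.mk k (Z ⊗[k] R) (Z ⊗[k] R) (1 ⊗ₜ 1) =
      TensorProduct.map (TensorProduct.mk k Z Z 1) (TensorProduct.mk k R R 1) := by
    ext; simp
  have colinear_inr : outer b.toLinearMap b.toLinearMap ∘ₗ TensorProduct.mk k Z Z 1 =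
      TensorProduct.map (TensorProduct.mk k Z Z 1) (inrHom k R).toLinearMap ∘ₗ
        b.toLinearMap := by
    ext x
    simp only [LinearMap.comp_apply, outer, TensorProduct.mk_apply, TensorProduct.map_tmul,
      AlgHom.toLinearMap_apply, map_one, Algebra.TensorProduct.one_def]
    exact LinearMap.congr_fun shuffle_one (b x)
  rw [LinearMap.comp_assoc, act_comp_of_comp _ (inrHom k R) colinear_inr]
  ext x; simp

theorem mulMap_mul'_id : mulMap (LinearMap.mul' k Z) LinearMap.id =
    LinearMap.mul' k Z ∘ₗ (LinearMap.mul' k Z).rTensor Z := by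
  ext; simp

theorem mulMap_mul'_id_assoc : mulMap (LinearMap.mul' k Z) LinearMap.id =
    LinearMap.mul' k Z ∘ₗ (LinearMap.mul' k Z).lTensor Z ∘ₗ
      (TensorProduct.assoc k Z Z Z).toLinearMap := by
  ext; simp [mul_assoc]

theorem act_face12 (hb : IsCoaction Δ counit b.toLinearMap) (σ : Conv2 k R) :
    mulMap (LinearMap.mul' k Z) LinearMap.id ∘ₗ
      act (outer (outer b.toLinearMap b.toLinearMap) b.toLinearMap) (face12 σ).val =
    LinearMap.mul' k Z ∘ₗ (LinearMap.mul' k Z ∘ₗ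
      act (outer b.toLinearMap b.toLinearMap) σ.val).rTensor Z := by
  rw [mulMap_mul'_id, LinearMap.comp_assoc, LinearMap.rTensor_comp,
    ← act_outer_fst hb (δ := outer b.toLinearMap b.toLinearMap)]
  rfl

theorem act_face23 (hb : IsCoaction Δ counit b.toLinearMap) (σ : Conv2 k R) :
    mulMap (LinearMap.mul' k Z) LinearMap.id ∘ₗ
      act (outer (outer b.toLinearMap b.toLinearMap) b.toLinearMap) (face23 σ).val =
    LinearMap.mul' k Z ∘ₗ (LinearMap.mul' k Z ∘ₗ
      act (outer b.toLinearMap b.toLinearMap) σ.val).lTensor Z ∘ₗ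
        (TensorProduct.assoc k Z Z Z).toLinearMap := by
  have act_assoc := act_comp_of_comp _ (Coalgebra.TensorProduct.assoc k k R R R :
    (R ⊗[k] R) ⊗[k] R →ₗc[k] R ⊗[k] (R ⊗[k] R))
    (outer_comp_assoc b.toLinearMap b.toLinearMap b.toLinearMap)
    (convPull (sndHom k R (R ⊗[k] R)) σ.val)
  rw [act_outer_snd hb] at act_assoc
  rw [mulMap_mul'_id_assoc, LinearMap.lTensor_comp, LinearMap.comp_assoc, LinearMap.comp_assoc,
    LinearMap.comp_assoc, act_assoc]
  rfl

theorem act_faceMulLeft (b : Z →ₐ[k] Z ⊗[k] R) (σ : Conv2 k R) :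
    mulMap (LinearMap.mul' k Z) LinearMap.id ∘ₗ
      act (outer (outer b.toLinearMap b.toLinearMap) b.toLinearMap) (faceMulLeft σ).val =
    (LinearMap.mul' k Z ∘ₗ act (outer b.toLinearMap b.toLinearMap) σ.val) ∘ₗ
      (LinearMap.mul' k Z).rTensor Z := by
  have colinear_mul : outer b.toLinearMap b.toLinearMap ∘ₗ (LinearMap.mul' k Z).rTensor Z =
      TensorProduct.map ((LinearMap.mul' k Z).rTensor Z) ((LinearMap.mul' k R).rTensor R) ∘ₗ
        outer (outer b.toLinearMap b.toLinearMap) b.toLinearMap :=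
    outer_comp_map (algHom_comp_mul' b) (by simp)
  rw [LinearMap.comp_assoc, act_comp_of_comp _ (Coalgebra.TensorProduct.map
    (Bialgebra.mulCoalgHom k R) (CoalgHom.id k R)) colinear_mul, mulMap_mul'_id]
  rfl

theorem act_faceMulRight (b : Z →ₐ[k] Z ⊗[k] R) (σ : Conv2 k R) :
    mulMap (LinearMap.mul' k Z) LinearMap.id ∘ₗ
      act (outer (outer b.toLinearMap b.toLinearMap) b.toLinearMap) (faceMulRight σ).val =
    (LinearMap.mul' k Z ∘ₗ act (outer b.toLinearMap b.toLinearMap) σ.val) ∘ₗ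
      (LinearMap.mul' k Z).lTensor Z ∘ₗ (TensorProduct.assoc k Z Z Z).toLinearMap := by
  have colinear_mul : outer b.toLinearMap b.toLinearMap ∘ₗ (LinearMap.mul' k Z).lTensor Z =
      TensorProduct.map ((LinearMap.mul' k Z).lTensor Z) ((LinearMap.mul' k R).lTensor R) ∘ₗ
        outer b.toLinearMap (outer b.toLinearMap b.toLinearMap) :=
    outer_comp_map (by simp) (algHom_comp_mul' b)
  rw [LinearMap.comp_assoc, ← LinearMap.comp_assoc _ _ (act _ _),
    act_comp_of_comp _ (Coalgebra.TensorProduct.map (CoalgHom.id k R)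
      (Bialgebra.mulCoalgHom k R)) colinear_mul, LinearMap.comp_assoc,
    act_comp_of_comp _ (Coalgebra.TensorProduct.assoc k k R R R :
      (R ⊗[k] R) ⊗[k] R →ₗc[k] R ⊗[k] (R ⊗[k] R))
      (outer_comp_assoc b.toLinearMap b.toLinearMap b.toLinearMap), mulMap_mul'_id_assoc]
  rfl

end ComoduleAlgebra

section BiGaloisIso

variable {k : Type*} [CommRing k] {Z : Type*} [Ring Z] [Algebra k Z]
  {A : Type*} [Ring A] [Bialgebra k A] {B : Type*} [Ring B] [Bialgebra k B]
  {β : Z →ₐ[k] A ⊗[k] Z} {ρ : Z →ₐ[k] Z ⊗[k] B}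

section

variable {M C D : Type*} [AddCommGroup M] [Module k M] [AddCommGroup C] [Module k C]
  [AddCommGroup D] [Module k D] [Coalgebra k C] [Coalgebra k D] {m : M →ₗ[k] Z}
  {lam : M →ₗ[k] M ⊗[k] D} {δ : M →ₗ[k] M ⊗[k] C} {g : D →ₗ[k] A} {g' : C →ₗ[k] B}

theorem IsBiGaloisMap.eq_iff (h : IsBiGaloisMap β ρ m lam δ g g')
    (hZ : Function.Injective (algebraMap k Z)) {σ σ' : WithConv (D →ₗ[k] k)}
    {τ τ' : WithConv (C →ₗ[k] k)} (hτ : IsIntertwined m lam δ σ τ)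
    (hτ' : IsIntertwined m lam δ σ' τ') : σ = σ' ↔ τ = τ' :=
  ⟨fun e => h.unique_right hZ hτ (e ▸ hτ'), fun e => h.unique_left hZ hτ (e ▸ hτ')⟩

theorem IsBiGaloisMap.exists_unit_right (h : IsBiGaloisMap β ρ m lam δ g g')
    (hβ : IsLeftGalois β) (hB : Function.Injective (TensorProduct.mk k Z B 1))
    {σ : (WithConv (D →ₗ[k] k))ˣ} (hσ : Commute (convScalar A σ.val) (.toConv g)) :
    ∃ τ : (WithConv (C →ₗ[k] k))ˣ, IsIntertwined m lam δ σ.val τ.val ∧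
      IsIntertwined m lam δ σ⁻¹.val τ⁻¹.val ∧ Commute (convScalar B τ.val) (.toConv g') := by
  have hσ_inv : Commute (convScalar A σ⁻¹.val) (.toConv g) :=
    Commute.units_inv_left (u := Units.map (convScalar A) σ) hσ
  obtain ⟨τ, rel, hτ⟩ := h.exists_right hβ hB hσ
  obtain ⟨τ', rel', -⟩ := h.exists_right hβ hB hσ_inv
  obtain ⟨φ, rfl, rfl⟩ := exists_unit_of_rel h.intertwined_one h.intertwined_mul
    (h.unique_right hβ.injective_algebraMap) rel rel'
  exact ⟨φ, rel, rel', hτ⟩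

theorem IsBiGaloisMap.exists_unit_left (h : IsBiGaloisMap β ρ m lam δ g g')
    (hρ : IsRightGalois ρ) (hA : Function.Injective (TensorProduct.mk k Z A 1))
    {τ : (WithConv (C →ₗ[k] k))ˣ} (hτ : Commute (convScalar B τ.val) (.toConv g')) :
    ∃ σ : (WithConv (D →ₗ[k] k))ˣ, IsIntertwined m lam δ σ.val τ.val ∧
      IsIntertwined m lam δ σ⁻¹.val τ⁻¹.val ∧ Commute (convScalar A σ.val) (.toConv g) := by
  have hτ_inv : Commute (convScalar B τ⁻¹.val) (.toConv g') :=
    Commute.units_inv_left (u := Units.map (convScalar B) τ) hτ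
  obtain ⟨σ, rel, hσ⟩ := h.exists_left hρ hA hτ
  obtain ⟨σ', rel', -⟩ := h.exists_left hρ hA hτ_inv
  obtain ⟨φ, rfl, rfl⟩ := exists_unit_of_rel (R := fun τ σ => IsIntertwined m lam δ σ τ)
    h.intertwined_one h.intertwined_mul (h.unique_left hρ.injective_algebraMap) rel rel'
  exact ⟨φ, rel, rel', hσ⟩

end

/-- The forms `μ` on `A` and `ν` on `B` act on `Z` in the same way. -/
abbrev IsIntertwined1 (β : Z →ₐ[k] A ⊗[k] Z) (ρ : Z →ₐ[k] Z ⊗[k] B)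
    (μ : WithConv (A →ₗ[k] k)) (ν : WithConv (B →ₗ[k] k)) : Prop :=
  IsIntertwined (LinearMap.id : Z →ₗ[k] Z) (opCoaction β).toLinearMap ρ.toLinearMap μ ν

/-- The forms `σ` on `A ⊗ A` and `τ` on `B ⊗ B` deform the product of `Z` in the same way. -/
abbrev IsIntertwined2 (β : Z →ₐ[k] A ⊗[k] Z) (ρ : Z →ₐ[k] Z ⊗[k] B)
    (σ : WithConv (A ⊗[k] A →ₗ[k] k)) (τ : WithConv (B ⊗[k] B →ₗ[k] k)) : Prop :=
  IsIntertwined (LinearMap.mul' k Z)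
    (outer (opCoaction β).toLinearMap (opCoaction β).toLinearMap)
    (outer ρ.toLinearMap ρ.toLinearMap) σ τ

theorem IsBiGalois.isBiGaloisMap_mul' (h : IsBiGalois β ρ) :
    IsBiGaloisMap β ρ (LinearMap.mul' k Z)
      (outer (opCoaction β).toLinearMap (opCoaction β).toLinearMap)
      (outer ρ.toLinearMap ρ.toLinearMap) (LinearMap.mul' k A) (LinearMap.mul' k B) := by
  simpa only [mulMap_id] using h.isBiGaloisMap.mul h.isBiGaloisMap

theorem IsIntertwined2.isLeftCocycle_iff (h : IsBiGalois β ρ) {σ : Conv2 k A} {τ : Conv2 k B}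
    (rel : IsIntertwined2 β ρ σ.val τ.val) : IsLeftCocycle σ ↔ IsLeftCocycle τ := by
  let m₃ : (Z ⊗[k] Z) ⊗[k] Z →ₗ[k] Z := mulMap (LinearMap.mul' k Z) LinearMap.id
  let R₃ := IsIntertwined m₃
    (outer (outer (opCoaction β).toLinearMap (opCoaction β).toLinearMap)
      (opCoaction β).toLinearMap)
    (outer (outer ρ.toLinearMap ρ.toLinearMap) ρ.toLinearMap)
  have biGalois : IsBiGaloisMap β ρ m₃ _ _ _ _ := h.isBiGaloisMap_mul'.mul h.isBiGaloisMap
  have rel_face12 : R₃ (face12 σ).val (face12 τ).val :=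
    (act_face12 h.left.isCoaction σ).trans
      ((congrArg (LinearMap.mul' k Z ∘ₗ LinearMap.rTensor Z ·) rel).trans
        (act_face12 h.right.isCoaction τ).symm)
  have rel_faceMulLeft : R₃ (faceMulLeft σ).val (faceMulLeft τ).val :=
    (act_faceMulLeft _ σ).trans
      ((congrArg (· ∘ₗ (LinearMap.mul' k Z).rTensor Z) rel).trans (act_faceMulLeft _ τ).symm)
  have rel_face23 : R₃ (face23 σ).val (face23 τ).val :=
    (act_face23 h.left.isCoaction σ).trans
      ((congrArg (LinearMap.mul' k Z ∘ₗ LinearMap.lTensor Z · ∘ₗ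
        (TensorProduct.assoc k Z Z Z).toLinearMap) rel).trans
          (act_face23 h.right.isCoaction τ).symm)
  have rel_faceMulRight : R₃ (faceMulRight σ).val (faceMulRight τ).val :=
    (act_faceMulRight _ σ).trans
      ((congrArg (· ∘ₗ (LinearMap.mul' k Z).lTensor Z ∘ₗ
        (TensorProduct.assoc k Z Z Z).toLinearMap) rel).trans (act_faceMulRight _ τ).symm)
  simp only [IsLeftCocycle, Units.ext_iff]
  exact biGalois.eq_iff h.left.injective_algebraMap
    (biGalois.intertwined_mul rel_face12 rel_faceMulLeft)
    (biGalois.intertwined_mul rel_face23 rel_faceMulRight)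

theorem IsIntertwined2.mem_reg2_iff (h : IsBiGalois β ρ) {σ : Conv2 k A} {τ : Conv2 k B}
    (rel : IsIntertwined2 β ρ σ.val τ.val) : σ ∈ Reg2 k A ↔ τ ∈ Reg2 k B := by
  have rel_inl : IsIntertwined1 β ρ (convPull (inlHom k A) σ.val) (convPull (inlHom k B) τ.val) :=
    congrArg (LinearMap.id ∘ₗ ·) ((act_convPull_inlHom _ _).trans
      ((congrArg (· ∘ₗ (TensorProduct.mk k Z Z).flip 1) rel).trans (act_convPull_inlHom _ _).symm))
  have rel_inr : IsIntertwined1 β ρ (convPull (inrHom k A) σ.val) (convPull (inrHom k B) τ.val) :=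
    congrArg (LinearMap.id ∘ₗ ·) ((act_convPull_inrHom _ _).trans
      ((congrArg (· ∘ₗ TensorProduct.mk k Z Z 1) rel).trans (act_convPull_inrHom _ _).symm))
  have eq_one_iff : ∀ {μ ν}, IsIntertwined1 β ρ μ ν → (μ = 1 ↔ ν = 1) := fun rel =>
    h.isBiGaloisMap.eq_iff h.left.injective_algebraMap rel h.isBiGaloisMap.intertwined_one
  have mem_iff_left := LazyCohomology.mem_reg2_iff k A σ
  have mem_iff_right := LazyCohomology.mem_reg2_iff k B τ
  rw [Units.ext_iff, Units.ext_iff] at mem_iff_left mem_iff_right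
  exact mem_iff_left.trans
    ((and_congr (eq_one_iff rel_inl) (eq_one_iff rel_inr)).trans mem_iff_right.symm)

theorem IsIntertwined1.mem_reg1_iff (hβ : IsLeftGalois β) {μ : Conv1 k A} {ν : Conv1 k B}
    (rel : IsIntertwined1 β ρ μ.val ν.val) : μ ∈ Reg1 k A ↔ ν ∈ Reg1 k B := by
  have apply_one : μ.val (1 : A) = ν.val (1 : B) := by
    apply hβ.injective_algebraMap
    rw [← act_apply_one (opCoaction β), ← act_apply_one ρ]
    exact LinearMap.congr_fun rel 1
  change μ.val (1 : A) = 1 ↔ ν.val (1 : B) = 1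
  rw [apply_one]

theorem IsIntertwined1.coboundary (h : IsBiGalois β ρ) {μ : Conv1 k A} {ν : Conv1 k B}
    (rel : IsIntertwined1 β ρ μ.val ν.val) (rel_inv : IsIntertwined1 β ρ μ⁻¹.val ν⁻¹.val) :
    IsIntertwined2 β ρ (coboundary μ).val (coboundary ν).val := by
  have act_eq : act (opCoaction β).toLinearMap μ.val = act ρ.toLinearMap ν.val := rel
  have act_inv_eq : act (opCoaction β).toLinearMap μ⁻¹.val = act ρ.toLinearMap ν⁻¹.val := rel_inv
  have rel_fst : IsIntertwined2 β ρ (convPull (fstHom k A A) μ.val)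
      (convPull (fstHom k B B) ν.val) := by
    rw [IsIntertwined2, IsIntertwined, act_outer_fst h.left.isCoaction,
      act_outer_fst h.right.isCoaction, act_eq]
  have rel_snd : IsIntertwined2 β ρ (convPull (sndHom k A A) μ.val)
      (convPull (sndHom k B B) ν.val) := by
    rw [IsIntertwined2, IsIntertwined, act_outer_snd h.left.isCoaction,
      act_outer_snd h.right.isCoaction, act_eq]
  have rel_mul : IsIntertwined2 β ρ (convPull (Bialgebra.mulCoalgHom k A) μ⁻¹.val)
      (convPull (Bialgebra.mulCoalgHom k B) ν⁻¹.val) := by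
    rw [IsIntertwined2, IsIntertwined, ← act_comp_mul', ← act_comp_mul', act_inv_eq]
  exact h.isBiGaloisMap_mul'.intertwined_mul
    (h.isBiGaloisMap_mul'.intertwined_mul rel_fst rel_snd) rel_mul

theorem tmul_one_injective [Module.FaithfullyFlat k Z] (N : Type*) [AddCommGroup N] [Module k N] :
    Function.Injective (TensorProduct.mk k Z N 1) := by
  rw [injective_iff_map_eq_zero]
  exact fun n hn => by simpa using hn

theorem IsBiGalois.nonempty_HL2_mulEquiv [Module.FaithfullyFlat k Z] (h : IsBiGalois β ρ) :
    Nonempty (HL2 k A ≃* HL2 k B) := by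
  have deg1 := h.isBiGaloisMap
  have deg2 := h.isBiGaloisMap_mul'
  have hZ := h.left.injective_algebraMap
  have hA := tmul_one_injective (k := k) (Z := Z) A
  have hB := tmul_one_injective (k := k) (Z := Z) B
  refine nonempty_HL2_mulEquiv_of_rel (fun σ τ => IsIntertwined2 β ρ σ.val τ.val)
    deg2.intertwined_mul (fun rel rel' => Units.ext (deg2.unique_right hZ rel rel'))
    (fun rel rel' => Units.ext (deg2.unique_left hZ rel rel')) ?_ ?_ ?_ ?_
  · intro σ ⟨⟨hσ, lazy⟩, cocycle⟩
    obtain ⟨τ, rel, -, hτ⟩ := deg2.exists_unit_right h.left hB lazy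
    exact ⟨τ, ⟨⟨(IsIntertwined2.mem_reg2_iff h rel).1 hσ, hτ⟩,
      (IsIntertwined2.isLeftCocycle_iff h rel).1 cocycle⟩, rel⟩
  · intro τ ⟨⟨hτ, lazy⟩, cocycle⟩
    obtain ⟨σ, rel, -, hσ⟩ := deg2.exists_unit_left h.right hA lazy
    exact ⟨σ, ⟨⟨(IsIntertwined2.mem_reg2_iff h rel).2 hτ, hσ⟩,
      (IsIntertwined2.isLeftCocycle_iff h rel).2 cocycle⟩, rel⟩
  · intro μ ⟨hμ, lazy⟩
    obtain ⟨ν, rel, rel_inv, hν⟩ := deg1.exists_unit_right h.left hB lazy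
    exact ⟨ν, ⟨(IsIntertwined1.mem_reg1_iff h.left rel).1 hμ, hν⟩,
      IsIntertwined1.coboundary h rel rel_inv⟩
  · intro ν ⟨hν, lazy⟩
    obtain ⟨μ, rel, rel_inv, hμ⟩ := deg1.exists_unit_left h.right hA lazy
    exact ⟨μ, ⟨(IsIntertwined1.mem_reg1_iff h.left rel).2 hν, hμ⟩,
      IsIntertwined1.coboundary h rel rel_inv⟩

end BiGaloisIso

section EndTransport

variable {C : Type*} [Category* C] {D : Type*} [Category* D] {X : Type*} [Category* X]
  {Y : Type*} [Category* Y] (e : X ≌ Y) (e' : C ≌ D) {G : X ⥤ C} {H : Y ⥤ D}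
  (i : e.functor ⋙ H ≅ G ⋙ e'.functor)

/-- Equivalences of the source and target categories that carry the functor `G` to `H` identify the
natural endomorphisms of `G` with those of `H`. -/
def endCongr : End G ≃* End H :=
  ((e'.congrRight.fullyFaithfulFunctor.mulEquivEnd G).trans i.symm.conj).trans
    (e.congrLeft.fullyFaithfulInverse.mulEquivEnd H).symm

variable {e e' i} in
theorem endCongr_eq_iff {θ : End G} {φ : End H} : endCongr e e' i θ = φ ↔
    ∀ x, i.hom.app x ≫ e'.functor.map (θ.app x) = φ.app (e.functor.obj x) ≫ i.hom.app x := by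
  have conj_eq_iff : endCongr e e' i θ = φ ↔
      i.hom ≫ Functor.whiskerRight θ e'.functor ≫ i.inv = Functor.whiskerLeft e.functor φ :=
    (e.congrLeft.fullyFaithfulInverse.mulEquivEnd H).symm_apply_eq
  rw [conj_eq_iff, NatTrans.ext_iff, funext_iff]
  refine forall_congr' fun x => ?_
  simp [← cancel_mono (i.hom.app x)]

/-- An equivalence identifies the natural endomorphisms of the identity functors. -/
def catCenterCongr : CatCenter C ≃* CatCenter D :=
  endCongr e' e' (e'.functor.rightUnitor ≪≫ e'.functor.leftUnitor.symm)

theorem map_app_eq_catCenterCongr_app (u : CatCenter C) (X : C) :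
    e'.functor.map (u.app X) = (catCenterCongr e' u).app (e'.functor.obj X) := by
  simpa using endCongr_eq_iff.1 (rfl : catCenterCongr e' u = _) X

end EndTransport

section TensorEnd

open MonoidalCategory Functor.LaxMonoidal Functor.Monoidal

variable {C : Type*} [Category* C] [MonoidalCategory C] {D : Type*} [Category* D]
  [MonoidalCategory D]

variable (C) in
/-- The natural endomorphisms of the tensor product functor of a monoidal category. -/
abbrev TensorEnd := End (tensor C)

namespace TensorEnd

/-- The component of a natural endomorphism of the tensor product, typed by `X ⊗ Y` rather than by
`(tensor C).obj (X, Y)`. -/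
def app (θ : TensorEnd C) (X Y : C) : X ⊗ Y ⟶ X ⊗ Y := NatTrans.app θ (X, Y)

theorem tensorHom_app (θ : TensorEnd C) {X X' Y Y' : C} (f : X ⟶ X') (g : Y ⟶ Y') :
    (f ⊗ₘ g) ≫ θ.app X' Y' = θ.app X Y ≫ (f ⊗ₘ g) :=
  θ.naturality ((f, g) : (X, Y) ⟶ (X', Y'))

theorem whiskerRight_app (θ : TensorEnd C) {X X' : C} (f : X ⟶ X') (Y : C) :
    f ▷ Y ≫ θ.app X' Y = θ.app X Y ≫ f ▷ Y := by
  simpa only [tensorHom_id] using θ.tensorHom_app f (𝟙 Y)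

theorem whiskerLeft_app (θ : TensorEnd C) (X : C) {Y Y' : C} (f : Y ⟶ Y') :
    X ◁ f ≫ θ.app X Y' = θ.app X Y ≫ X ◁ f := by
  simpa only [id_tensorHom] using θ.tensorHom_app (𝟙 X) f

/-- The 2-cocycle identity at three objects, for a natural endomorphism of the tensor product. -/
def IsCocycleAt (θ : TensorEnd C) (X Y Z : C) : Prop :=
  θ.app (X ⊗ Y) Z ≫ θ.app X Y ▷ Z ≫ (α_ X Y Z).hom =
    (α_ X Y Z).hom ≫ θ.app X (Y ⊗ Z) ≫ X ◁ θ.app Y Z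

/-- A natural endomorphism of the tensor product is normalized at an object if it is trivial on the
tensor products of this object with the unit object. -/
def IsNormalizedAt (θ : TensorEnd C) (X : C) : Prop :=
  θ.app X (𝟙_ C) = 𝟙 (X ⊗ 𝟙_ C) ∧ θ.app (𝟙_ C) X = 𝟙 (𝟙_ C ⊗ X)

theorem IsCocycleAt.of_iso {θ : TensorEnd C} {X X' Y Y' Z Z' : C} (h : IsCocycleAt θ X Y Z)
    (a : X ≅ X') (b : Y ≅ Y') (c : Z ≅ Z') : IsCocycleAt θ X' Y' Z' := by
  have left_natural : ((a.hom ⊗ₘ b.hom) ⊗ₘ c.hom) ≫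
      θ.app (X' ⊗ Y') Z' ≫ θ.app X' Y' ▷ Z' ≫ (α_ X' Y' Z').hom =
      (θ.app (X ⊗ Y) Z ≫ θ.app X Y ▷ Z ≫ (α_ X Y Z).hom) ≫ (a.hom ⊗ₘ b.hom ⊗ₘ c.hom) := by
    rw [reassoc_of% θ.tensorHom_app, tensorHom_comp_whiskerRight_assoc, tensorHom_app,
      ← whiskerRight_comp_tensorHom, Category.assoc, associator_naturality]
    simp only [Category.assoc]
  have right_natural : ((a.hom ⊗ₘ b.hom) ⊗ₘ c.hom) ≫
      (α_ X' Y' Z').hom ≫ θ.app X' (Y' ⊗ Z') ≫ X' ◁ θ.app Y' Z' =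
      ((α_ X Y Z).hom ≫ θ.app X (Y ⊗ Z) ≫ X ◁ θ.app Y Z) ≫ (a.hom ⊗ₘ b.hom ⊗ₘ c.hom) := by
    rw [associator_naturality_assoc, reassoc_of% θ.tensorHom_app, tensorHom_comp_whiskerLeft,
      tensorHom_app, ← whiskerLeft_comp_tensorHom]
    simp only [Category.assoc]
  rw [IsCocycleAt, ← cancel_epi ((a.hom ⊗ₘ b.hom) ⊗ₘ c.hom), left_natural, right_natural, h]

theorem IsNormalizedAt.of_iso {θ : TensorEnd C} {X X' : C} (h : IsNormalizedAt θ X)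
    (a : X ≅ X') : IsNormalizedAt θ X' := by
  constructor
  · rw [← cancel_epi (a.hom ▷ 𝟙_ C), whiskerRight_app, h.1, Category.id_comp, Category.comp_id]
  · rw [← cancel_epi (𝟙_ C ◁ a.hom), whiskerLeft_app, h.2, Category.id_comp, Category.comp_id]

/-- The coboundary of an invertible natural endomorphism of the identity functor. -/
def coboundary (u : (CatCenter C)ˣ) : TensorEnd C where
  app P := u⁻¹.val.app (P.1 ⊗ P.2) ≫ P.1 ◁ u.val.app P.2 ≫ u.val.app P.1 ▷ P.2
  naturality {P P'} f := by
    change (f.1 ⊗ₘ f.2) ≫ _ = _ ≫ (f.1 ⊗ₘ f.2)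
    rw [CatCenter.naturality_assoc, tensorHom_comp_whiskerLeft_assoc, u.val.naturality,
      tensorHom_comp_whiskerRight, u.val.naturality, ← whiskerRight_comp_tensorHom,
      ← whiskerLeft_comp_tensorHom]
    simp only [Category.assoc, whisker_exchange_assoc]

theorem coboundary_app (u : (CatCenter C)ˣ) (X Y : C) : (coboundary u).app X Y =
    u⁻¹.val.app (X ⊗ Y) ≫ X ◁ u.val.app Y ≫ u.val.app X ▷ Y := rfl

end TensorEnd

variable (e : C ≌ D) [e.functor.Monoidal]

/-- A monoidal equivalence identifies the natural endomorphisms of the tensor products. -/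
def tensorEndCongr : TensorEnd C ≃* TensorEnd D :=
  endCongr (e.prod e) e (μNatIso e.functor)

theorem μ_comp_map_app (θ : TensorEnd C) (X Y : C) :
    μ e.functor X Y ≫ e.functor.map (θ.app X Y) =
      (tensorEndCongr e θ).app (e.functor.obj X) (e.functor.obj Y) ≫ μ e.functor X Y :=
  endCongr_eq_iff.1 (rfl : tensorEndCongr e θ = _) (X, Y)

theorem isCocycleAt_tensorEndCongr_obj (θ : TensorEnd C) (X Y Z : C) :
    (tensorEndCongr e θ).IsCocycleAt (e.functor.obj X) (e.functor.obj Y) (e.functor.obj Z) ↔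
      θ.IsCocycleAt X Y Z := by
  let F := e.functor
  let φ := tensorEndCongr e θ
  have left_eq : (μ F X Y ▷ F.obj Z ≫ μ F (X ⊗ Y) Z) ≫
      F.map (θ.app (X ⊗ Y) Z ≫ θ.app X Y ▷ Z ≫ (α_ X Y Z).hom) =
      (φ.app (F.obj X ⊗ F.obj Y) (F.obj Z) ≫ φ.app (F.obj X) (F.obj Y) ▷ F.obj Z ≫
        (α_ _ _ _).hom) ≫ F.obj X ◁ μ F Y Z ≫ μ F X (Y ⊗ Z) := by
    simp only [F.map_comp, Category.assoc]
    rw [reassoc_of% μ_comp_map_app e, ← μ_natural_left_assoc,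
      reassoc_of% TensorEnd.whiskerRight_app, ← comp_whiskerRight_assoc, μ_comp_map_app,
      comp_whiskerRight_assoc, associativity]
  have right_eq : (μ F X Y ▷ F.obj Z ≫ μ F (X ⊗ Y) Z) ≫
      F.map ((α_ X Y Z).hom ≫ θ.app X (Y ⊗ Z) ≫ X ◁ θ.app Y Z) =
      ((α_ _ _ _).hom ≫ φ.app (F.obj X) (F.obj Y ⊗ F.obj Z) ≫
        F.obj X ◁ φ.app (F.obj Y) (F.obj Z)) ≫ F.obj X ◁ μ F Y Z ≫ μ F X (Y ⊗ Z) := by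
    simp only [F.map_comp, Category.assoc]
    rw [associativity_assoc, reassoc_of% μ_comp_map_app e, ← μ_natural_right,
      reassoc_of% TensorEnd.whiskerLeft_app, ← whiskerLeft_comp_assoc, μ_comp_map_app,
      whiskerLeft_comp_assoc]
  rw [TensorEnd.IsCocycleAt, TensorEnd.IsCocycleAt, ← F.map_injective.eq_iff,
    ← cancel_epi (μ F X Y ▷ F.obj Z ≫ μ F (X ⊗ Y) Z), left_eq, right_eq, cancel_mono]

theorem isNormalizedAt_tensorEndCongr_obj (θ : TensorEnd C) (X : C) :
    (tensorEndCongr e θ).IsNormalizedAt (e.functor.obj X) ↔ θ.IsNormalizedAt X := by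
  let F := e.functor
  have right_unit : (F.obj X ◁ ε F ≫ μ F X (𝟙_ C)) ≫ F.map (θ.app X (𝟙_ C)) =
      (tensorEndCongr e θ).app (F.obj X) (𝟙_ D) ≫ F.obj X ◁ ε F ≫ μ F X (𝟙_ C) := by
    rw [Category.assoc, μ_comp_map_app, reassoc_of% TensorEnd.whiskerLeft_app]
  have left_unit : (ε F ▷ F.obj X ≫ μ F (𝟙_ C) X) ≫ F.map (θ.app (𝟙_ C) X) =
      (tensorEndCongr e θ).app (𝟙_ D) (F.obj X) ≫ ε F ▷ F.obj X ≫ μ F (𝟙_ C) X := by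
    rw [Category.assoc, μ_comp_map_app, reassoc_of% TensorEnd.whiskerRight_app]
  refine and_congr ?_ ?_
  · rw [← F.map_injective.eq_iff, ← cancel_epi (F.obj X ◁ ε F ≫ μ F X (𝟙_ C)), right_unit, F.map_id,
      Category.comp_id, cancel_mono_id]
  · rw [← F.map_injective.eq_iff, ← cancel_epi (ε F ▷ F.obj X ≫ μ F (𝟙_ C) X), left_unit, F.map_id,
      Category.comp_id, cancel_mono_id]

theorem forall_isCocycleAt_tensorEndCongr (θ : TensorEnd C) :
    (∀ X Y Z, (tensorEndCongr e θ).IsCocycleAt X Y Z) ↔ ∀ X Y Z, θ.IsCocycleAt X Y Z :=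
  ⟨fun h X Y Z => (isCocycleAt_tensorEndCongr_obj e θ X Y Z).1 (h _ _ _), fun h X Y Z =>
    ((isCocycleAt_tensorEndCongr_obj e θ _ _ _).2 (h _ _ _)).of_iso
      (e.counitIso.app X) (e.counitIso.app Y) (e.counitIso.app Z)⟩

theorem forall_isNormalizedAt_tensorEndCongr (θ : TensorEnd C) :
    (∀ X, (tensorEndCongr e θ).IsNormalizedAt X) ↔ ∀ X, θ.IsNormalizedAt X :=
  ⟨fun h X => (isNormalizedAt_tensorEndCongr_obj e θ X).1 (h _), fun h X =>
    ((isNormalizedAt_tensorEndCongr_obj e θ _).2 (h _)).of_iso (e.counitIso.app X)⟩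

theorem catCenterCongr_app_unit_iff (u : CatCenter C) :
    (catCenterCongr e u).app (𝟙_ D) = 𝟙 (𝟙_ D) ↔ u.app (𝟙_ C) = 𝟙 (𝟙_ C) := by
  rw [← e.functor.map_injective.eq_iff, map_app_eq_catCenterCongr_app, e.functor.map_id,
    ← cancel_epi (ε e.functor), Category.comp_id, CatCenter.naturality, cancel_mono_id]

theorem tensorEndCongr_coboundary (u : (CatCenter C)ˣ) :
    tensorEndCongr e (TensorEnd.coboundary u) =
      TensorEnd.coboundary (Units.map (catCenterCongr e).toMonoidHom u) := by
  refine endCongr_eq_iff.2 fun ⟨X, Y⟩ => ?_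
  let v := Units.map (catCenterCongr e).toMonoidHom u
  have map_inv : ∀ X, e.functor.map (u⁻¹.val.app X) = v⁻¹.val.app (e.functor.obj X) :=
    map_app_eq_catCenterCongr_app e u⁻¹.val
  have map_val : ∀ X, e.functor.map (u.val.app X) = v.val.app (e.functor.obj X) :=
    map_app_eq_catCenterCongr_app e u.val
  change μ e.functor X Y ≫ e.functor.map ((TensorEnd.coboundary u).app X Y) =
    (TensorEnd.coboundary v).app _ _ ≫ μ e.functor X Y
  simp only [TensorEnd.coboundary_app, Functor.map_comp, Category.assoc]
  rw [map_inv, CatCenter.naturality_assoc, ← μ_natural_right_assoc, ← μ_natural_left, map_val,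
    map_val]

end TensorEnd

section RegularCoaction

variable {k : Type*} [CommRing k] {C : Type*} [AddCommGroup C] [Module k C] [Coalgebra k C]
  {M M' P : Type*} [AddCommGroup M] [Module k M] [AddCommGroup M'] [Module k M']
  [Ring P] [Algebra k P] {δ : M →ₗ[k] M ⊗[k] C}

theorem isCoaction_comul : IsCoaction (comul (R := k) (A := C)) counit comul where
  coassoc := Coalgebra.coassoc
  counit_comp := by
    rw [Coalgebra.lTensor_counit_comp_comul]
    ext; simp

theorem lTensor_comul_injective {f g : C →ₗ[k] P}
    (h : f.lTensor C ∘ₗ comul = g.lTensor C ∘ₗ comul) : f = g := by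
  have contract : ∀ f : C →ₗ[k] P, (TensorProduct.lid k P).toLinearMap ∘ₗ
      (counit (R := k) (A := C)).rTensor P ∘ₗ f.lTensor C ∘ₗ comul = f := fun f => by
    rw [← LinearMap.comp_assoc (comul (R := k)), LinearMap.rTensor_comp_lTensor,
      ← LinearMap.lTensor_comp_rTensor, LinearMap.comp_assoc, Coalgebra.rTensor_counit_comp_comul]
    ext; simp
  rw [← contract f, h, contract]

theorem act_comul_injective {τ τ' : WithConv (C →ₗ[k] k)}
    (h : act (comul (R := k) (A := C)) τ = act comul τ') : τ = τ' :=
  WithConv.ext (lTensor_comul_injective (LinearMap.ext fun c =>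
    (TensorProduct.rid k C).injective (LinearMap.congr_fun h c)))

theorem act_comp_of_colinear {δ' : M' →ₗ[k] M' ⊗[k] C} {f : M →ₗ[k] M'}
    (hf : δ' ∘ₗ f = f.rTensor C ∘ₗ δ) (τ : WithConv (C →ₗ[k] k)) :
    act δ' τ ∘ₗ f = f ∘ₗ act δ τ :=
  act_comp_of_comp f (CoalgHom.id k C) hf τ

theorem IsCoaction.eq_act_counit_comp (h : IsCoaction comul counit δ) {f : M →ₗ[k] M}
    {g : C →ₗ[k] C} (hf : δ ∘ₗ f = g.lTensor M ∘ₗ δ) : f = act δ (.toConv (counit ∘ₗ g)) :=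
  calc f
    _ = ((TensorProduct.rid k M).toLinearMap ∘ₗ (counit (R := k) (A := C)).lTensor M ∘ₗ δ) ∘ₗ f :=
      by rw [h.counit_comp, LinearMap.id_comp]
    _ = (TensorProduct.rid k M).toLinearMap ∘ₗ (counit ∘ₗ g).lTensor M ∘ₗ δ := by
      rw [LinearMap.comp_assoc, LinearMap.comp_assoc, hf, LinearMap.lTensor_comp,
        LinearMap.comp_assoc]

theorem IsCoaction.lTensor_comp_act (h : IsCoaction comul counit δ) {f g : C →ₗ[k] P}
    {τ : WithConv (C →ₗ[k] k)}
    (hτ : .toConv g * convScalar P τ = convScalar P τ * .toConv f) :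
    (g.lTensor M ∘ₗ δ) ∘ₗ act δ τ = (act δ τ).rTensor P ∘ₗ f.lTensor M ∘ₗ δ := by
  have twist : g ∘ₗ act comul τ = f ∘ₗ act (opComul comul) τ := by
    rw [LazyCohomology.comp_act, LazyCohomology.comp_act,
      convCoact_opComul comul fun _ _ => (Algebra.commutes _ _).symm]
    exact congrArg WithConv.ofConv hτ
  rw [LinearMap.comp_assoc, h.comp_act, ← LinearMap.comp_assoc, ← LinearMap.lTensor_comp, twist,
    LinearMap.lTensor_comp, LinearMap.comp_assoc, ← h.rTensor_act_comp, ← LinearMap.comp_assoc,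
    ← LinearMap.comp_assoc, LinearMap.lTensor_comp_rTensor, LinearMap.rTensor_comp_lTensor]

theorem commute_convScalar_of_lTensor_comp_act {f : C →ₗ[k] P} {τ : WithConv (C →ₗ[k] k)}
    (h : (f.lTensor C ∘ₗ comul) ∘ₗ act comul τ =
      (act comul τ).rTensor P ∘ₗ f.lTensor C ∘ₗ comul) :
    Commute (convScalar P τ) (.toConv f) := by
  refine commute_convScalar_iff.2 (lTensor_comul_injective ?_)
  rw [LinearMap.comp_assoc, isCoaction_comul.comp_act, ← LinearMap.comp_assoc,
    ← LinearMap.lTensor_comp, ← LinearMap.comp_assoc, LinearMap.rTensor_comp_lTensor,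
    ← LinearMap.lTensor_comp_rTensor, LinearMap.comp_assoc, isCoaction_comul.rTensor_act_comp,
    ← LinearMap.comp_assoc, ← LinearMap.lTensor_comp] at h
  exact h

end RegularCoaction

section Codiagonal

variable {k : Type*} [CommRing k] {R : Type*} [Ring R] [Bialgebra k R]
  {M M' M'' : Type*} [AddCommGroup M] [Module k M] [AddCommGroup M'] [Module k M']
  [AddCommGroup M''] [Module k M'']

/-- The codiagonal coaction `x ⊗ y ↦ x₀ ⊗ y₀ ⊗ x₁ y₁` on a tensor product. -/
def codiagonal (δ : M →ₗ[k] M ⊗[k] R) (δ' : M' →ₗ[k] M' ⊗[k] R) :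
    M ⊗[k] M' →ₗ[k] (M ⊗[k] M') ⊗[k] R :=
  (LinearMap.mul' k R).lTensor (M ⊗[k] M') ∘ₗ outer δ δ'

section

variable (δ : M →ₗ[k] M ⊗[k] R) (δ' : M' →ₗ[k] M' ⊗[k] R) (δ'' : M'' →ₗ[k] M'' ⊗[k] R)

theorem act_codiagonal (τ : WithConv (R →ₗ[k] k)) :
    act (codiagonal δ δ') τ = act (outer δ δ') (convPull (Bialgebra.mulCoalgHom k R) τ) :=
  act_comp_of_comp LinearMap.id (Bialgebra.mulCoalgHom k R) rfl τ

theorem act_outer_codiagonal_left (τ : WithConv (R ⊗[k] R →ₗ[k] k)) :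
    act (outer (codiagonal δ δ') δ'') τ = act (outer (outer δ δ') δ'')
      (convPull (Coalgebra.TensorProduct.map (Bialgebra.mulCoalgHom k R) (CoalgHom.id k R)) τ) := by
  have comp_id : δ'' ∘ₗ LinearMap.id = TensorProduct.map LinearMap.id LinearMap.id ∘ₗ δ'' := by
    rw [TensorProduct.map_id]
    rfl
  have h := outer_comp_map (m := LinearMap.id) (g := LinearMap.mul' k R) (d := codiagonal δ δ')
    (δ := outer δ δ') rfl comp_id
  rw [TensorProduct.map_id] at h
  exact act_comp_of_comp LinearMap.id
    (Coalgebra.TensorProduct.map (Bialgebra.mulCoalgHom k R) (CoalgHom.id k R)) h τ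

theorem act_outer_codiagonal_right (τ : WithConv (R ⊗[k] R →ₗ[k] k)) :
    act (outer δ (codiagonal δ' δ'')) τ = act (outer δ (outer δ' δ''))
      (convPull (Coalgebra.TensorProduct.map (CoalgHom.id k R) (Bialgebra.mulCoalgHom k R)) τ) := by
  have comp_id : δ ∘ₗ LinearMap.id = TensorProduct.map LinearMap.id LinearMap.id ∘ₗ δ := by
    rw [TensorProduct.map_id]
    rfl
  have h := outer_comp_map (m' := LinearMap.id) (g' := LinearMap.mul' k R)
    (d' := codiagonal δ' δ'') (δ' := outer δ' δ'') comp_id rfl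
  rw [TensorProduct.map_id] at h
  exact act_comp_of_comp LinearMap.id
    (Coalgebra.TensorProduct.map (CoalgHom.id k R) (Bialgebra.mulCoalgHom k R)) h τ

theorem act_outer_outer_comp_assoc (τ : WithConv (R ⊗[k] (R ⊗[k] R) →ₗ[k] k)) :
    act (outer δ (outer δ' δ'')) τ ∘ₗ (TensorProduct.assoc k M M' M'').toLinearMap =
      (TensorProduct.assoc k M M' M'').toLinearMap ∘ₗ act (outer (outer δ δ') δ'')
        (convPull (Coalgebra.TensorProduct.assoc k k R R R :
          (R ⊗[k] R) ⊗[k] R →ₗc[k] R ⊗[k] (R ⊗[k] R)) τ) :=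
  act_comp_of_comp _ (Coalgebra.TensorProduct.assoc k k R R R :
    (R ⊗[k] R) ⊗[k] R →ₗc[k] R ⊗[k] (R ⊗[k] R)) (outer_comp_assoc δ δ' δ'') τ

theorem act_outer_trivial (τ : WithConv (R ⊗[k] R →ₗ[k] k)) :
    act (outer δ ((TensorProduct.mk k k R).flip 1)) τ ∘ₗ (TensorProduct.rid k M).symm.toLinearMap =
      (TensorProduct.rid k M).symm.toLinearMap ∘ₗ act δ (convPull (inlHom k R) τ) := by
  have shuffle : (TensorProduct.tensorTensorTensorComm k M R k R).toLinearMap ∘ₗ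
      TensorProduct.map LinearMap.id ((TensorProduct.mk k k R).flip 1) ∘ₗ
        (TensorProduct.rid k (M ⊗[k] R)).symm.toLinearMap =
      TensorProduct.map (TensorProduct.rid k M).symm.toLinearMap (inlHom k R).toLinearMap := by
    ext; simp [inlHom]
  refine act_comp_of_comp _ (inlHom k R) (LinearMap.ext fun x => ?_) τ
  simpa [outer] using LinearMap.congr_fun shuffle (δ x)

theorem act_trivial_outer (τ : WithConv (R ⊗[k] R →ₗ[k] k)) :
    act (outer ((TensorProduct.mk k k R).flip 1) δ) τ ∘ₗ (TensorProduct.lid k M).symm.toLinearMap =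
      (TensorProduct.lid k M).symm.toLinearMap ∘ₗ act δ (convPull (inrHom k R) τ) := by
  have shuffle : (TensorProduct.tensorTensorTensorComm k k R M R).toLinearMap ∘ₗ
      TensorProduct.map ((TensorProduct.mk k k R).flip 1) LinearMap.id ∘ₗ
        (TensorProduct.lid k (M ⊗[k] R)).symm.toLinearMap =
      TensorProduct.map (TensorProduct.lid k M).symm.toLinearMap (inrHom k R).toLinearMap := by
    ext; simp [inrHom]
  refine act_comp_of_comp _ (inrHom k R) (LinearMap.ext fun x => ?_) τ
  simpa [outer] using LinearMap.congr_fun shuffle (δ x)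

end

variable {δ : M →ₗ[k] M ⊗[k] R} {δ' : M' →ₗ[k] M' ⊗[k] R} {δ'' : M'' →ₗ[k] M'' ⊗[k] R}

theorem IsCoaction.outer_comul {C C' : Type*} [AddCommGroup C] [Module k C] [Coalgebra k C]
    [AddCommGroup C'] [Module k C'] [Coalgebra k C'] {δ : M →ₗ[k] M ⊗[k] C}
    {δ' : M' →ₗ[k] M' ⊗[k] C'} (h : IsCoaction comul counit δ) (h' : IsCoaction comul counit δ') :
    IsCoaction comul counit (LazyCohomology.outer δ δ') := by
  simpa only [LazyCohomology.outer_comul, outer_counit] using h.outer h'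

theorem act_face12_mul_faceMulLeft (h : IsCoaction comul counit δ) (h' : IsCoaction comul counit δ')
    (h'' : IsCoaction comul counit δ'') (σ : Conv2 k R) :
    (act (outer δ δ') σ.val).rTensor M'' ∘ₗ act (outer (codiagonal δ δ') δ'') σ.val =
      act (outer (outer δ δ') δ'') (face12 σ * faceMulLeft σ).val := by
  rw [act_outer_codiagonal_left, ← act_outer_fst h'',
    ← act_mul ((h.outer_comul h').outer_comul h'')]
  rfl

theorem act_face23_mul_faceMulRight (h : IsCoaction comul counit δ)
    (h' : IsCoaction comul counit δ') (h'' : IsCoaction comul counit δ'') (σ : Conv2 k R) :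
    ((act (outer δ' δ'') σ.val).lTensor M ∘ₗ act (outer δ (codiagonal δ' δ'')) σ.val) ∘ₗ
      (TensorProduct.assoc k M M' M'').toLinearMap =
      (TensorProduct.assoc k M M' M'').toLinearMap ∘ₗ
        act (outer (outer δ δ') δ'') (face23 σ * faceMulRight σ).val := by
  rw [act_outer_codiagonal_right, ← act_outer_snd h,
    ← act_mul (h.outer_comul (h'.outer_comul h'')), act_outer_outer_comp_assoc, map_mul]
  rfl

theorem act_cocycle_iff (h : IsCoaction comul counit δ) (h' : IsCoaction comul counit δ')
    (h'' : IsCoaction comul counit δ'') (σ : Conv2 k R) :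
    ((TensorProduct.assoc k M M' M'').toLinearMap ∘ₗ (act (outer δ δ') σ.val).rTensor M'') ∘ₗ
        act (outer (codiagonal δ δ') δ'') σ.val =
      ((act (outer δ' δ'') σ.val).lTensor M ∘ₗ act (outer δ (codiagonal δ' δ'')) σ.val) ∘ₗ
        (TensorProduct.assoc k M M' M'').toLinearMap ↔
      act (outer (outer δ δ') δ'') (face12 σ * faceMulLeft σ).val =
        act (outer (outer δ δ') δ'') (face23 σ * faceMulRight σ).val := by
  rw [LinearMap.comp_assoc, act_face12_mul_faceMulLeft h h' h'',
    act_face23_mul_faceMulRight h h' h'']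
  exact LinearMap.cancel_left (TensorProduct.assoc k M M' M'').injective

theorem act_outer_trivial_eq_id_iff (τ : WithConv (R ⊗[k] R →ₗ[k] k)) :
    act (outer δ ((TensorProduct.mk k k R).flip 1)) τ = LinearMap.id ↔
      act δ (convPull (inlHom k R) τ) = LinearMap.id := by
  rw [← LinearMap.cancel_right (TensorProduct.rid k M).symm.surjective,
    ← LinearMap.cancel_left (TensorProduct.rid k M).symm.injective, ← act_outer_trivial]
  rfl

theorem act_trivial_outer_eq_id_iff (τ : WithConv (R ⊗[k] R →ₗ[k] k)) :
    act (outer ((TensorProduct.mk k k R).flip 1) δ) τ = LinearMap.id ↔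
      act δ (convPull (inrHom k R) τ) = LinearMap.id := by
  rw [← LinearMap.cancel_right (TensorProduct.lid k M).symm.surjective,
    ← LinearMap.cancel_left (TensorProduct.lid k M).symm.injective, ← act_trivial_outer]
  rfl

theorem act_coboundary (h : IsCoaction comul counit δ) (h' : IsCoaction comul counit δ')
    (μ : Conv1 k R) :
    ((act δ μ.val).rTensor M' ∘ₗ (act δ' μ.val).lTensor M) ∘ₗ act (codiagonal δ δ') μ⁻¹.val =
      act (outer δ δ') (coboundary μ).val := by
  rw [act_codiagonal, ← act_outer_fst h', ← act_outer_snd h, ← act_mul (h.outer_comul h'),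
    ← act_mul (h.outer_comul h')]
  rfl

end Codiagonal

namespace Comod

open MonoidalCategory

variable {k A : Type u} [CommRing k] [Ring A] [Bialgebra k A]

theorem isCoaction (V : Comod k A) : IsCoaction comul counit V.coact :=
  ⟨V.coassoc, V.counit_comp⟩

variable (k A) in
/-- The regular comodule. -/
def regular : Comod k A where
  carrier := A
  coact := comul
  coassoc := isCoaction_comul.coassoc
  counit_comp := isCoaction_comul.counit_comp

/-- The coaction `x ⊗ a ↦ x ⊗ a₁ ⊗ a₂` of the cofree comodule `M ⊗ A` on a module `M`. -/
def cofreeCoact (M C : Type*) [AddCommGroup M] [Module k M] [AddCommGroup C] [Module k C]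
    [Coalgebra k C] : M ⊗[k] C →ₗ[k] (M ⊗[k] C) ⊗[k] C :=
  (TensorProduct.assoc k M C C).symm.toLinearMap ∘ₗ comul.lTensor M

section

variable {M C : Type*} [AddCommGroup M] [Module k M] [AddCommGroup C] [Module k C] [Coalgebra k C]

theorem cofreeCoact_comp_mk (x : M) :
    cofreeCoact M C ∘ₗ TensorProduct.mk k M C x =
      (TensorProduct.mk k M C x).rTensor C ∘ₗ comul := by
  have assoc_symm_comp_mk : (TensorProduct.assoc k M C C).symm.toLinearMap ∘ₗ
      TensorProduct.mk k M (C ⊗[k] C) x = (TensorProduct.mk k M C x).rTensor C := by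
    ext; simp
  exact congrArg (· ∘ₗ comul) assoc_symm_comp_mk

theorem isCoaction_cofreeCoact : IsCoaction comul counit (cofreeCoact (k := k) M C) where
  coassoc := by
    refine TensorProduct.ext (LinearMap.ext fun x => ?_)
    have assoc_comp_mk : (TensorProduct.assoc k (M ⊗[k] C) C C).toLinearMap ∘ₗ
        ((TensorProduct.mk k M C x).rTensor C).rTensor C =
        (TensorProduct.mk k M C x).rTensor (C ⊗[k] C) ∘ₗ
          (TensorProduct.assoc k C C C).toLinearMap := by
      ext; simp
    change ((TensorProduct.assoc k (M ⊗[k] C) C C).toLinearMap ∘ₗ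
      (cofreeCoact M C).rTensor C) ∘ₗ cofreeCoact M C ∘ₗ TensorProduct.mk k M C x =
      comul.lTensor (M ⊗[k] C) ∘ₗ cofreeCoact M C ∘ₗ TensorProduct.mk k M C x
    rw [cofreeCoact_comp_mk, LinearMap.comp_assoc, ← LinearMap.comp_assoc comul,
      ← LinearMap.rTensor_comp, cofreeCoact_comp_mk, LinearMap.rTensor_comp,
      ← LinearMap.comp_assoc, ← LinearMap.comp_assoc, assoc_comp_mk, LinearMap.comp_assoc,
      LinearMap.comp_assoc, isCoaction_comul.coassoc, ← LinearMap.comp_assoc,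
      ← LinearMap.comp_assoc, LinearMap.lTensor_comp_rTensor, LinearMap.rTensor_comp_lTensor]
  counit_comp := by
    refine TensorProduct.ext (LinearMap.ext fun x => ?_)
    have rid_comp_mk : (TensorProduct.rid k (M ⊗[k] C)).toLinearMap ∘ₗ
        (TensorProduct.mk k M C x).rTensor k =
        TensorProduct.mk k M C x ∘ₗ (TensorProduct.rid k C).toLinearMap := by
      ext; simp
    change ((TensorProduct.rid k (M ⊗[k] C)).toLinearMap ∘ₗ counit.lTensor (M ⊗[k] C)) ∘ₗ
      cofreeCoact M C ∘ₗ TensorProduct.mk k M C x = TensorProduct.mk k M C x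
    rw [cofreeCoact_comp_mk, LinearMap.comp_assoc, ← LinearMap.comp_assoc comul,
      LinearMap.lTensor_comp_rTensor, ← LinearMap.rTensor_comp_lTensor, LinearMap.comp_assoc,
      ← LinearMap.comp_assoc, rid_comp_mk, LinearMap.comp_assoc, isCoaction_comul.counit_comp,
      LinearMap.comp_id]

end

/-- The cofree comodule `M ⊗ A` on a module `M`. -/
def cofree (A : Type u) [Ring A] [Bialgebra k A] (M : Type u) [AddCommGroup M] [Module k M] :
    Comod k A where
  carrier := M ⊗[k] A
  coact := cofreeCoact M A
  coassoc := isCoaction_cofreeCoact.coassoc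
  counit_comp := isCoaction_cofreeCoact.counit_comp

/-- The coaction of a comodule, as a morphism to the cofree comodule. -/
def coactHom (V : Comod k A) : V ⟶ cofree A V where
  lin := V.coact
  colinear := by
    change ((TensorProduct.assoc k V A A).symm.toLinearMap ∘ₗ comul.lTensor V) ∘ₗ V.coact = _
    rw [LinearMap.comp_assoc, ← V.coassoc]
    ext v
    exact (TensorProduct.assoc k V A A).symm_apply_apply _

/-- The map `a ↦ x ⊗ a`, as a morphism from the regular to the cofree comodule. -/
def regularToCofree {M : Type u} [AddCommGroup M] [Module k M] (x : M) :
    regular k A ⟶ cofree A M where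
  lin := TensorProduct.mk k M A x
  colinear := cofreeCoact_comp_mk (k := k) (C := A) x

theorem lin_catCenter_app (u : CatCenter (Comod k A)) (V : Comod k A) :
    Hom.lin (u.app V) =
      act V.coact (.toConv ((counit : A →ₗ[k] k) ∘ₗ Hom.lin (u.app (regular k A)))) := by
  let g : A →ₗ[k] A := Hom.lin (u.app (regular k A))
  have app_cofree : Hom.lin (u.app (cofree A V)) = g.lTensor V := TensorProduct.ext' fun x a =>
    LinearMap.congr_fun (congrArg Hom.lin (u.naturality (regularToCofree (A := A) x))) a
  refine V.isCoaction.eq_act_counit_comp ?_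
  rw [← app_cofree]
  exact (congrArg Hom.lin (u.naturality (coactHom V))).symm

/-- The linear form on `A` by which a natural endomorphism of the identity functor acts. -/
def centerForm : CatCenter (Comod k A) →* WithConv (A →ₗ[k] k) where
  toFun u := .toConv ((counit : A →ₗ[k] k) ∘ₗ Hom.lin (u.app (regular k A)))
  map_one' := rfl
  map_mul' u v := act_comul_injective (k := k) (C := A) <| by
    rw [act_mul isCoaction_comul]
    exact (lin_catCenter_app (u * v) (regular k A)).symm.trans
      (congrArg₂ (· ∘ₗ ·) (lin_catCenter_app u (regular k A)) (lin_catCenter_app v (regular k A)))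

theorem lin_app_eq_act_centerForm (u : CatCenter (Comod k A)) (V : Comod k A) :
    Hom.lin (u.app V) = act V.coact (centerForm u) :=
  lin_catCenter_app u V

theorem commute_centerForm (u : CatCenter (Comod k A)) :
    Commute (convScalar A (centerForm u)) (.toConv LinearMap.id) := by
  apply commute_convScalar_of_lTensor_comp_act
  rw [LinearMap.lTensor_id, LinearMap.id_comp]
  have h := Hom.colinear (u.app (regular k A))
  rw [lin_app_eq_act_centerForm] at h
  exact h

theorem exists_centerForm_eq {τ : WithConv (A →ₗ[k] k)}
    (h : Commute (convScalar A τ) (.toConv LinearMap.id)) :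
    ∃ u : CatCenter (Comod k A), centerForm u = τ := by
  let u : CatCenter (Comod k A) :=
    { app V := ⟨act V.coact τ, by
        have colinear := V.isCoaction.lTensor_comp_act h.symm.eq
        rwa [LinearMap.lTensor_id, LinearMap.id_comp] at colinear⟩
      naturality V W f := hom_ext (act_comp_of_colinear f.colinear τ) }
  exact ⟨u, act_comul_injective (k := k) (C := A) (lin_app_eq_act_centerForm u (regular k A)).symm⟩

theorem centerForm_injective :
    Function.Injective (centerForm : CatCenter (Comod k A) →* WithConv (A →ₗ[k] k)) :=
  fun u v h => NatTrans.ext <| funext fun V => hom_ext <| by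
    rw [lin_app_eq_act_centerForm, lin_app_eq_act_centerForm, h]

theorem app_unit_eq_id_iff (u : CatCenter (Comod k A)) :
    u.app (𝟙_ (Comod k A)) = 𝟙 (𝟙_ (Comod k A)) ↔ centerForm u (1 : A) = 1 := by
  have lin_app_unit : ∀ r : k, Hom.lin (u.app (𝟙_ (Comod k A))) r = centerForm u (1 : A) * r :=
    fun r => by rw [lin_app_eq_act_centerForm]; rfl
  refine ⟨fun h => ?_, fun h => hom_ext (LinearMap.ext fun (r : k) => ?_)⟩
  · rw [← mul_one (centerForm u (1 : A)), ← lin_app_unit, h]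
    rfl
  · rw [lin_app_unit, h, one_mul]
    rfl

theorem map_centerForm_mem_Reg1L_iff (u : (CatCenter (Comod k A))ˣ) :
    Units.map centerForm u ∈ Reg1L k A ↔ u.val.app (𝟙_ (Comod k A)) = 𝟙 (𝟙_ (Comod k A)) := by
  rw [app_unit_eq_id_iff]
  exact ⟨fun h => h.1, fun h => ⟨h, commute_centerForm u.val⟩⟩

end Comod

namespace Comod

open MonoidalCategory

variable {k A : Type u} [CommRing k] [Ring A] [Bialgebra k A]

theorem lin_tensorEnd_app (θ : TensorEnd (Comod k A)) (V W : Comod k A) :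
    Hom.lin (θ.app V W) = act (outer V.coact W.coact) (.toConv
      ((counit : A ⊗[k] A →ₗ[k] k) ∘ₗ Hom.lin (θ.app (regular k A) (regular k A)))) := by
  let f : (V ⊗[k] A) ⊗[k] (W ⊗[k] A) →ₗ[k] (V ⊗[k] A) ⊗[k] (W ⊗[k] A) :=
    Hom.lin (θ.app (cofree A V) (cofree A W))
  let g : A ⊗[k] A →ₗ[k] A ⊗[k] A := Hom.lin (θ.app (regular k A) (regular k A))
  let h : V ⊗[k] W →ₗ[k] V ⊗[k] W := Hom.lin (θ.app V W)
  have comm_comp_f : (TensorProduct.tensorTensorTensorComm k V A W A).toLinearMap ∘ₗ f =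
      g.lTensor (V ⊗[k] W) ∘ₗ (TensorProduct.tensorTensorTensorComm k V A W A).toLinearMap := by
    ext x a y b
    have f_tmul : f ((x ⊗ₜ a) ⊗ₜ (y ⊗ₜ b)) =
        TensorProduct.map (TensorProduct.mk k V A x) (TensorProduct.mk k W A y) (g (a ⊗ₜ b)) :=
      LinearMap.congr_fun (congrArg Hom.lin
        (θ.tensorHom_app (regularToCofree (A := A) x) (regularToCofree (A := A) y))) (a ⊗ₜ b)
    have comm_comp_mk : (TensorProduct.tensorTensorTensorComm k V A W A).toLinearMap ∘ₗ
        TensorProduct.map (TensorProduct.mk k V A x) (TensorProduct.mk k W A y) =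
        TensorProduct.mk k (V ⊗[k] W) (A ⊗[k] A) (x ⊗ₜ y) := by
      ext; simp
    exact (congrArg (TensorProduct.tensorTensorTensorComm k V A W A) f_tmul).trans
      (LinearMap.congr_fun comm_comp_mk (g (a ⊗ₜ b)))
  have f_comp_coact : f ∘ₗ TensorProduct.map V.coact W.coact =
      TensorProduct.map V.coact W.coact ∘ₗ h :=
    congrArg Hom.lin (θ.tensorHom_app (coactHom V) (coactHom W))
  have outer_comp_h : outer V.coact W.coact ∘ₗ h =
      g.lTensor (V ⊗[k] W) ∘ₗ outer V.coact W.coact := by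
    rw [outer, LinearMap.comp_assoc, ← f_comp_coact, ← LinearMap.comp_assoc, comm_comp_f,
      LinearMap.comp_assoc]
  exact (V.isCoaction.outer_comul W.isCoaction).eq_act_counit_comp outer_comp_h

/-- The linear form on `A ⊗ A` by which a natural endomorphism of the tensor product acts. -/
def tensorForm : TensorEnd (Comod k A) →* WithConv (A ⊗[k] A →ₗ[k] k) where
  toFun θ := .toConv
    ((counit : A ⊗[k] A →ₗ[k] k) ∘ₗ Hom.lin (θ.app (regular k A) (regular k A)))
  map_one' := rfl
  map_mul' θ φ := act_comul_injective (k := k) (C := A ⊗[k] A) <| by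
    rw [act_mul isCoaction_comul]
    exact (lin_tensorEnd_app (θ * φ) (regular k A) (regular k A)).symm.trans
      (congrArg₂ (· ∘ₗ ·) (lin_tensorEnd_app θ (regular k A) (regular k A))
        (lin_tensorEnd_app φ (regular k A) (regular k A)))

theorem lin_app_eq_act_tensorForm (θ : TensorEnd (Comod k A)) (V W : Comod k A) :
    Hom.lin (θ.app V W) = act (outer V.coact W.coact) (tensorForm θ) :=
  lin_tensorEnd_app θ V W

theorem lin_app_regular_eq_act_tensorForm (θ : TensorEnd (Comod k A)) :
    Hom.lin (θ.app (regular k A) (regular k A)) =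
      act (comul (R := k) (A := A ⊗[k] A)) (tensorForm θ) :=
  lin_tensorEnd_app θ (regular k A) (regular k A)

theorem tensorForm_injective : Function.Injective
    (tensorForm : TensorEnd (Comod k A) →* WithConv (A ⊗[k] A →ₗ[k] k)) :=
  fun θ φ h => NatTrans.ext <| funext fun P => hom_ext <| by
    change Hom.lin (θ.app P.1 P.2) = Hom.lin (φ.app P.1 P.2)
    rw [lin_app_eq_act_tensorForm, lin_app_eq_act_tensorForm, h]

theorem commute_tensorForm (θ : TensorEnd (Comod k A)) :
    Commute (convScalar A (tensorForm θ)) (.toConv (LinearMap.mul' k A)) := by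
  apply commute_convScalar_of_lTensor_comp_act
  have h := Hom.colinear (θ.app (regular k A) (regular k A))
  rw [lin_app_regular_eq_act_tensorForm] at h
  exact h

theorem act_outer_comp_map {V V' W W' : Comod k A} (f : V ⟶ V') (g : W ⟶ W')
    (τ : WithConv (A ⊗[k] A →ₗ[k] k)) :
    act (outer V'.coact W'.coact) τ ∘ₗ TensorProduct.map (Hom.lin f) (Hom.lin g) =
      TensorProduct.map (Hom.lin f) (Hom.lin g) ∘ₗ act (outer V.coact W.coact) τ := by
  have colinear := outer_comp_map (g := LinearMap.id) (g' := LinearMap.id)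
    (Hom.colinear f) (Hom.colinear g)
  rw [TensorProduct.map_id] at colinear
  exact act_comp_of_colinear colinear τ

theorem exists_tensorForm_eq {τ : WithConv (A ⊗[k] A →ₗ[k] k)}
    (h : Commute (convScalar A τ) (.toConv (LinearMap.mul' k A))) :
    ∃ θ : TensorEnd (Comod k A), tensorForm θ = τ := by
  let θ : TensorEnd (Comod k A) :=
    { app P := ⟨act (outer P.1.coact P.2.coact) τ,
        (P.1.isCoaction.outer_comul P.2.isCoaction).lTensor_comp_act h.symm.eq⟩
      naturality P Q f := hom_ext (act_outer_comp_map f.1 f.2 τ) }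
  exact ⟨θ, act_comul_injective (k := k) (C := A ⊗[k] A)
    (lin_app_regular_eq_act_tensorForm θ).symm⟩

theorem exists_units_map_tensorForm_eq {σ : Conv2 k A} (h : IsLazy2 σ) :
    ∃ θ : (TensorEnd (Comod k A))ˣ, Units.map tensorForm θ = σ := by
  have h_inv : IsLazy2 σ⁻¹ :=
    Commute.units_inv_left (u := Units.map (convScalar A) σ) h
  obtain ⟨θ, hθ⟩ := exists_tensorForm_eq h
  obtain ⟨φ, hφ⟩ := exists_tensorForm_eq h_inv
  exact exists_units_map_eq tensorForm_injective hθ hφ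

section

variable {θ : TensorEnd (Comod k A)} {σ : Conv2 k A}

theorem isCocycleAt_iff (h : tensorForm θ = σ.val) (V W X : Comod k A) :
    θ.IsCocycleAt V W X ↔
      act (outer (outer V.coact W.coact) X.coact) (face12 σ * faceMulLeft σ).val =
        act (outer (outer V.coact W.coact) X.coact) (face23 σ * faceMulRight σ).val := by
  have lin_app : ∀ V W : Comod k A, act (outer V.coact W.coact) σ.val = Hom.lin (θ.app V W) :=
    fun V W => h ▸ (lin_app_eq_act_tensorForm θ V W).symm
  rw [← act_cocycle_iff V.isCoaction W.isCoaction X.isCoaction, lin_app V W, lin_app W X,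
    show act (outer (codiagonal V.coact W.coact) X.coact) σ.val = _ from
      lin_app (tensorObj V W) X,
    show act (outer V.coact (codiagonal W.coact X.coact)) σ.val = _ from lin_app V (tensorObj W X)]
  exact ⟨fun e => congrArg Hom.lin e, fun e => hom_ext e⟩

theorem forall_isCocycleAt_iff (h : tensorForm θ = σ.val) :
    (∀ V W X, θ.IsCocycleAt V W X) ↔ IsLeftCocycle σ := by
  simp only [isCocycleAt_iff h]
  refine ⟨fun hθ => Units.ext ?_, fun hσ V W X => by rw [hσ]⟩
  exact act_comul_injective (k := k) (C := (A ⊗[k] A) ⊗[k] A)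
    (hθ (regular k A) (regular k A) (regular k A))

theorem act_coact_eq_id_iff (τ : WithConv (A →ₗ[k] k)) :
    (∀ V : Comod k A, act V.coact τ = LinearMap.id) ↔ τ = 1 :=
  ⟨fun h => act_comul_injective (k := k) (C := A)
    ((h (regular k A)).trans (act_one (isCoaction_comul (k := k) (C := A))).symm),
    fun h V => h ▸ act_one V.isCoaction⟩

theorem forall_isNormalizedAt_iff (h : tensorForm θ = σ.val) :
    (∀ V, θ.IsNormalizedAt V) ↔ σ ∈ Reg2 k A := by
  have lin_app : ∀ V W : Comod k A, Hom.lin (θ.app V W) = act (outer V.coact W.coact) σ.val :=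
    fun V W => h ▸ lin_app_eq_act_tensorForm θ V W
  have app_unit_right : ∀ V : Comod k A, θ.app V (𝟙_ (Comod k A)) = 𝟙 _ ↔
      act V.coact (convPull (inlHom k A) σ.val) = LinearMap.id := fun V => by
    rw [← act_outer_trivial_eq_id_iff]
    exact ⟨fun e => (lin_app V (𝟙_ _)).symm.trans (congrArg Hom.lin e),
      fun e => hom_ext ((lin_app V (𝟙_ _)).trans e)⟩
  have app_unit_left : ∀ V : Comod k A, θ.app (𝟙_ (Comod k A)) V = 𝟙 _ ↔
      act V.coact (convPull (inrHom k A) σ.val) = LinearMap.id := fun V => by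
    rw [← act_trivial_outer_eq_id_iff]
    exact ⟨fun e => (lin_app (𝟙_ _) V).symm.trans (congrArg Hom.lin e),
      fun e => hom_ext ((lin_app (𝟙_ _) V).trans e)⟩
  refine Iff.trans ?_ (mem_reg2_iff k A σ).symm
  simp only [TensorEnd.IsNormalizedAt, app_unit_right, app_unit_left, forall_and,
    act_coact_eq_id_iff, Units.ext_iff]
  rfl

theorem mem_ZL2_iff (h : tensorForm θ = σ.val) :
    σ ∈ ZL2 k A ↔ (∀ V, θ.IsNormalizedAt V) ∧ ∀ V W X, θ.IsCocycleAt V W X := by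
  have lazy : IsLazy2 σ := by
    rw [IsLazy2, ← h]
    exact commute_tensorForm θ
  rw [forall_isNormalizedAt_iff h, forall_isCocycleAt_iff h]
  exact ⟨fun hσ => ⟨hσ.1.1, hσ.2⟩, fun hσ => ⟨⟨hσ.1, lazy⟩, hσ.2⟩⟩

end

theorem exists_units_map_centerForm_eq {μ : Conv1 k A} (h : IsLazy1 μ) :
    ∃ u : (CatCenter (Comod k A))ˣ, Units.map centerForm u = μ := by
  have h_inv : IsLazy1 μ⁻¹ := Commute.units_inv_left (u := Units.map (convScalar A) μ) h
  obtain ⟨u, hu⟩ := exists_centerForm_eq h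
  obtain ⟨v, hv⟩ := exists_centerForm_eq h_inv
  exact exists_units_map_eq centerForm_injective hu hv

theorem tensorForm_coboundary (u : (CatCenter (Comod k A))ˣ) :
    tensorForm (TensorEnd.coboundary u) =
      (LazyCohomology.coboundary (Units.map centerForm u)).val := by
  refine act_comul_injective (k := k) (C := A ⊗[k] A) ?_
  let V := regular k A
  refine (lin_app_regular_eq_act_tensorForm _).symm.trans ?_
  change ((Hom.lin (u.val.app V)).rTensor V ∘ₗ (Hom.lin (u.val.app V)).lTensor V) ∘ₗ
    Hom.lin (u⁻¹.val.app (tensorObj V V)) = _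
  rw [lin_app_eq_act_centerForm, lin_app_eq_act_centerForm]
  exact act_coboundary V.isCoaction V.isCoaction (Units.map centerForm u)

section

variable {B : Type u} [Ring B] [Bialgebra k B] (e : Comod k A ≌ Comod k B) [e.functor.Monoidal]

/-- The linear forms `σ` and `τ` act by natural endomorphisms of the tensor products that
correspond to each other under `e`. -/
def FormsCorrespond (σ : Conv2 k A) (τ : Conv2 k B) : Prop :=
  ∃ θ, tensorForm θ = σ.val ∧ tensorForm (tensorEndCongr e θ) = τ.val

theorem formsCorrespond_map (θ : (TensorEnd (Comod k A))ˣ) :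
    FormsCorrespond e (Units.map tensorForm θ)
      (Units.map tensorForm (Units.mapEquiv (tensorEndCongr e) θ)) :=
  ⟨θ.val, rfl, rfl⟩

variable {e}

theorem FormsCorrespond.mul {σ σ' : Conv2 k A} {τ τ' : Conv2 k B} (h : FormsCorrespond e σ τ)
    (h' : FormsCorrespond e σ' τ') : FormsCorrespond e (σ * σ') (τ * τ') := by
  obtain ⟨θ, hσ, hτ⟩ := h
  obtain ⟨θ', hσ', hτ'⟩ := h'
  exact ⟨θ * θ', by rw [map_mul, hσ, hσ', Units.val_mul],
    by rw [map_mul, map_mul, hτ, hτ', Units.val_mul]⟩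

theorem FormsCorrespond.unique_right {σ : Conv2 k A} {τ τ' : Conv2 k B}
    (h : FormsCorrespond e σ τ) (h' : FormsCorrespond e σ τ') : τ = τ' := by
  obtain ⟨θ, hσ, hτ⟩ := h
  obtain ⟨θ', hσ', hτ'⟩ := h'
  obtain rfl := tensorForm_injective (hσ.trans hσ'.symm)
  exact Units.ext (hτ.symm.trans hτ')

theorem FormsCorrespond.unique_left {σ σ' : Conv2 k A} {τ : Conv2 k B}
    (h : FormsCorrespond e σ τ) (h' : FormsCorrespond e σ' τ) : σ = σ' := by
  obtain ⟨θ, hσ, hτ⟩ := h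
  obtain ⟨θ', hσ', hτ'⟩ := h'
  obtain rfl := (tensorEndCongr e).injective (tensorForm_injective (hτ.trans hτ'.symm))
  exact Units.ext (hσ.symm.trans hσ')

theorem FormsCorrespond.mem_ZL2_iff {σ : Conv2 k A} {τ : Conv2 k B}
    (h : FormsCorrespond e σ τ) : σ ∈ ZL2 k A ↔ τ ∈ ZL2 k B := by
  obtain ⟨θ, hσ, hτ⟩ := h
  rw [Comod.mem_ZL2_iff hσ, Comod.mem_ZL2_iff hτ, forall_isNormalizedAt_tensorEndCongr,
    forall_isCocycleAt_tensorEndCongr]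

variable (e)

theorem formsCorrespond_coboundary (u : (CatCenter (Comod k A))ˣ) :
    FormsCorrespond e (coboundary (Units.map centerForm u))
      (coboundary (Units.map centerForm (Units.mapEquiv (catCenterCongr e) u))) :=
  ⟨TensorEnd.coboundary u, tensorForm_coboundary u, by
    rw [tensorEndCongr_coboundary]
    exact tensorForm_coboundary _⟩

theorem map_centerForm_catCenterCongr_mem_Reg1L_iff (u : (CatCenter (Comod k A))ˣ) :
    Units.map centerForm (Units.mapEquiv (catCenterCongr e) u) ∈ Reg1L k B ↔
      Units.map centerForm u ∈ Reg1L k A := by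
  rw [map_centerForm_mem_Reg1L_iff, map_centerForm_mem_Reg1L_iff]
  exact catCenterCongr_app_unit_iff e u.val

end

theorem nonempty_HL2_mulEquiv {B : Type u} [Ring B] [Bialgebra k B] (e : Comod k A ≌ Comod k B)
    [e.functor.Monoidal] : Nonempty (HL2 k A ≃* HL2 k B) := by
  refine nonempty_HL2_mulEquiv_of_rel (FormsCorrespond e) FormsCorrespond.mul
    FormsCorrespond.unique_right FormsCorrespond.unique_left (fun σ hσ => ?_) (fun τ hτ => ?_)
    (fun μ hμ => ?_) fun ν hν => ?_
  · obtain ⟨θ, rfl⟩ := exists_units_map_tensorForm_eq hσ.1.2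
    exact ⟨_, (formsCorrespond_map e θ).mem_ZL2_iff.1 hσ, formsCorrespond_map e θ⟩
  · obtain ⟨φ, rfl⟩ := exists_units_map_tensorForm_eq hτ.1.2
    obtain ⟨θ, rfl⟩ := (Units.mapEquiv (tensorEndCongr e)).surjective φ
    exact ⟨_, (formsCorrespond_map e θ).mem_ZL2_iff.2 hτ, formsCorrespond_map e θ⟩
  · obtain ⟨u, rfl⟩ := exists_units_map_centerForm_eq hμ.2
    exact ⟨_, (map_centerForm_catCenterCongr_mem_Reg1L_iff e u).2 hμ,
      formsCorrespond_coboundary e u⟩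
  · obtain ⟨v, rfl⟩ := exists_units_map_centerForm_eq hν.2
    obtain ⟨u, rfl⟩ := (Units.mapEquiv (catCenterCongr e)).surjective v
    exact ⟨_, (map_centerForm_catCenterCongr_mem_Reg1L_iff e u).1 hν,
      formsCorrespond_coboundary e u⟩

end Comod

theorem MonoidallyCoMoritaEquivalent.nonempty_HL2_mulEquiv {k A B : Type u} [CommRing k] [Ring A]
    [Bialgebra k A] [Ring B] [Bialgebra k B] (h : MonoidallyCoMoritaEquivalent k A B) :
    Nonempty (HL2 k A ≃* HL2 k B) := by
  obtain ⟨e, ⟨_⟩, -, -⟩ := h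
  exact Comod.nonempty_HL2_mulEquiv e

section Corestriction

variable {k : Type*} [CommRing k] {C D M : Type*} [AddCommGroup C] [Module k C] [Coalgebra k C]
  [AddCommGroup D] [Module k D] [Coalgebra k D] [AddCommGroup M] [Module k M]
  {δ : M →ₗ[k] M ⊗[k] C}

theorem IsCoaction.lTensor_comp (h : IsCoaction comul counit δ) (f : C →ₗc[k] D) :
    IsCoaction comul counit (f.toLinearMap.lTensor M ∘ₗ δ) where
  coassoc := by
    have assoc_comp_map : (TensorProduct.assoc k M D D).toLinearMap ∘ₗ
        TensorProduct.map (f.toLinearMap.lTensor M) f.toLinearMap =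
        (TensorProduct.map f.toLinearMap f.toLinearMap).lTensor M ∘ₗ
          (TensorProduct.assoc k M C C).toLinearMap :=
      TensorProduct.ext_threefold fun _ _ _ => rfl
    calc
      _ = ((TensorProduct.assoc k M D D).toLinearMap ∘ₗ
          TensorProduct.map (f.toLinearMap.lTensor M) f.toLinearMap) ∘ₗ δ.rTensor C ∘ₗ δ := by
        simp only [LinearMap.rTensor_comp, LinearMap.comp_assoc, ← LinearMap.rTensor_comp_lTensor]
        simp only [← LinearMap.comp_assoc (δ), LinearMap.lTensor_comp_rTensor,
          LinearMap.rTensor_comp_lTensor]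
      _ = (TensorProduct.map f.toLinearMap f.toLinearMap ∘ₗ comul).lTensor M ∘ₗ δ := by
        rw [assoc_comp_map, LinearMap.comp_assoc, h.coassoc, LinearMap.lTensor_comp,
          LinearMap.comp_assoc]
      _ = _ := by
        rw [f.map_comp_comul, LinearMap.lTensor_comp, LinearMap.comp_assoc]
  counit_comp := by
    rw [← LinearMap.comp_assoc (δ), ← LinearMap.lTensor_comp, f.counit_comp, h.counit_comp]

/-- The action of an invertible linear form on a comodule. -/
def actEquiv (h : IsCoaction comul counit δ) (τ : (WithConv (C →ₗ[k] k))ˣ) : M ≃ₗ[k] M :=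
  LinearEquiv.ofLinearMap (act δ τ.val) (act δ τ⁻¹.val)
    (by rw [← act_mul h, Units.mul_inv, act_one h]) (by rw [← act_mul h, Units.inv_mul, act_one h])

end Corestriction

namespace Comod

open MonoidalCategory Functor

variable {k A B : Type u} [CommRing k] [Ring A] [Bialgebra k A] [Ring B] [Bialgebra k B]

/-- The functor from `A`-comodules to `B`-comodules along a morphism of coalgebras. -/
def corestrict (f : A →ₗc[k] B) : Comod k A ⥤ Comod k B where
  obj V :=
    { carrier := V
      coact := f.toLinearMap.lTensor V ∘ₗ V.coact
      coassoc := (V.isCoaction.lTensor_comp f).coassoc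
      counit_comp := (V.isCoaction.lTensor_comp f).counit_comp }
  map {V W} φ := ⟨(Hom.lin φ : V →ₗ[k] W), by
    rw [LinearMap.comp_assoc, Hom.colinear φ, ← LinearMap.comp_assoc, ← LinearMap.comp_assoc,
      LinearMap.lTensor_comp_rTensor, LinearMap.rTensor_comp_lTensor]⟩

/-- Corestriction along a morphism of coalgebras and back along a left inverse of it. -/
def idIsoCorestrictComp {f : A →ₗc[k] B} {g : B →ₗc[k] A}
    (h : g.toLinearMap ∘ₗ f.toLinearMap = LinearMap.id) :
    𝟭 (Comod k A) ≅ corestrict f ⋙ corestrict g :=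
  NatIso.ofComponents fun V => isoOfLinearEquiv (.refl k V) <| by
    change g.toLinearMap.lTensor V ∘ₗ f.toLinearMap.lTensor V ∘ₗ V.coact =
      LinearMap.id.rTensor A ∘ₗ V.coact
    rw [← LinearMap.comp_assoc, ← LinearMap.lTensor_comp, h, LinearMap.lTensor_id,
      LinearMap.rTensor_id]

/-- The equivalence of categories of comodules along an isomorphism of coalgebras. -/
def corestrictEquivalence (e : A ≃ₗc[k] B) : Comod k A ≌ Comod k B where
  functor := corestrict (e : A →ₗc[k] B)
  inverse := corestrict (e.symm : B →ₗc[k] A)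
  unitIso := idIsoCorestrictComp (LinearMap.ext e.symm_apply_apply)
  counitIso := (idIsoCorestrictComp (LinearMap.ext e.apply_symm_apply)).symm

instance (f : A →ₗc[k] B) : (corestrict f).Additive where
  map_add := rfl

instance (f : A →ₗc[k] B) : (corestrict f).Linear k where
  map_smul _ _ := rfl

end Comod

variable {k : Type u} {A : Type v} {B : Type w} [CommRing k] [Ring A] [Bialgebra k A] [Ring B]
  [Bialgebra k B]

/-- The product `ω(a₁, b₁) a₂ b₂ ω⁻¹(a₃, b₃)` of the twist of `A` by `ω`. -/
def twistedMul (ω : Conv2 k A) : WithConv (A ⊗[k] A →ₗ[k] A) :=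
  convScalar A ω.val * .toConv (LinearMap.mul' k A) * convScalar A ω⁻¹.val

theorem twistedMul_mul (ω : Conv2 k A) :
    twistedMul ω * convScalar A ω.val = convScalar A ω.val * .toConv (LinearMap.mul' k A) := by
  rw [twistedMul, mul_assoc, ← map_mul, Units.inv_mul, map_one, mul_one]

section

variable {M : Type*} [AddCommGroup M] [Module k M] {δ : M →ₗ[k] M ⊗[k] A} {ω : Conv2 k A}

theorem act_outer_trivial_eq_id (h : IsCoaction comul counit δ) (hω : ω ∈ Reg2 k A) :
    act (outer δ ((TensorProduct.mk k k A).flip 1)) ω.val = LinearMap.id := by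
  rw [act_outer_trivial_eq_id_iff, show convPull (inlHom k A) ω.val = 1 from
    congrArg Units.val ((mem_reg2_iff k A ω).1 hω).1, act_one h]

theorem act_trivial_outer_eq_id (h : IsCoaction comul counit δ) (hω : ω ∈ Reg2 k A) :
    act (outer ((TensorProduct.mk k k A).flip 1) δ) ω.val = LinearMap.id := by
  rw [act_trivial_outer_eq_id_iff, show convPull (inrHom k A) ω.val = 1 from
    congrArg Units.val ((mem_reg2_iff k A ω).1 hω).2, act_one h]

end

section

variable {ω : Conv2 k A} {f : A →ₗc[k] B}
  (hf : LinearMap.mul' k B ∘ₗ TensorProduct.map f.toLinearMap f.toLinearMap =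
    f.toLinearMap ∘ₗ (twistedMul ω).ofConv)
include hf

theorem codiagonal_comp_act {M M' : Type*} [AddCommGroup M] [Module k M] [AddCommGroup M']
    [Module k M']
    {δ : M →ₗ[k] M ⊗[k] A} {δ' : M' →ₗ[k] M' ⊗[k] A} (h : IsCoaction comul counit δ)
    (h' : IsCoaction comul counit δ') :
    codiagonal (f.toLinearMap.lTensor M ∘ₗ δ) (f.toLinearMap.lTensor M' ∘ₗ δ') ∘ₗ
      act (outer δ δ') ω.val =
      (act (outer δ δ') ω.val).rTensor B ∘ₗ
        f.toLinearMap.lTensor (M ⊗[k] M') ∘ₗ codiagonal δ δ' := by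
  have outer_lTensor : outer (f.toLinearMap.lTensor M ∘ₗ δ) (f.toLinearMap.lTensor M' ∘ₗ δ') =
      (TensorProduct.map f.toLinearMap f.toLinearMap).lTensor (M ⊗[k] M') ∘ₗ outer δ δ' := by
    have h := outer_comp_map (m := LinearMap.id) (m' := LinearMap.id)
      (LinearMap.comp_id (f.toLinearMap.lTensor M ∘ₗ δ))
      (LinearMap.comp_id (f.toLinearMap.lTensor M' ∘ₗ δ'))
    rwa [TensorProduct.map_id, LinearMap.comp_id] at h
  have colinear := congrArg (f.toLinearMap.lTensor (M ⊗[k] M') ∘ₗ ·)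
    ((h.outer_comul h').lTensor_comp_act (twistedMul_mul ω))
  rw [codiagonal, outer_lTensor, ← LinearMap.comp_assoc, ← LinearMap.lTensor_comp, hf,
    LinearMap.lTensor_comp, LinearMap.comp_assoc, LinearMap.comp_assoc]
  refine colinear.trans ?_
  exact congrArg (· ∘ₗ codiagonal δ δ')
    ((LinearMap.lTensor_comp_rTensor ..).trans (LinearMap.rTensor_comp_lTensor ..).symm)

end

namespace Comod

open MonoidalCategory Functor

variable {k A B : Type u} [CommRing k] [Ring A] [Bialgebra k A] [Ring B] [Bialgebra k B]
  {ω : Conv2 k A} {f : A →ₗc[k] B}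

/-- The action of `ω` on `V ⊗ W`, as an isomorphism onto the tensor product of the corestrictions
of `V` and `W` along a map that sends the product twisted by `ω` to the product of `B`. -/
def twistIso (hf : LinearMap.mul' k B ∘ₗ TensorProduct.map f.toLinearMap f.toLinearMap =
    f.toLinearMap ∘ₗ (twistedMul ω).ofConv) (V W : Comod k A) :
    (corestrict f).obj (V ⊗ W) ≅ (corestrict f).obj V ⊗ (corestrict f).obj W :=
  isoOfLinearEquiv (V := (corestrict f).obj (tensorObj V W))
    (W := tensorObj ((corestrict f).obj V) ((corestrict f).obj W))
    (actEquiv (V.isCoaction.outer_comul W.isCoaction) ω)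
    (codiagonal_comp_act hf V.isCoaction W.isCoaction)

/-- The unit isomorphism of corestriction along a map that preserves the unit. -/
def corestrictUnitIso (hf : f 1 = 1) : (corestrict f).obj (𝟙_ (Comod k A)) ≅ 𝟙_ (Comod k B) :=
  isoOfLinearEquiv (V := (corestrict f).obj (trivial k A)) (W := trivial k B) (.refl k k) <| by
    refine LinearMap.ext_ring ?_
    change (1 : k) ⊗ₜ[k] (1 : B) = 1 ⊗ₜ f 1
    rw [hf]

/-- Corestriction along a map that sends the product twisted by a cocycle `ω` to the product of `B`,
as an oplax monoidal functor with the action of `ω` as comparison maps. -/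
@[reducible]
def corestrictOplaxMonoidal (hω : ω ∈ Reg2 k A) (cocycle : IsLeftCocycle ω) (map_one : f 1 = 1)
    (map_mul : LinearMap.mul' k B ∘ₗ TensorProduct.map f.toLinearMap f.toLinearMap =
      f.toLinearMap ∘ₗ (twistedMul ω).ofConv) : (corestrict f).OplaxMonoidal where
  η := (corestrictUnitIso map_one).hom
  δ V W := (twistIso map_mul V W).hom
  δ_natural_left φ X := hom_ext (act_outer_comp_map φ (𝟙 X) ω.val).symm
  δ_natural_right X φ := hom_ext (act_outer_comp_map (𝟙 X) φ ω.val).symm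
  oplax_associativity V W X := hom_ext <| by
    refine (act_cocycle_iff V.isCoaction W.isCoaction X.isCoaction ω).2 ?_
    rw [show face12 ω * faceMulLeft ω = _ from cocycle]
  oplax_left_unitality V := hom_ext <| by
    change (TensorProduct.lid k V).symm.toLinearMap = (LinearMap.id.rTensor V ∘ₗ
      act (outer ((TensorProduct.mk k k A).flip 1) V.coact) ω.val) ∘ₗ
        (TensorProduct.lid k V).symm.toLinearMap
    rw [act_trivial_outer_eq_id V.isCoaction hω, LinearMap.rTensor_id]
    rfl
  oplax_right_unitality V := hom_ext <| by
    change (TensorProduct.rid k V).symm.toLinearMap = (LinearMap.id.lTensor V ∘ₗ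
      act (outer V.coact ((TensorProduct.mk k k A).flip 1)) ω.val) ∘ₗ
        (TensorProduct.rid k V).symm.toLinearMap
    rw [act_outer_trivial_eq_id V.isCoaction hω, LinearMap.lTensor_id]
    rfl

/-- The oplax monoidal structure of `corestrictOplaxMonoidal` is monoidal. -/
@[reducible]
def corestrictMonoidal (hω : ω ∈ Reg2 k A) (cocycle : IsLeftCocycle ω) (map_one : f 1 = 1)
    (map_mul : LinearMap.mul' k B ∘ₗ TensorProduct.map f.toLinearMap f.toLinearMap =
      f.toLinearMap ∘ₗ (twistedMul ω).ofConv) : (corestrict f).Monoidal :=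
  letI := corestrictOplaxMonoidal hω cocycle map_one map_mul
  haveI : IsIso (OplaxMonoidal.η (corestrict f)) := (corestrictUnitIso map_one).isIso_hom
  haveI : ∀ V W, IsIso (OplaxMonoidal.δ (corestrict f) V W) :=
    fun V W => (twistIso map_mul V W).isIso_hom
  Monoidal.ofOplaxMonoidal (corestrict f)

end Comod

theorem IsCocycleTwist.monoidallyCoMoritaEquivalent {k A B : Type u} [CommRing k] [Ring A]
    [Bialgebra k A] [Ring B] [Bialgebra k B] (h : IsCocycleTwist k A B) :
    MonoidallyCoMoritaEquivalent k A B := by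
  obtain ⟨ω, hω, cocycle, e, map_one, map_mul⟩ := h
  have mul_comp_map : LinearMap.mul' k B ∘ₗ TensorProduct.map e.toLinearMap e.toLinearMap =
      e.toLinearMap ∘ₗ (twistedMul ω).ofConv := TensorProduct.ext' map_mul
  exact ⟨Comod.corestrictEquivalence e,
    ⟨Comod.corestrictMonoidal hω cocycle map_one mul_comp_map⟩,
    inferInstanceAs (Comod.corestrict (e : A →ₗc[k] B)).Additive,
    inferInstanceAs ((Comod.corestrict (e : A →ₗc[k] B)).Linear k)⟩

end LazyCohomology

end

theorem corollary3p10_general {k A B : Type u} [CommRing k] [Ring A] [Bialgebra k A] [Ring B]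
    [Bialgebra k B] :
    ((∃ (Z : Type w) (_ : Ring Z) (_ : Algebra k Z) (β : Z →ₐ[k] A ⊗[k] Z) (ρ : Z →ₐ[k] Z ⊗[k] B),
        Module.FaithfullyFlat k Z ∧ LazyCohomology.IsBiGalois β ρ) →
      Nonempty (LazyCohomology.HL2 k A ≃* LazyCohomology.HL2 k B)) ∧
    (LazyCohomology.MonoidallyCoMoritaEquivalent k A B →
      Nonempty (LazyCohomology.HL2 k A ≃* LazyCohomology.HL2 k B)) ∧
    (LazyCohomology.IsCocycleTwist k A B →
      Nonempty (LazyCohomology.HL2 k A ≃* LazyCohomology.HL2 k B)) :=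
  ⟨fun ⟨_, _, _, _, _, _, h⟩ => h.nonempty_HL2_mulEquiv, fun h => h.nonempty_HL2_mulEquiv,
    fun h => h.monoidallyCoMoritaEquivalent.nonempty_HL2_mulEquiv⟩

theorem corollary3p10 {k A B : Type u} [CommRing k] [Ring A] [HopfAlgebra k A] [Ring B]
    [HopfAlgebra k B] [Module.Flat k A] [Module.Flat k B] :
    -- a `k`-faithfully flat `A`-`B`-biGalois object yields an isomorphism of groups
    ((∃ (Z : Type w) (_ : Ring Z) (_ : Algebra k Z) (β : Z →ₐ[k] A ⊗[k] Z) (ρ : Z →ₐ[k] Z ⊗[k] B),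
        Module.FaithfullyFlat k Z ∧ LazyCohomology.IsBiGalois β ρ) →
      Nonempty (LazyCohomology.HL2 k A ≃* LazyCohomology.HL2 k B)) ∧
    -- invariance under monoidal co-Morita equivalence
    (LazyCohomology.MonoidallyCoMoritaEquivalent k A B →
      Nonempty (LazyCohomology.HL2 k A ≃* LazyCohomology.HL2 k B)) ∧
    -- invariance under cocycle twists
    (LazyCohomology.IsCocycleTwist k A B →
      Nonempty (LazyCohomology.HL2 k A ≃* LazyCohomology.HL2 k B)) :=
  corollary3p10_general
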